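/- A graph is outerplanar if it has a planar embedding in which all vertices lie on the boundary of the outer face. The $Q$-index $q(G)$ of a finite simple graph $G$ is the largest eigenvalue of its signless Laplacian matrix $D(G)+A(G)$, where $D(G)$ is the diagonal matrix of degrees and $A(G)$ is the adjacency matrix. A graph is $C_\ell$-free if it has no (not necessarily induced) subgraph isomorphic to the cycle $C_\ell$ on $\ell$ vertices. Let $n\ge 1$ and $\ell\ge 3$ be integers, let $\alpha=\lfloor\frac{n-1}{\ell-2}\rfloor$ and $r=n-1-\alpha(\ell-2)$, and let $H=K_1\vee(\alpha P_{\ell-2}\cup P_r)$ be the join of a single vertex with the disjoint union of $\alpha$ copies of the path $P_{\ell-2}$ on $\ell-2$ vertices and one path $P_r$ on $r$ vertices ($P_0$ being empty). Then $H$ is a connected outerplanar $C_\ell$-free graph of order $n$, and every connected outerplanar $C_\ell$-free graph $G$ of order $n$ satisfies $$q(G)\le q(H).$$ Moreover, unless $(n,\ell)=(4,3)$, equality holds if and only if $G\cong H$. (For $(n,\ell)=(4,3)$ uniqueness fails, since $C_4$ is also outerplanar and $C_3$-free, and $q(C_4)=4=q(K_{1,3})$.) -/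

import Mathlib

namespace OuterplanarQ

universe u v

/-! ### Planar embeddings and outerplanar graphs -/

/-- `S` is a simple arc in the plane `ℂ` with end points `a` and `b`. -/
def IsSimpleArc (S : Set ℂ) (a b : ℂ) : Prop :=
  ∃ γ : unitInterval → ℂ, Continuous γ ∧ Function.Injective γ ∧
    γ 0 = a ∧ γ 1 = b ∧ Set.range γ = S

/-- A planar embedding of a simple graph: the vertices are distinct points of the plane, each edge
is a simple arc joining its two ends, an edge passes through no vertex other than its ends, and
two distinct edges meet only in common ends. (The value of `arc` at a non-edge is irrelevant.) -/
structure PlanarEmbedding {V : Type u} (G : SimpleGraph V) where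
  point : V → ℂ
  arc : Sym2 V → Set ℂ
  point_injective : Function.Injective point
  isSimpleArc : ∀ u v : V, G.Adj u v → IsSimpleArc (arc s(u, v)) (point u) (point v)
  mem_of_point_mem : ∀ e ∈ G.edgeSet, ∀ w : V, point w ∈ arc e → w ∈ e
  inter_subset : ∀ e ∈ G.edgeSet, ∀ f ∈ G.edgeSet, e ≠ f →
    arc e ∩ arc f ⊆ point '' {w | w ∈ e ∧ w ∈ f}

namespace PlanarEmbedding

variable {V : Type u} {G : SimpleGraph V}

/-- The subset of the plane covered by the vertices and the edges. -/
def drawing (φ : PlanarEmbedding G) : Set ℂ :=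
  Set.range φ.point ∪ ⋃ e ∈ G.edgeSet, φ.arc e

/-- The outer face of an embedded (finite) graph: the unbounded connected component of the
complement of the drawing. -/
def outerFace (φ : PlanarEmbedding G) : Set ℂ :=
  {z | z ∈ φ.drawingᶜ ∧ ¬ Bornology.IsBounded (connectedComponentIn φ.drawingᶜ z)}

end PlanarEmbedding

/-- A graph is outerplanar if it has a planar embedding in which all vertices lie on the boundary
of the outer face. -/
def IsOuterplanar {V : Type u} (G : SimpleGraph V) : Prop :=
  ∃ φ : PlanarEmbedding G, ∀ w : V, φ.point w ∈ frontier φ.outerFace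

/-! ### The signless Laplacian and the `Q`-index -/

open Classical in
/-- The signless Laplacian matrix `D + A`. -/
noncomputable def signlessLaplacian {V : Type u} [Fintype V] (G : SimpleGraph V) : Matrix V V ℝ :=
  G.degMatrix ℝ + G.adjMatrix ℝ

/-- The `Q`-index: the largest eigenvalue of the signless Laplacian. -/
noncomputable def qIndex {V : Type u} [Fintype V] (G : SimpleGraph V) : ℝ :=
  sSup {μ : ℝ | ∃ x : V → ℝ, x ≠ 0 ∧ (signlessLaplacian G).mulVec x = μ • x}

/-- On a nonempty vertex set the supremum is attained, so it is the largest eigenvalue. -/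
theorem qIndex_isGreatest {V : Type u} [Fintype V] [Nonempty V] (G : SimpleGraph V) :
    IsGreatest {μ : ℝ | ∃ x : V → ℝ, x ≠ 0 ∧ (signlessLaplacian G).mulVec x = μ • x}
      (qIndex G) := by
  classical
  have hS : {μ : ℝ | ∃ x : V → ℝ, x ≠ 0 ∧ (signlessLaplacian G).mulVec x = μ • x} =
      {μ | Module.End.HasEigenvalue (Matrix.toLin' (signlessLaplacian G)) μ} := by
    ext μ
    constructor
    · rintro ⟨x, hx, h⟩
      exact Module.End.hasEigenvalue_of_hasEigenvector
        (Module.End.hasEigenvector_iff.2 ⟨Module.End.mem_eigenspace_iff.2 (by simpa using h), hx⟩)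
    · intro h
      obtain ⟨x, hx⟩ := Module.End.HasEigenvalue.exists_hasEigenvector h
      exact ⟨x, hx.2, by simpa using hx.apply_eq_smul⟩
  have hherm : (signlessLaplacian G).IsHermitian := by
    unfold signlessLaplacian
    rw [Matrix.IsHermitian, Matrix.conjTranspose_eq_transpose_of_trivial, Matrix.transpose_add]
    congr 1
    · exact G.isSymm_degMatrix ℝ
    · exact G.isSymm_adjMatrix
  have hne : {μ : ℝ | ∃ x : V → ℝ, x ≠ 0 ∧
      (signlessLaplacian G).mulVec x = μ • x}.Nonempty := by
    obtain ⟨i⟩ := ‹Nonempty V›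
    refine ⟨hherm.eigenvalues i, (hherm.eigenvectorBasis i).ofLp, ?_, ?_⟩
    · intro h
      have h1 := hherm.eigenvectorBasis.orthonormal.ne_zero i
      exact h1 (by ext j; exact congrFun h j)
    · exact hherm.mulVec_eigenvectorBasis i
  have hfin : {μ : ℝ | ∃ x : V → ℝ, x ≠ 0 ∧
      (signlessLaplacian G).mulVec x = μ • x}.Finite := by
    rw [hS]
    exact Module.End.finite_hasEigenvalue _
  exact ⟨hne.csSup_mem hfin, fun μ hμ => le_csSup hfin.bddAbove hμ⟩

/-! ### The extremal graph -/

/-- The disjoint union of `a` copies of `G`. -/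
def copies {V : Type u} (a : ℕ) (G : SimpleGraph V) : SimpleGraph (Fin a × V) where
  Adj p q := p.1 = q.1 ∧ G.Adj p.2 q.2
  symm := ⟨fun _ _ h => ⟨h.1.symm, h.2.symm⟩⟩
  loopless := ⟨fun _ h => G.irrefl h.2⟩

/-- The join of two graphs: their disjoint union with all edges between the two parts added. -/
def join {V : Type u} {W : Type v} (G : SimpleGraph V) (H : SimpleGraph W) :
    SimpleGraph (V ⊕ W) :=
  SimpleGraph.sum G H ⊔ completeBipartiteGraph V W

/-- The graph `K₁ ∨ (a P_k ∪ P_r)`. -/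
def fanGraph (a k r : ℕ) : SimpleGraph (Fin 1 ⊕ ((Fin a × Fin k) ⊕ Fin r)) :=
  join (⊤ : SimpleGraph (Fin 1))
    (SimpleGraph.sum (copies a (SimpleGraph.pathGraph k)) (SimpleGraph.pathGraph r))

end OuterplanarQ

section

open Complex Set Topology

/-! ### A parity obstruction to planarity -/

namespace OuterplanarQ

/-! Let `G` be in the class with q = q(G) ≥ q(H); it suffices to show G ≅ H, apart from the
exception with four vertices. Everything is compared at a vertex `v` where the positive eigenvector
`x` takes its maximal value 1.

Topology enters only through excluded configurations. An outerplanar graph can be drawn with one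
more vertex placed in the outer face and joined to all others, so a K₄ would give a K₅ and a theta
configuration a K₃,₃; both are refuted by a parity count of winding numbers (`no_drawing_K5`,
`no_drawing_K33`). Hence the neighbourhood of `v` induces a disjoint union of paths
(`IsOuterplanar.exists_iso_neighborSet`), any other vertex has at most two neighbours there, and
C_ℓ-freeness bounds each path by k = ℓ - 2 vertices (`part_le_of_free`).

On a path with m vertices joined to a hub of value 1 the eigenvalue equations at q are solved
explicitly. The sum S(m) of the solution is strictly convex in m (`pathSum_exchange`), so among
partitions of n - 1 into parts at most k the sum of S over the parts is largest for the greedy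
partition, the one of H (`sum_le_extremalSum`, `sum_lt_extremalSum`). A Rayleigh quotient with the
path solutions turns q ≥ q(H) into the statement that n - 1 plus this maximal sum is at most q
(`le_of_qIndex_fanGraph_le`).

If `v` is adjacent to all other vertices, pairing `x` with the path solutions gives q = n - 1 + ∑
S(m i). Two parts smaller than k would make the right side strictly smaller than the bound above, so
at most one part is not full and G ≅ H (`part_unique_of_far_eq_empty`).

It remains to show that no vertex is far from `v`. The same pairing is applied with the value
1/(q-1), that of a one-vertex path, at far vertices (`IsHubVector.sum_identity`), and compared with
the partition in which each far vertex becomes a part of size one. In the resulting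
`HubConfig.far_inequality` a far vertex with at most two neighbours around `v` contributes too
little as soon as n ≥ 7. Five and six vertices need numerical bounds and the eigenvalue equations at
individual vertices. With fewer vertices the degree bound q ≤ 2 deg v suffices, and ℓ = 3 is settled
by summing the eigenvalue equations over the neighbours of `v`. -/

theorem exists_continuous_log {X : Type*} [TopologicalSpace X] [SimplyConnectedSpace X]
    [LocallyPathConnectedSpace X] (f : X → ℂ) (hf : Continuous f) (h0 : ∀ x, f x ≠ 0) :
    ∃ g : X → ℂ, Continuous g ∧ ∀ x, exp (g x) = f x := by
  obtain ⟨x₀⟩ : Nonempty X := inferInstance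
  obtain ⟨g, ⟨-, hg⟩, -⟩ := isCoveringMapOn_exp.existsUnique_continuousMap_lifts
    (⟨f, hf⟩ : C(X, ℂ)) (a₀ := x₀) (exp_log (h0 x₀)) (fun x => h0 x)
  exact ⟨g, g.continuous, fun x => congrFun hg x⟩

/-- After a constant shift that makes the two logarithms agree at 0, both lift the same path through
the covering `exp`, so they coincide. -/
theorem log_change_unique (f g h : ℝ → ℂ) (hg : Continuous g) (hh : Continuous h)
    (hgf : ∀ x, exp (g x) = f x) (hhf : ∀ x, exp (h x) = f x) : g 1 - g 0 = h 1 - h 0 := by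
  have hf : Continuous f := by
    have : f = fun x => exp (g x) := funext fun x => (hgf x).symm
    rw [this]; fun_prop
  have h0 : ∀ x, f x ∈ ({0}ᶜ : Set ℂ) := fun x => by
    rw [← hgf x]; exact exp_ne_zero _
  obtain ⟨F, -, hF⟩ := isCoveringMapOn_exp.existsUnique_continuousMap_lifts
    (⟨f, hf⟩ : C(ℝ, ℂ)) (a₀ := 0) (hgf 0) h0
  have h1 := hF ⟨g, hg⟩ ⟨rfl, funext hgf⟩
  have h2 := hF ⟨fun x => h x + (g 0 - h 0), by fun_prop⟩ ⟨by simp, funext fun x => by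
    have e : exp (g 0 - h 0) = 1 := by
      rw [exp_sub, hgf, hhf, div_self (h0 0)]
    simp [exp_add, e, hhf]⟩
  have h3 := DFunLike.congr_fun (h1.trans h2.symm) 1
  simp only [ContinuousMap.coe_mk] at h3
  rw [h3]; ring

open Classical in
/-- The change of a continuous logarithm of `γ - w` along the path `γ`. -/
noncomputable def logChange {a b : ℂ} (γ : Path a b) (w : ℂ) : ℂ :=
  if h : ∃ g : ℝ → ℂ, Continuous g ∧ ∀ t, exp (g t) = γ.extend t - w then
    h.choose 1 - h.choose 0 else 0

theorem logChange_eq {a b : ℂ} (γ : Path a b) (w : ℂ) (g : ℝ → ℂ) (hg : Continuous g)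
    (h : ∀ t, exp (g t) = γ.extend t - w) : logChange γ w = g 1 - g 0 := by
  have hex : ∃ g : ℝ → ℂ, Continuous g ∧ ∀ t, exp (g t) = γ.extend t - w := ⟨g, hg, h⟩
  rw [logChange, dif_pos hex]
  exact log_change_unique _ _ _ hex.choose_spec.1 hg hex.choose_spec.2 h

theorem extend_mem_range {a b : ℂ} (γ : Path a b) (t : ℝ) : γ.extend t ∈ range γ := by
  rw [← Path.extend_range]; exact mem_range_self t

theorem exp_logChange {a b : ℂ} (γ : Path a b) (w : ℂ) (hw : w ∉ range γ) :
    exp (logChange γ w) = (b - w) / (a - w) := by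
  obtain ⟨g, hg, h⟩ := exists_continuous_log (fun t => γ.extend t - w)
    (by fun_prop) (fun t h => hw (by rw [← sub_eq_zero.1 h]; exact extend_mem_range γ t))
  rw [logChange_eq γ w g hg h, exp_sub, h, h]
  simp

/-- Disjointness makes γ(s) - δ(t) nonvanishing on the simply connected parameter plane, so it has a
global logarithm; its changes along the two ways round the unit square agree. -/
theorem logChange_square {a b c d : ℂ} (γ : Path a b) (δ : Path c d)
    (h : Disjoint (range γ) (range δ)) :
    logChange γ c + logChange δ b = logChange δ a + logChange γ d := by
  obtain ⟨g, hg, hgh⟩ := exists_continuous_log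
    (fun t : ℝ × ℝ => γ.extend t.1 - δ.extend t.2) (by fun_prop)
    (fun t ht => Set.disjoint_left.1 h (extend_mem_range γ t.1)
      (by rw [sub_eq_zero.1 ht]; exact extend_mem_range δ t.2))
  -- The arc δ is viewed from the ends of γ, which reverses the sign of γ - δ; the shift by πi
  -- accounts for this and cancels in every difference.
  have e : exp (Real.pi * I) = -1 := exp_pi_mul_I
  rw [logChange_eq γ c (fun t => g (t, 0)) (by fun_prop) (fun t => by simp [hgh]),
    logChange_eq γ d (fun t => g (t, 1)) (by fun_prop) (fun t => by simp [hgh]),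
    logChange_eq δ a (fun t => g (0, t) + Real.pi * I) (by fun_prop)
      (fun t => by simp [hgh, exp_add]),
    logChange_eq δ b (fun t => g (1, t) + Real.pi * I) (by fun_prop)
      (fun t => by simp [hgh, exp_add])]
  ring

/-- A logarithm of `p i - p j`, chosen so that exchanging `i < j` adds `-π I`. -/
noncomputable def pairLog {n : ℕ} (p : Fin n → ℂ) (i j : Fin n) : ℂ :=
  if i < j then log (p j - p i) + Real.pi * I else log (p i - p j)

/-- The sign of the pair `(i, j)`. -/
def pairSign {n : ℕ} (i j : Fin n) : ℤ := if i < j then 1 else -1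

theorem exp_pairLog {n : ℕ} (p : Fin n → ℂ) {i j : Fin n} (h : p i ≠ p j) :
    exp (pairLog p i j) = p i - p j := by
  unfold pairLog
  split_ifs
  · rw [exp_add, exp_pi_mul_I, exp_log (sub_ne_zero.2 h.symm)]; ring
  · rw [exp_log (sub_ne_zero.2 h)]

theorem pairLog_sub {n : ℕ} (p : Fin n → ℂ) {i j : Fin n} (h : i ≠ j) :
    pairLog p i j = pairLog p j i + pairSign i j * (Real.pi * I) := by
  unfold pairLog pairSign
  rcases lt_or_gt_of_ne h with h | h
  · simp [h, h.not_gt]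
  · simp [h, h.not_gt]

/-- Each pair of disjoint arcs gives a linear equation between the winding numbers of arcs around
vertices. -/
theorem exists_crossing_equations {n : ℕ} (p : Fin n → ℂ) (γ : ∀ i j, Path (p i) (p j)) :
    ∃ N : Fin n → Fin n → Fin n → ℤ, ∀ i j k l, Disjoint (range (γ i j)) (range (γ k l)) →
      pairSign j k - pairSign i k - pairSign j l + pairSign i l
        + 2 * (N i j k + N k l j - N k l i - N i j l) = 0 := by
  -- The change of logarithm and the difference of the fixed pair logarithms have equal
  -- exponentials, hence differ by a multiple of 2πi. The integer is chosen before the hypothesis so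
  -- that `choose` yields one total function.
  have key : ∀ i j w, ∃ m : ℤ, p w ∉ range (γ i j) →
      logChange (γ i j) (p w) = pairLog p j w - pairLog p i w + m * (2 * Real.pi * I) := by
    intro i j w
    by_cases hw : p w ∉ range (γ i j)
    · have hi : p i ≠ p w := fun h => hw (h ▸ ⟨0, by simp⟩)
      have hj : p j ≠ p w := fun h => hw (h ▸ ⟨1, by simp⟩)
      obtain ⟨m, hm⟩ := exp_eq_exp_iff_exists_int.1
        (show exp (logChange (γ i j) (p w)) = exp (pairLog p j w - pairLog p i w) by
          rw [exp_logChange _ _ hw, exp_sub, exp_pairLog p hi, exp_pairLog p hj])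
      exact ⟨m, fun _ => hm⟩
    · exact ⟨0, fun h => absurd h hw⟩
  choose N hN using key
  refine ⟨N, fun i j k l h => ?_⟩
  have mem0 : ∀ i j, p i ∈ range (γ i j) := fun i j => ⟨0, by simp⟩
  have mem1 : ∀ i j, p j ∈ range (γ i j) := fun i j => ⟨1, by simp⟩
  have hl := Set.disjoint_left.1 h
  have hr := Set.disjoint_right.1 h
  have ne : ∀ x y, p x ∈ range (γ i j) → p y ∈ range (γ k l) → x ≠ y :=
    fun x y hx hy e => hl hx (e ▸ hy)
  have sq := logChange_square (γ i j) (γ k l) h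
  rw [hN i j k (hr (mem0 _ _)), hN i j l (hr (mem1 _ _)), hN k l i (hl (mem0 _ _)),
    hN k l j (hl (mem1 _ _)), pairLog_sub p (ne j k (mem1 _ _) (mem0 _ _)),
    pairLog_sub p (ne i k (mem0 _ _) (mem0 _ _)), pairLog_sub p (ne i l (mem0 _ _) (mem1 _ _)),
    pairLog_sub p (ne j l (mem1 _ _) (mem1 _ _))] at sq
  have hpi : (Real.pi * I : ℂ) ≠ 0 := by simp [Real.pi_ne_zero]
  have : ((pairSign j k - pairSign i k - pairSign j l + pairSign i l
        + 2 * (N i j k + N k l j - N k l i - N i j l) : ℤ) : ℂ) * (Real.pi * I) = 0 := by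
    push_cast
    linear_combination sq
  exact_mod_cast (mul_eq_zero.1 this).resolve_right hpi

/-- For two vertex-disjoint edges the sign part is ±2 if they interleave as chords of a convex
pentagon and 0 otherwise. Halve the fifteen equations and add them modulo 2: every integer N occurs
exactly twice, while five pairs of chords interleave, so an odd number would be even. -/
theorem no_drawing_K5 (p : Fin 5 → ℂ) (γ : ∀ i j, Path (p i) (p j))
    (h : ∀ i j k l, i ≠ k → i ≠ l → j ≠ k → j ≠ l → i < j → k < l →
      Disjoint (range (γ i j)) (range (γ k l))) : False := by
  obtain ⟨N, hN⟩ := exists_crossing_equations p γ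
  have e : ∀ i j k l : Fin 5, i ≠ k ∧ i ≠ l ∧ j ≠ k ∧ j ≠ l ∧ i < j ∧ k < l →
      pairSign j k - pairSign i k - pairSign j l + pairSign i l
        + 2 * (N i j k + N k l j - N k l i - N i j l) = 0 := fun i j k l ⟨a, b, c, d, e, f⟩ =>
    hN i j k l (h i j k l a b c d e f)
  have e1 := e 0 1 2 3 (by decide)
  have e2 := e 0 1 2 4 (by decide)
  have e3 := e 0 1 3 4 (by decide)
  have e4 := e 0 2 1 3 (by decide)
  have e5 := e 0 2 1 4 (by decide)
  have e6 := e 0 2 3 4 (by decide)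
  have e7 := e 0 3 1 2 (by decide)
  have e8 := e 0 3 1 4 (by decide)
  have e9 := e 0 3 2 4 (by decide)
  have e10 := e 0 4 1 2 (by decide)
  have e11 := e 0 4 1 3 (by decide)
  have e12 := e 0 4 2 3 (by decide)
  have e13 := e 1 2 3 4 (by decide)
  have e14 := e 1 3 2 4 (by decide)
  have e15 := e 1 4 2 3 (by decide)
  simp [pairSign] at e1 e2 e3 e4 e5 e6 e7 e8 e9 e10 e11 e12 e13 e14 e15
  omega

/-- The vertices `0, 2, 4` form one side and `1, 3, 5` the other side of `K₃,₃`. -/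
theorem no_drawing_K33 (p : Fin 6 → ℂ) (γ : ∀ i j, Path (p i) (p j))
    (h : ∀ i ∈ ({0, 2, 4} : Finset (Fin 6)), ∀ j ∈ ({1, 3, 5} : Finset (Fin 6)),
      ∀ k ∈ ({0, 2, 4} : Finset (Fin 6)), ∀ l ∈ ({1, 3, 5} : Finset (Fin 6)), i < k → j ≠ l →
      Disjoint (range (γ i j)) (range (γ k l))) : False := by
  obtain ⟨N, hN⟩ := exists_crossing_equations p γ
  have e : ∀ i j k l : Fin 6, i ∈ ({0, 2, 4} : Finset (Fin 6)) ∧ j ∈ ({1, 3, 5} : Finset (Fin 6)) ∧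
      k ∈ ({0, 2, 4} : Finset (Fin 6)) ∧ l ∈ ({1, 3, 5} : Finset (Fin 6)) ∧ i < k ∧ j ≠ l →
      pairSign j k - pairSign i k - pairSign j l + pairSign i l
        + 2 * (N i j k + N k l j - N k l i - N i j l) = 0 := fun i j k l ⟨a, b, c, d, e, f⟩ =>
    hN i j k l (h i a j b k c l d e f)
  have e1 := e 0 1 2 3 (by decide)
  have e2 := e 0 1 2 5 (by decide)
  have e3 := e 0 3 2 1 (by decide)
  have e4 := e 0 3 2 5 (by decide)
  have e5 := e 0 5 2 1 (by decide)
  have e6 := e 0 5 2 3 (by decide)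
  have e7 := e 0 1 4 3 (by decide)
  have e8 := e 0 1 4 5 (by decide)
  have e9 := e 0 3 4 1 (by decide)
  have e10 := e 0 3 4 5 (by decide)
  have e11 := e 0 5 4 1 (by decide)
  have e12 := e 0 5 4 3 (by decide)
  have e13 := e 2 1 4 3 (by decide)
  have e14 := e 2 1 4 5 (by decide)
  have e15 := e 2 3 4 1 (by decide)
  have e16 := e 2 3 4 5 (by decide)
  have e17 := e 2 5 4 1 (by decide)
  have e18 := e 2 5 4 3 (by decide)
  -- The parity count as for K₅: each N occurs in two equations, and among the edges of K₃,₃ placed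
  -- on a hexagon only the three long diagonals interleave pairwise, which gives an odd total.
  simp [pairSign] at e1 e2 e3 e4 e5 e6 e7 e8 e9 e10 e11 e12 e13 e14 e15 e16 e17 e18
  omega

end OuterplanarQ

end

section

open Complex Set Topology

/-! ### Excluded subgraphs of outerplanar graphs -/

namespace OuterplanarQ

/-- The parity argument never uses simplicity of the arcs, so connections inside prescribed sets are
enough, and walks or hub curves with self-intersections may serve as edges. -/
theorem no_joined_K5 (p : Fin 5 → ℂ) (S : Fin 5 → Fin 5 → Set ℂ)
    (hS : ∀ i j, i < j → JoinedIn (S i j) (p i) (p j))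
    (h : ∀ i j k l, i ≠ k → i ≠ l → j ≠ k → j ≠ l → i < j → k < l →
      Disjoint (S i j) (S k l)) : False := by
  have key : ∀ i j, ∃ γ : Path (p i) (p j), i < j → range γ ⊆ S i j := by
    intro i j
    by_cases hij : i < j
    · obtain ⟨γ, hγ⟩ := hS i j hij
      exact ⟨γ, fun _ => range_subset_iff.2 hγ⟩
    · exact ⟨Path.segment _ _, fun h => absurd h hij⟩
  choose γ hγ using key
  exact no_drawing_K5 p γ fun i j k l h1 h2 h3 h4 h5 h6 =>
    (h i j k l h1 h2 h3 h4 h5 h6).mono (hγ i j h5) (hγ k l h6)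

theorem no_joined_K33 (p : Fin 6 → ℂ) (S : Fin 6 → Fin 6 → Set ℂ)
    (hS : ∀ i ∈ ({0, 2, 4} : Finset (Fin 6)), ∀ j ∈ ({1, 3, 5} : Finset (Fin 6)),
      JoinedIn (S i j) (p i) (p j))
    (h : ∀ i ∈ ({0, 2, 4} : Finset (Fin 6)), ∀ j ∈ ({1, 3, 5} : Finset (Fin 6)),
      ∀ k ∈ ({0, 2, 4} : Finset (Fin 6)), ∀ l ∈ ({1, 3, 5} : Finset (Fin 6)), i < k → j ≠ l →
      Disjoint (S i j) (S k l)) : False := by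
  have key : ∀ i j, ∃ γ : Path (p i) (p j), i ∈ ({0, 2, 4} : Finset (Fin 6)) →
      j ∈ ({1, 3, 5} : Finset (Fin 6)) → range γ ⊆ S i j := by
    intro i j
    by_cases hij : i ∈ ({0, 2, 4} : Finset (Fin 6)) ∧ j ∈ ({1, 3, 5} : Finset (Fin 6))
    · obtain ⟨γ, hγ⟩ := hS i hij.1 j hij.2
      exact ⟨γ, fun _ _ => range_subset_iff.2 hγ⟩
    · exact ⟨Path.segment _ _, fun h h' => absurd ⟨h, h'⟩ hij⟩
  choose γ hγ using key
  exact no_drawing_K33 p γ fun i hi j hj k hk l hl h1 h2 =>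
    (h i hi j hj k hk l hl h1 h2).mono (hγ i j hi hj) (hγ k l hk hl)

theorem isPathConnected_norm_gt {R : ℝ} (hR : 0 < R) : IsPathConnected {z : ℂ | R < ‖z‖} := by
  have : {z : ℂ | R < ‖z‖} = exp '' {w : ℂ | Real.log R < w.re} := by
    ext z
    constructor
    · intro hz
      have hz : R < ‖z‖ := hz
      have hz0 : z ≠ 0 := by
        rintro rfl
        simp at hz; linarith
      exact ⟨log z, by simpa [log_re] using Real.log_lt_log hR hz, exp_log hz0⟩
    · rintro ⟨w, hw, rfl⟩
      have hw : Real.log R < w.re := hw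
      simp only [mem_ofPred_eq, norm_exp]
      exact (Real.log_lt_iff_lt_exp hR).1 hw
  rw [this]
  refine IsPathConnected.image ?_ continuous_exp
  exact (convex_halfSpace_re_gt _).isPathConnected ⟨(Real.log R + 1 : ℝ), by simp⟩

variable {V : Type*} {G : SimpleGraph V}

namespace PlanarEmbedding

theorem isCompact_arc (φ : PlanarEmbedding G) {e : Sym2 V} (he : e ∈ G.edgeSet) :
    IsCompact (φ.arc e) := by
  induction e using Sym2.ind with
  | _ u v =>
    obtain ⟨γ, hγ, -, -, -, h⟩ := φ.isSimpleArc u v he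
    rw [← h]
    exact isCompact_range hγ

theorem joinedIn_arc (φ : PlanarEmbedding G) {u v : V} (h : G.Adj u v) :
    JoinedIn (φ.arc s(u, v)) (φ.point u) (φ.point v) := by
  obtain ⟨γ, hγ, -, h0, h1, h⟩ := φ.isSimpleArc u v h
  exact ⟨⟨⟨γ, hγ⟩, h0, h1⟩, fun t => h ▸ mem_range_self t⟩

theorem isCompact_drawing [Finite V] (φ : PlanarEmbedding G) : IsCompact φ.drawing :=
  (finite_range _).isCompact.union
    ((toFinite G.edgeSet).isCompact_biUnion fun _ he => φ.isCompact_arc he)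

/-- An unbounded component leaves any disc containing the drawing, and the exterior of a disc is
path connected; so there is only one unbounded component. -/
theorem joinedIn_outerFace [Finite V] (φ : PlanarEmbedding G) {x y : ℂ}
    (hx : x ∈ φ.outerFace) (hy : y ∈ φ.outerFace) : JoinedIn φ.drawingᶜ x y := by
  obtain ⟨R, hR, hD⟩ := φ.isCompact_drawing.isBounded.subset_closedBall_lt 0 0
  have hout : {z : ℂ | R < ‖z‖} ⊆ φ.drawingᶜ := fun z hz hzD => by
    have := hD hzD
    simp only [Metric.mem_closedBall, dist_zero_right] at this
    exact absurd hz (not_lt.2 this)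
  have hopen : IsOpen φ.drawingᶜ := φ.isCompact_drawing.isClosed.isOpen_compl
  have far : ∀ x ∈ φ.outerFace, ∃ y, R < ‖y‖ ∧ JoinedIn φ.drawingᶜ x y := by
    rintro x ⟨hx, hb⟩
    have : ¬ connectedComponentIn φ.drawingᶜ x ⊆ Metric.closedBall 0 R := fun h =>
      hb (Metric.isBounded_closedBall.subset h)
    obtain ⟨y, hy, hyR⟩ := not_subset.1 this
    refine ⟨y, by simpa using hyR, ?_⟩
    have hc : IsPathConnected (connectedComponentIn φ.drawingᶜ x) :=
      (hopen.connectedComponentIn.isConnected_iff_isPathConnected).1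
        (isConnected_connectedComponentIn_iff.2 hx)
    exact (hc.joinedIn x (mem_connectedComponentIn hx) y hy).mono (connectedComponentIn_subset _ _)
  obtain ⟨x', hx', hxx'⟩ := far x hx
  obtain ⟨y', hy', hyy'⟩ := far y hy
  exact hxx'.trans ((((isPathConnected_norm_gt hR).joinedIn x' hx' y' hy').mono hout).trans
    hyy'.symm)

/-- All vertices on the boundary of the outer face can be joined to a common point, each by a curve
which avoids the edges not incident to the vertex. -/
theorem exists_hub [Finite V] (φ : PlanarEmbedding G)
    (hφ : ∀ w, φ.point w ∈ frontier φ.outerFace) :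
    ∃ z : ℂ, ∀ w, JoinedIn {x | ∀ e ∈ G.edgeSet, w ∉ e → x ∉ φ.arc e} (φ.point w) z := by
  rcases isEmpty_or_nonempty V with hV | ⟨⟨w₀⟩⟩
  · exact ⟨0, fun w => (hV.false w).elim⟩
  have hne : φ.outerFace.Nonempty := by
    rw [← closure_nonempty_iff]
    exact ⟨_, frontier_subset_closure (hφ w₀)⟩
  obtain ⟨z, hz⟩ := hne
  refine ⟨z, fun w => ?_⟩
  set A : Set ℂ := ⋃ e ∈ {e | e ∈ G.edgeSet ∧ w ∉ e}, φ.arc e with hA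
  have hAc : IsCompact A := (toFinite _).isCompact_biUnion fun _ he => φ.isCompact_arc he.1
  have hset : {x | ∀ e ∈ G.edgeSet, w ∉ e → x ∉ φ.arc e} = Aᶜ := by
    ext x; simp [hA]
  have hwA : φ.point w ∈ Aᶜ := by
    rw [← hset]
    exact fun e he hw hx => hw (φ.mem_of_point_mem e he w hx)
  -- A small disc around the vertex misses all non-incident edges and contains a point of the outer
  -- face, from which the hub is reached off the drawing.
  obtain ⟨ε, hε, hball⟩ := Metric.isOpen_iff.1 hAc.isClosed.isOpen_compl _ hwA
  obtain ⟨y, hy, hdist⟩ := Metric.mem_closure_iff.1 (frontier_subset_closure (hφ w)) ε hε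
  rw [hset]
  have h1 : JoinedIn Aᶜ (φ.point w) y :=
    (((convex_ball (φ.point w) ε).isPathConnected ⟨_, Metric.mem_ball_self hε⟩).joinedIn _
      (Metric.mem_ball_self hε) y (by rwa [Metric.mem_ball, dist_comm])).mono hball
  refine h1.trans ((φ.joinedIn_outerFace hy hz).mono (compl_subset_compl.2 ?_))
  refine iUnion₂_subset fun e he => ?_
  exact (subset_biUnion_of_mem (u := fun e => φ.arc e) he.1).trans subset_union_right

end PlanarEmbedding

/-- The drawing of a graph together with one further vertex `none` joined to all others. -/
structure ConeDrawing (G : SimpleGraph V) where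
  point : Option V → ℂ
  region : Set (Option V) → Set ℂ
  joinedIn_edge : ∀ A u v, G.Adj u v → some u ∈ A → some v ∈ A →
    JoinedIn (region A) (point (some u)) (point (some v))
  joinedIn_cone : ∀ A u, some u ∈ A → none ∈ A → JoinedIn (region A) (point (some u)) (point none)
  disjoint : ∀ A B, Disjoint A B → Disjoint (region A) (region B)

theorem IsOuterplanar.coneDrawing [Finite V] (h : IsOuterplanar G) : Nonempty (ConeDrawing G) := by
  obtain ⟨φ, hφ⟩ := h
  obtain ⟨z, hz⟩ := φ.exists_hub hφ
  choose γ hγ using hz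
  -- The region of `A` consists of the edges with both ends in `A` and, if `none ∈ A`, of the hub
  -- curves from vertices in `A`. Hub curves may cross each other and the edges at their own vertex:
  -- of two disjoint vertex sets only one contains `none`, and a hub curve from `w` can meet only
  -- edges at `w`.
  refine ⟨⟨fun o => o.elim z φ.point, fun A => {x | ∃ e ∈ G.edgeSet, (∀ w ∈ e, some w ∈ A) ∧
    x ∈ φ.arc e} ∪ {x | none ∈ A ∧ ∃ w, some w ∈ A ∧ x ∈ range (γ w)}, ?_, ?_, ?_⟩⟩
  · intro A u v huv hu hv
    refine (φ.joinedIn_arc huv).mono fun x hx => Or.inl ⟨_, huv, ?_, hx⟩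
    intro w hw
    rcases Sym2.mem_iff.1 hw with rfl | rfl <;> assumption
  · exact fun A u hu hn => ⟨γ u, fun t => Or.inr ⟨hn, u, hu, mem_range_self t⟩⟩
  · intro A B hAB
    have hd : ∀ x, x ∈ A → x ∉ B := fun x hx => Set.disjoint_left.1 hAB hx
    rw [Set.disjoint_left]
    rintro x (⟨e, he, heA, hx⟩ | ⟨hn, w, hw, ⟨t, rfl⟩⟩) (⟨f, hf, hfB, hx'⟩ | ⟨hn', w', hw', hx'⟩)
    · have hef : e ≠ f := by
        rintro rfl
        induction e using Sym2.ind with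
        | _ u v => exact hd _ (heA u (Sym2.mem_mk_left _ _)) (hfB u (Sym2.mem_mk_left _ _))
      obtain ⟨w, ⟨hwe, hwf⟩, -⟩ := φ.inter_subset e he f hf hef ⟨hx, hx'⟩
      exact hd _ (heA w hwe) (hfB w hwf)
    · obtain ⟨t, rfl⟩ := hx'
      exact hγ w' t e he (fun h => hd _ (heA _ h) hw') hx
    · exact hγ w t f hf (fun h => hd _ hw (hfB _ h)) hx'
    · exact hd _ hn hn'

theorem ConeDrawing.joinedIn_walk (D : ConeDrawing G) (A : Set (Option V)) {u v : V}
    (p : G.Walk u v) (h : ∀ x ∈ p.support, some x ∈ A) (hne : u ≠ v) :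
    JoinedIn (D.region A) (D.point (some u)) (D.point (some v)) := by
  induction p with
  | nil => exact absurd rfl hne
  | @cons u w v huw q ih =>
    have h1 : JoinedIn (D.region A) (D.point (some u)) (D.point (some w)) :=
      D.joinedIn_edge A u w huw (h _ (by simp)) (h _ (by simp))
    by_cases hwv : w = v
    · exact hwv ▸ h1
    · exact h1.trans (ih (fun x hx => h x (by simp [hx])) hwv)

/-- The cone over K₄ is K₅. -/
theorem IsOuterplanar.no_K4 [Finite V] (h : IsOuterplanar G) {a b c d : V} (hab : G.Adj a b)
    (hac : G.Adj a c) (had : G.Adj a d) (hbc : G.Adj b c) (hbd : G.Adj b d) (hcd : G.Adj c d) :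
    False := by
  obtain ⟨D⟩ := h.coneDrawing
  let x : Fin 5 → Option V := ![some a, some b, some c, some d, none]
  have hx : Function.Injective x := by
    intro i j hij
    have := hab.ne; have := hac.ne; have := had.ne; have := hbc.ne; have := hbd.ne; have := hcd.ne
    fin_cases i <;> fin_cases j <;> simp_all [x]
  refine no_joined_K5 (fun i => D.point (x i)) (fun i j => D.region {x i, x j}) ?_ ?_
  · intro i j hij
    fin_cases i <;> fin_cases j <;> first
      | exact absurd hij (by decide)
      | exact D.joinedIn_edge _ _ _ (by assumption) (by simp [x]) (by simp [x])
      | exact D.joinedIn_cone _ _ (by simp [x]) (by simp [x])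
  · intro i j k l h1 h2 h3 h4 _ _
    refine D.disjoint _ _ ?_
    simp [hx.eq_iff, h1.symm, h2.symm, h3.symm, h4.symm]

/-- An outerplanar graph has no two vertices `u`, `w` joined by three internally disjoint paths with
inner vertices, two of which consist of one inner vertex each. -/
theorem IsOuterplanar.no_theta [Finite V] (h : IsOuterplanar G) {u w a b c : V}
    (huw : u ≠ w) (hab : a ≠ b) (hua : G.Adj u a) (hub : G.Adj u b) (hwa : G.Adj w a)
    (hwb : G.Adj w b) (huc : G.Adj u c) (p : G.Walk w c) (hwc : w ≠ c)
    (hp : ∀ x ∈ p.support, x ≠ u ∧ x ≠ a ∧ x ≠ b) : False := by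
  obtain ⟨D⟩ := h.coneDrawing
  -- The sides of K₃,₃ are `u`, `w`, the apex and `a`, `b`, `c`; the connection from `w` to `c` runs
  -- along the walk `p`, so its region is the one of the whole support.
  let x : Fin 6 → Option V := ![some u, some a, some w, some b, none, some c]
  have hc := hp c (by simp)
  have hw := hp w (by simp)
  let B : Set (Option V) := {y | ∃ z ∈ p.support, y = some z}
  let A : Fin 6 → Fin 6 → Set (Option V) := fun i j => if i = 2 ∧ j = 5 then B else {x i, x j}
  refine no_joined_K33 (fun i => D.point (x i)) (fun i j => D.region (A i j)) ?_ ?_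
  · intro i hi j hj
    simp only [Finset.mem_insert, Finset.mem_singleton] at hi hj
    rcases hi with rfl | rfl | rfl <;> rcases hj with rfl | rfl | rfl
    · exact D.joinedIn_edge _ _ _ hua (by simp [A, x]) (by simp [A, x])
    · exact D.joinedIn_edge _ _ _ hub (by simp [A, x]) (by simp [A, x])
    · exact D.joinedIn_edge _ _ _ huc (by simp [A, x]) (by simp [A, x])
    · exact D.joinedIn_edge _ _ _ hwa (by simp [A, x]) (by simp [A, x])
    · exact D.joinedIn_edge _ _ _ hwb (by simp [A, x]) (by simp [A, x])
    · exact D.joinedIn_walk _ p (fun y hy => by simpa [A, B] using hy) hwc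
    · exact (D.joinedIn_cone _ a (by simp [A, x]) (by simp [A, x])).symm
    · exact (D.joinedIn_cone _ b (by simp [A, x]) (by simp [A, x])).symm
    · exact (D.joinedIn_cone _ c (by simp [A, x]) (by simp [A, x])).symm
  · intro i hi j hj k hk l hl hik hjl
    have e1 := hua.ne; have e2 := hub.ne; have e3 := hwa.ne; have e4 := hwb.ne; have e5 := huc.ne
    have hu' : u ∉ p.support := fun h => (hp u h).1 rfl
    have ha' : a ∉ p.support := fun h => (hp a h).2.1 rfl
    have hb' : b ∉ p.support := fun h => (hp b h).2.2 rfl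
    refine D.disjoint _ _ ?_
    simp only [Finset.mem_insert, Finset.mem_singleton] at hi hj hk hl
    rcases hi with rfl | rfl | rfl <;> rcases hk with rfl | rfl | rfl <;>
      first
      | exact absurd hik (by decide)
      | rcases hj with rfl | rfl | rfl <;> rcases hl with rfl | rfl | rfl <;>
        first
        | exact absurd rfl hjl
        | simp_all [A, x, B, Set.disjoint_left, eq_comm]

end OuterplanarQ

end

section

open Complex Set Topology

/-! ### Outerplanarity of subgraphs of fans -/

namespace OuterplanarQ

theorem mem_segment_I {z : ℂ} {x : ℕ} (h : z ∈ segment ℝ I (x : ℂ)) :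
    0 ≤ z.im ∧ z.im ≤ 1 ∧ z.re = (1 - z.im) * x := by
  obtain ⟨s, t, hs, ht, hst, rfl⟩ := h
  obtain rfl : t = 1 - s := by linarith
  simp; constructor <;> linarith

theorem mem_segment_nat {z : ℂ} {x : ℕ} (h : z ∈ segment ℝ (x : ℂ) ((x + 1 : ℕ) : ℂ)) :
    z.im = 0 ∧ x ≤ z.re ∧ z.re ≤ x + 1 := by
  obtain ⟨s, t, hs, ht, hst, rfl⟩ := h
  obtain rfl : t = 1 - s := by linarith
  simp; constructor <;> nlinarith

variable {V : Type*} {G : SimpleGraph V}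

section fan

variable (v₀ : V) (pos : V → ℕ)

open Classical in
/-- The point `I` for the hub `v₀`, and points on the real axis for the other vertices. -/
noncomputable def fanPoint (w : V) : ℂ := if w = v₀ then I else (pos w : ℂ)

/-- Edges are drawn as segments. -/
noncomputable def fanArc (e : Sym2 V) : Set ℂ :=
  Sym2.lift ⟨fun u v => segment ℝ (fanPoint v₀ pos u) (fanPoint v₀ pos v),
    fun _ _ => segment_symm _ _ _⟩ e

variable {v₀ pos}

theorem fanPoint_hub : fanPoint v₀ pos v₀ = I := if_pos rfl

theorem fanPoint_of_ne {w : V} (h : w ≠ v₀) : fanPoint v₀ pos w = (pos w : ℂ) := if_neg h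

theorem fan_edge_cases (hadj : ∀ u v, G.Adj u v → u ≠ v₀ → v ≠ v₀ →
      pos u + 1 = pos v ∨ pos v + 1 = pos u) {e : Sym2 V} (he : e ∈ G.edgeSet) :
    (∃ u, u ≠ v₀ ∧ e = s(v₀, u)) ∨ ∃ u v, u ≠ v₀ ∧ v ≠ v₀ ∧ pos v = pos u + 1 ∧ e = s(u, v) := by
  induction e using Sym2.ind with
  | _ u v =>
    have he : G.Adj u v := he
    by_cases hu : u = v₀
    · exact Or.inl ⟨v, fun h => he.ne (hu.trans h.symm), by rw [hu]⟩
    by_cases hv : v = v₀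
    · exact Or.inl ⟨u, hu, by rw [hv, Sym2.eq_swap]⟩
    rcases hadj u v he hu hv with h | h
    · exact Or.inr ⟨u, v, hu, hv, h.symm, rfl⟩
    · exact Or.inr ⟨v, u, hv, hu, h.symm, Sym2.eq_swap⟩

theorem mem_fanArc_hub {u : V} (hu : u ≠ v₀) {z : ℂ} (h : z ∈ fanArc v₀ pos s(v₀, u)) :
    0 ≤ z.im ∧ z.im ≤ 1 ∧ z.re = (1 - z.im) * pos u := by
  refine mem_segment_I ?_
  simpa [fanArc, fanPoint_hub, fanPoint_of_ne hu] using h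

theorem mem_fanArc_path {u v : V} (hu : u ≠ v₀) (hv : v ≠ v₀) (huv : pos v = pos u + 1) {z : ℂ}
    (h : z ∈ fanArc v₀ pos s(u, v)) : z.im = 0 ∧ pos u ≤ z.re ∧ z.re ≤ pos u + 1 := by
  refine mem_segment_nat ?_
  simpa [fanArc, fanPoint_of_ne hv, fanPoint_of_ne hu, huv] using h

theorem eq_fanPoint_of_im {u : V} (hu : u ≠ v₀) {z : ℂ} (h : z.im = 0) (h' : z.re = pos u) :
    z = fanPoint v₀ pos u := by
  rw [fanPoint_of_ne hu]
  apply Complex.ext <;> simp [h, h']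

theorem fanPoint_injective (hpos : ∀ u v, u ≠ v₀ → v ≠ v₀ → pos u = pos v → u = v) :
    Function.Injective (fanPoint v₀ pos) := by
  intro u v h
  unfold fanPoint at h
  split_ifs at h with h1 h2 h2
  · rw [h1, h2]
  · simpa using congrArg Complex.im h
  · simpa using congrArg Complex.im h
  · exact hpos u v h1 h2 (by exact_mod_cast h)

theorem fan_mem_of_point_mem (hpos : ∀ u v, u ≠ v₀ → v ≠ v₀ → pos u = pos v → u = v)
    (hadj : ∀ u v, G.Adj u v → u ≠ v₀ → v ≠ v₀ → pos u + 1 = pos v ∨ pos v + 1 = pos u)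
    {e : Sym2 V} (he : e ∈ G.edgeSet) {w : V} (h : fanPoint v₀ pos w ∈ fanArc v₀ pos e) :
    w ∈ e := by
  by_cases hw : w = v₀
  · rcases fan_edge_cases hadj he with ⟨u, hu, rfl⟩ | ⟨u, v, hu, hv, huv, rfl⟩
    · simp [hw]
    · have := (mem_fanArc_path hu hv huv h).1
      simp [hw, fanPoint_hub] at this
  · rw [fanPoint_of_ne hw] at h
    rcases fan_edge_cases hadj he with ⟨u, hu, rfl⟩ | ⟨u, v, hu, hv, huv, rfl⟩
    · have := (mem_fanArc_hub hu h).2.2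
      simp only [natCast_re, natCast_im, sub_zero, one_mul, Nat.cast_inj] at this
      simp [hpos w u hw hu this]
    · obtain ⟨-, h1, h2⟩ := mem_fanArc_path hu hv huv h
      simp only [natCast_re] at h1 h2
      have h1 : pos u ≤ pos w := by exact_mod_cast h1
      have h2 : pos w ≤ pos u + 1 := by exact_mod_cast h2
      rcases Nat.lt_or_ge (pos u) (pos w) with h3 | h3
      · simp [hpos w v hw hv (by omega)]
      · simp [hpos w u hw hu (by omega)]

/-- A graph with a vertex `v₀` whose removal leaves a subgraph of a path has a straight-line
embedding. -/
noncomputable def fanEmbedding (hpos : ∀ u v, u ≠ v₀ → v ≠ v₀ → pos u = pos v → u = v)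
    (hadj : ∀ u v, G.Adj u v → u ≠ v₀ → v ≠ v₀ → pos u + 1 = pos v ∨ pos v + 1 = pos u) :
    PlanarEmbedding G where
  point := fanPoint v₀ pos
  arc := fanArc v₀ pos
  point_injective := fanPoint_injective hpos
  isSimpleArc u v h :=
    ⟨Path.segment (fanPoint v₀ pos u) (fanPoint v₀ pos v), by fun_prop,
      Path.segment_injective_of_ne ((fanPoint_injective hpos).ne h.ne), by simp, by simp,
      Path.range_segment _ _⟩
  mem_of_point_mem e he w h := fan_mem_of_point_mem hpos hadj he h
  inter_subset := by
    have hub_path : ∀ u, u ≠ v₀ → ∀ a b, a ≠ v₀ → b ≠ v₀ → pos b = pos a + 1 →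
        s(a, b) ∈ G.edgeSet → ∀ z, z ∈ fanArc v₀ pos s(v₀, u) → z ∈ fanArc v₀ pos s(a, b) →
        z = fanPoint v₀ pos u ∧ u ∈ s(a, b) := by
      intro u hu a b ha hb hab he z hz hz'
      obtain ⟨-, -, h1⟩ := mem_fanArc_hub hu hz
      obtain ⟨h2, -⟩ := mem_fanArc_path ha hb hab hz'
      have hzu := eq_fanPoint_of_im hu h2 (by rw [h1, h2]; ring)
      exact ⟨hzu, fan_mem_of_point_mem hpos hadj he (hzu ▸ hz')⟩
    have path_path : ∀ a b a' b', a ≠ v₀ → b ≠ v₀ → pos b = pos a + 1 → a' ≠ v₀ → b' ≠ v₀ →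
        pos b' = pos a' + 1 → pos a < pos a' → ∀ z, z ∈ fanArc v₀ pos s(a, b) →
        z ∈ fanArc v₀ pos s(a', b') → z = fanPoint v₀ pos b ∧ b = a' := by
      intro a b a' b' ha hb hab ha' hb' hab' hlt z hz hz'
      obtain ⟨h1, h2, h3⟩ := mem_fanArc_path ha hb hab hz
      obtain ⟨-, h5, h6⟩ := mem_fanArc_path ha' hb' hab' hz'
      have h7 : (pos a' : ℝ) ≤ pos a + 1 := h5.trans h3
      have h8 : pos a' ≤ pos a + 1 := by exact_mod_cast h7
      have h9 : pos a' = pos b := by omega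
      refine ⟨eq_fanPoint_of_im hb h1 ?_, hpos b a' hb ha' h9.symm⟩
      rw [h9] at h5
      refine le_antisymm ?_ h5
      rw [hab]; push_cast; exact h3
    intro e he f hf hef z hz
    obtain ⟨hz, hz'⟩ := hz
    rcases fan_edge_cases hadj he with ⟨u, hu, rfl⟩ | ⟨u, v, hu, hv, huv, rfl⟩ <;>
      rcases fan_edge_cases hadj hf with ⟨u', hu', rfl⟩ | ⟨u', v', hu', hv', huv', rfl⟩
    · have huu : u ≠ u' := fun h => hef (by rw [h])
      obtain ⟨-, -, h1⟩ := mem_fanArc_hub hu hz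
      obtain ⟨-, -, h2⟩ := mem_fanArc_hub hu' hz'
      have hne : (pos u : ℝ) - (pos u' : ℝ) ≠ 0 := fun h =>
        huu (hpos u u' hu hu' (by exact_mod_cast sub_eq_zero.1 h))
      have hmul : (1 - z.im) * ((pos u : ℝ) - (pos u' : ℝ)) = 0 := by linear_combination h2 - h1
      have him : 1 - z.im = 0 := (mul_eq_zero.1 hmul).resolve_right hne
      refine ⟨v₀, by simp, ?_⟩
      rw [fanPoint_hub]
      apply Complex.ext
      · rw [h1, him]; simp
      · simp; linarith
    · obtain ⟨h1, h2⟩ := hub_path u hu u' v' hu' hv' huv' hf z hz hz'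
      exact ⟨u, ⟨by simp, h2⟩, h1.symm⟩
    · obtain ⟨h1, h2⟩ := hub_path u' hu' u v hu hv huv he z hz' hz
      exact ⟨u', ⟨h2, by simp⟩, h1.symm⟩
    · rcases lt_trichotomy (pos u) (pos u') with h | h | h
      · obtain ⟨h1, h2⟩ := path_path u v u' v' hu hv huv hu' hv' huv' h z hz hz'
        exact ⟨v, ⟨by simp, by simp [h2]⟩, h1.symm⟩
      · exact absurd (by rw [hpos u u' hu hu' h, hpos v v' hv hv' (by omega)]) hef
      · obtain ⟨h1, h2⟩ := path_path u' v' u v hu' hv' huv' hu hv huv h z hz' hz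
        exact ⟨v', ⟨by simp [h2], by simp⟩, h1.symm⟩

theorem mem_fanEmbedding_drawing (hpos : ∀ u v, u ≠ v₀ → v ≠ v₀ → pos u = pos v → u = v)
    (hadj : ∀ u v, G.Adj u v → u ≠ v₀ → v ≠ v₀ → pos u + 1 = pos v ∨ pos v + 1 = pos u) {z : ℂ}
    (hz : z ∈ (fanEmbedding hpos hadj).drawing) : 0 ≤ z.im ∧ z.im ≤ 1 := by
  rcases hz with ⟨w, rfl⟩ | hz
  · by_cases hw : w = v₀
    · simp [fanEmbedding, hw, fanPoint_hub]
    · simp [fanEmbedding, fanPoint_of_ne hw]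
  · simp only [mem_iUnion] at hz
    obtain ⟨e, he, hz⟩ := hz
    rcases fan_edge_cases hadj he with ⟨u, hu, rfl⟩ | ⟨u, v, hu, hv, huv, rfl⟩
    · exact ⟨(mem_fanArc_hub hu hz).1, (mem_fanArc_hub hu hz).2.1⟩
    · simp [(mem_fanArc_path hu hv huv hz).1]

theorem PlanarEmbedding.subset_outerFace (φ : PlanarEmbedding G) {A : Set ℂ}
    (hA : IsPreconnected A) (hb : ¬ Bornology.IsBounded A) (hd : A ⊆ φ.drawingᶜ) :
    A ⊆ φ.outerFace := fun _ hz =>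
  ⟨hd hz, fun h => hb (h.subset (hA.subset_connectedComponentIn hz hd))⟩

/-- The drawing lies in the strip 0 ≤ Im z ≤ 1, so the half-planes below and above it belong to the
outer face. The hub `I` is on the boundary of the upper one, all other vertices on that of the lower
one. -/
theorem isOuterplanar_of_fan (hpos : ∀ u v, u ≠ v₀ → v ≠ v₀ → pos u = pos v → u = v)
    (hadj : ∀ u v, G.Adj u v → u ≠ v₀ → v ≠ v₀ → pos u + 1 = pos v ∨ pos v + 1 = pos u) :
    IsOuterplanar G := by
  refine ⟨fanEmbedding hpos hadj, fun w => ?_⟩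
  set φ := fanEmbedding hpos hadj with hφ
  have low : {z : ℂ | z.im < 0} ⊆ φ.outerFace := by
    refine φ.subset_outerFace (convex_halfSpace_im_lt _).isPreconnected ?_ ?_
    · intro hb
      obtain ⟨C, hC⟩ := hb.exists_norm_le
      have := hC (-(|C| + 1 : ℝ) * I) (by simp; linarith [abs_nonneg C])
      rw [norm_mul, norm_I, mul_one, norm_neg, norm_real, Real.norm_eq_abs,
        abs_of_pos (by positivity)] at this
      linarith [le_abs_self C]
    · exact fun _ hz hzd =>
        absurd (mem_fanEmbedding_drawing hpos hadj hzd).1 (not_le.2 hz)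
  have high : {z : ℂ | 1 < z.im} ⊆ φ.outerFace := by
    refine φ.subset_outerFace (convex_halfSpace_im_gt _).isPreconnected ?_ ?_
    · intro hb
      obtain ⟨C, hC⟩ := hb.exists_norm_le
      have := hC ((|C| + 2 : ℝ) * I) (by simp; linarith [abs_nonneg C])
      rw [norm_mul, norm_I, mul_one, norm_real, Real.norm_eq_abs,
        abs_of_pos (by positivity)] at this
      linarith [le_abs_self C]
    · exact fun _ hz hzd =>
        absurd (mem_fanEmbedding_drawing hpos hadj hzd).2 (not_le.2 hz)
  have hnot : φ.point w ∉ φ.outerFace := fun h => h.1 (Or.inl ⟨w, rfl⟩)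
  refine ⟨?_, fun h => hnot (interior_subset h)⟩
  by_cases hw : w = v₀
  · have : φ.point w = I := by rw [hw]; exact fanPoint_hub
    refine closure_mono high ?_
    rw [closure_setOfPred_lt_im, this]
    simp
  · have : φ.point w = (pos w : ℂ) := fanPoint_of_ne hw
    refine closure_mono low ?_
    rw [closure_setOfPred_im_lt, this]
    simp

end fan

end OuterplanarQ

end

section

/-! ### Spectral estimates -/

namespace OuterplanarQ

open Finset

variable {V : Type*} [Fintype V] {G : SimpleGraph V}

open Classical in
/-- The signless Laplacian as an operator: `(Q x)_u = ∑_{w ∼ u} (x_u + x_w)`. -/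
noncomputable def qOp (G : SimpleGraph V) (x : V → ℝ) (u : V) : ℝ :=
  ∑ w with G.Adj u w, (x u + x w)

theorem mulVec_signlessLaplacian (x : V → ℝ) : (signlessLaplacian G).mulVec x = qOp G x := by
  classical
  ext u
  simp only [signlessLaplacian, qOp, Matrix.add_mulVec, Pi.add_apply,
    SimpleGraph.degMatrix_mulVec_apply, SimpleGraph.adjMatrix_mulVec_apply, sum_add_distrib,
    sum_const, nsmul_eq_mul, SimpleGraph.neighborFinset_eq_filter,
    ← SimpleGraph.card_neighborFinset_eq_degree]

theorem qOp_eq_ite [DecidableRel G.Adj] (x : V → ℝ) (u : V) :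
    qOp G x u = ∑ w, if G.Adj u w then x u + x w else 0 := by
  rw [qOp, sum_filter]
  exact sum_congr rfl fun w _ => by congr

theorem sum_mul_qOp_comm (x y : V → ℝ) : ∑ u, y u * qOp G x u = ∑ u, x u * qOp G y u := by
  classical
  have h : ∀ x y : V → ℝ, ∑ u, y u * qOp G x u =
      ∑ u, ∑ w, if G.Adj u w then x u * y u + x w * y u else 0 := by
    intro x y
    refine sum_congr rfl fun u _ => ?_
    rw [qOp_eq_ite, mul_sum]
    refine sum_congr rfl fun w _ => ?_
    split_ifs <;> ring
  have h2 : ∀ x y : V → ℝ, (∑ u, ∑ w, if G.Adj u w then x u * y u + x w * y u else 0) =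
      (∑ u, ∑ w, if G.Adj u w then x u * y u else 0) +
      ∑ u, ∑ w, if G.Adj u w then x w * y u else 0 := by
    intro x y
    simp only [← sum_add_distrib]
    refine sum_congr rfl fun u _ => sum_congr rfl fun w _ => ?_
    split_ifs <;> ring
  rw [h, h, h2, h2]
  congr 1
  · exact sum_congr rfl fun u _ => sum_congr rfl fun w _ => by rw [mul_comm]
  · rw [sum_comm]
    exact sum_congr rfl fun u _ => sum_congr rfl fun w _ => by rw [G.adj_comm, mul_comm]

theorem isHermitian_signlessLaplacian : (signlessLaplacian G).IsHermitian := by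
  classical
  unfold signlessLaplacian
  exact (SimpleGraph.isHermitian_degMatrix ..).add (SimpleGraph.isHermitian_adjMatrix ..)

open Classical in
theorem posSemidef_qIndex_sub :
    (qIndex G • (1 : Matrix V V ℝ) - signlessLaplacian G).PosSemidef := by
  have hH : (qIndex G • (1 : Matrix V V ℝ) - signlessLaplacian G).IsHermitian :=
    ((Matrix.isHermitian_one (n := V) (α := ℝ)).smul (k := qIndex G)
      (IsSelfAdjoint.all _)).sub isHermitian_signlessLaplacian
  rw [hH.posSemidef_iff_eigenvalues_nonneg]
  intro i
  have : Nonempty V := ⟨i⟩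
  have hne : (hH.eigenvectorBasis i).ofLp ≠ 0 := by
    intro h
    exact hH.eigenvectorBasis.orthonormal.ne_zero i (by ext j; exact congrFun h j)
  have h := hH.mulVec_eigenvectorBasis i
  rw [Matrix.sub_mulVec, Matrix.smul_mulVec, Matrix.one_mulVec] at h
  have h2 : (signlessLaplacian G).mulVec (hH.eigenvectorBasis i).ofLp =
      (qIndex G - hH.eigenvalues i) • (hH.eigenvectorBasis i).ofLp := by
    rw [sub_smul, ← h]; abel
  have := (qIndex_isGreatest G).2 ⟨_, hne, h2⟩
  simp only [Pi.zero_apply]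
  linarith

open Classical in
theorem dotProduct_qIndex_sub (x : V → ℝ) :
    star x ⬝ᵥ (qIndex G • (1 : Matrix V V ℝ) - signlessLaplacian G).mulVec x =
      qIndex G * ∑ u, x u ^ 2 - ∑ u, x u * qOp G x u := by
  rw [Matrix.sub_mulVec, Matrix.smul_mulVec, Matrix.one_mulVec, mulVec_signlessLaplacian,
    dotProduct_sub, dotProduct_smul, smul_eq_mul]
  simp [dotProduct, pow_two]

/-- The Rayleigh bound. Together with its equality case below it replaces any further use of
eigenvalues: everything later is a computation with `qOp`. -/
theorem sum_mul_qOp_le (x : V → ℝ) : ∑ u, x u * qOp G x u ≤ qIndex G * ∑ u, x u ^ 2 := by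
  classical
  have h := (posSemidef_qIndex_sub (G := G)).dotProduct_mulVec_nonneg x
  have h2 := dotProduct_qIndex_sub (G := G) x
  have : 0 ≤ qIndex G * ∑ u, x u ^ 2 - ∑ u, x u * qOp G x u := by
    rw [← h2]; exact h
  linarith

theorem qOp_eq_of_sum_eq (x : V → ℝ) (h : ∑ u, x u * qOp G x u = qIndex G * ∑ u, x u ^ 2)
    (u : V) : qOp G x u = qIndex G * x u := by
  classical
  have h2 := dotProduct_qIndex_sub (G := G) x
  rw [h, sub_self] at h2
  have h3 := (posSemidef_qIndex_sub (G := G)).dotProduct_mulVec_zero_iff x |>.1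
    (by rw [← h2])
  rw [Matrix.sub_mulVec, Matrix.smul_mulVec, Matrix.one_mulVec, mulVec_signlessLaplacian] at h3
  have := congrFun h3 u
  simp only [Pi.sub_apply, Pi.smul_apply, smul_eq_mul, Pi.zero_apply] at this
  linarith

theorem lt_qIndex_of_le_qOp {c : ℝ} {z : V → ℝ} (hz : ∀ u, 0 ≤ z u)
    (h : ∀ u, c * z u ≤ qOp G z u) {v : V} (hv : 0 < z v) (hlt : c * z v < qOp G z v) :
    c < qIndex G := by
  have h1 : ∑ u, z u * (c * z u) < ∑ u, z u * qOp G z u :=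
    sum_lt_sum (fun u _ => mul_le_mul_of_nonneg_left (h u) (hz u))
      ⟨v, mem_univ _, mul_lt_mul_of_pos_left hlt hv⟩
  have h2 : ∑ u, z u * (c * z u) = c * ∑ u, z u ^ 2 := by
    rw [mul_sum]; exact sum_congr rfl fun u _ => by ring
  have h3 : 0 < ∑ u, z u ^ 2 :=
    sum_pos' (fun u _ => sq_nonneg _) ⟨v, mem_univ _, by positivity⟩
  have h4 := sum_mul_qOp_le (G := G) z
  rw [h2] at h1
  exact lt_of_mul_lt_mul_right (h1.trans_le h4) h3.le

/-- Perron–Frobenius: the absolute values of an eigenvector for the largest eigenvalue also attain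
the Rayleigh bound, hence form an eigenvector; a zero would spread along edges to the whole
connected graph. Dividing by the maximum normalises the vector. -/
theorem exists_positive_eigenvector (hG : G.Connected) :
    ∃ (x : V → ℝ) (v : V), (∀ u, 0 < x u) ∧ x v = 1 ∧ (∀ u, x u ≤ 1) ∧
      ∀ u, qOp G x u = qIndex G * x u := by
  classical
  have := hG.nonempty
  obtain ⟨x, hx0, hx⟩ := (qIndex_isGreatest G).1
  rw [mulVec_signlessLaplacian] at hx
  have hx : ∀ u, qOp G x u = qIndex G * x u := fun u => congrFun hx u
  set y : V → ℝ := fun u => |x u| with hy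
  have hyq : ∀ u, qOp G y u = qIndex G * y u := by
    refine qOp_eq_of_sum_eq y (le_antisymm (sum_mul_qOp_le y) ?_)
    have h1 : qIndex G * ∑ u, y u ^ 2 = ∑ u, x u * qOp G x u := by
      rw [mul_sum]
      refine sum_congr rfl fun u _ => ?_
      rw [hx, hy]
      simp only [sq_abs]; ring
    rw [h1]
    refine sum_le_sum fun u _ => ?_
    rw [qOp, qOp, mul_sum, mul_sum]
    refine sum_le_sum fun w _ => ?_
    simp only [hy, mul_add]
    exact add_le_add (abs_mul_abs_self _).ge ((le_abs_self _).trans (abs_mul _ _).le)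
  have hy0 : ∀ u, 0 ≤ y u := fun u => abs_nonneg _
  have hzero : ∀ u w, G.Adj u w → y u = 0 → y w = 0 := by
    intro u w huw hu
    have h := hyq u
    rw [hu, mul_zero, qOp, sum_eq_zero_iff_of_nonneg (fun w _ => add_nonneg (hy0 _) (hy0 _))] at h
    have := h w (by simp [huw])
    linarith [hy0 u, hy0 w]
  have hpos : ∀ u, 0 < y u := by
    intro u
    refine lt_of_le_of_ne (hy0 u) fun hu => hx0 ?_
    ext w
    obtain ⟨p⟩ := hG.preconnected u w
    have : ∀ a b, G.Walk a b → y a = 0 → y b = 0 := by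
      intro a b p
      induction p with
      | nil => exact id
      | cons h _ ih => exact fun ha => ih (hzero _ _ h ha)
    exact abs_eq_zero.1 (this u w p hu.symm)
  obtain ⟨v, -, hv⟩ := exists_max_image univ y univ_nonempty
  refine ⟨fun u => y u / y v, v, fun u => div_pos (hpos u) (hpos v), div_self (hpos v).ne',
    fun u => (div_le_one (hpos v)).2 (hv u (mem_univ _)), fun u => ?_⟩
  have h : qOp G (fun u => y u / y v) u = qOp G y u / y v := by
    rw [qOp, qOp, sum_div]
    exact sum_congr rfl fun w _ => by rw [add_div]
  rw [h, hyq, mul_div_assoc]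

theorem qIndex_le_of_iso {W : Type*} [Fintype W] {H : SimpleGraph W} [Nonempty V] [Nonempty W]
    (e : G ≃g H) : qIndex G ≤ qIndex H := by
  classical
  obtain ⟨x, hx0, hx⟩ := (qIndex_isGreatest G).1
  refine (qIndex_isGreatest H).2 ⟨x ∘ e.symm, ?_, ?_⟩
  · intro h
    refine hx0 (funext fun u => ?_)
    simpa using congrFun h (e u)
  · rw [mulVec_signlessLaplacian] at hx ⊢
    ext w
    have := congrFun hx (e.symm w)
    simp only [Pi.smul_apply, smul_eq_mul, Function.comp_apply] at this ⊢
    rw [← this, qOp_eq_ite, qOp_eq_ite]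
    refine (Fintype.sum_equiv e.toEquiv _ _ fun u => ?_).symm
    have h : H.Adj w (e u) ↔ G.Adj (e.symm w) u := by
      rw [← e.map_adj_iff]; simp
    simp [h]

theorem qIndex_eq_of_iso {W : Type*} [Fintype W] {H : SimpleGraph W} [Nonempty V]
    (e : G ≃g H) : qIndex G = qIndex H := by
  have : Nonempty W := ⟨e (Classical.arbitrary V)⟩
  exact le_antisymm (qIndex_le_of_iso e) (qIndex_le_of_iso e.symm)

end OuterplanarQ

end

section

/-! ### The eigenvalue equation on a path joined to a hub -/

namespace OuterplanarQ

open Finset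

/-- `y` solves the eigenvalue equations of the signless Laplacian with eigenvalue `q` at the
vertices of a path on `m` vertices joined to a hub with value `1`. -/
structure IsPathSolution (q : ℝ) (m : ℕ) (y : ℕ → ℝ) : Prop where
  pos : ∀ i < m, 0 < y i
  eq : ∀ i < m, q * y i = (1 + y i) + (if 0 < i then y i + y (i - 1) else 0) +
    (if i + 1 < m then y i + y (i + 1) else 0)

/-- The value of the solution at the vertex with `A = t ^ (i + 1)` and `B = t ^ (m - i)`. -/
noncomputable def pathEntry (t A B : ℝ) : ℝ :=
  t / (t - 1) ^ 2 * (1 - 2 * t * (A + B) / ((t + 1) * (A * B + t)))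

/-! ### Closed form of the path solution -/

section pathEntry

variable {t A B : ℝ}

/-- With q - 3 = t + 1/t the equation at an inner vertex is (t + 1/t) y_i = 1 + y_{i-1} + y_{i+1}.
Moving along the path multiplies `A` by t and divides `B` by t, so the product in the denominator
stays fixed. -/
theorem pathEntry_rec (ht : 1 < t) (hA : 0 < A) (hB : 0 < B) :
    (t + t⁻¹) * pathEntry t A B =
      1 + pathEntry t (A / t) (B * t) + pathEntry t (A * t) (B / t) := by
  have h1 : t - 1 ≠ 0 := by linarith
  have h2 : t + 1 ≠ 0 := by linarith
  have h3 : A * B + t ≠ 0 := by positivity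
  have h0 : t ≠ 0 := by linarith
  have e1 : A / t * (B * t) = A * B := by field_simp
  have e2 : A * t * (B / t) = A * B := by field_simp
  unfold pathEntry
  rw [e1, e2]
  field_simp
  ring

theorem pathEntry_swap : pathEntry t A B = pathEntry t B A := by
  unfold pathEntry
  rw [add_comm A B, mul_comm A B]

/-- An end vertex satisfies the inner equation with the fictitious neighbour value -y; this lemma
supplies that boundary condition. -/
theorem pathEntry_end (ht : 1 < t) (hB : 0 < B) : pathEntry t 1 (B * t) = -pathEntry t t B := by
  have h1 : t - 1 ≠ 0 := by linarith
  have h2 : t + 1 ≠ 0 := by linarith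
  have h0 : t ≠ 0 := by linarith
  have h3 : B + 1 ≠ 0 := by linarith
  have e1 : 1 * (B * t) + t = t * (B + 1) := by ring
  have e2 : t * B + t = t * (B + 1) := by ring
  unfold pathEntry
  rw [e1, e2]
  field_simp
  ring

theorem pathEntry_pos (ht : 1 < t) (hA : t ≤ A) (hB : t ≤ B) : 0 < pathEntry t A B := by
  have h1 : 0 < t - 1 := by linarith
  have h3 : 0 < (t + 1) * (A * B + t) := by
    have : 0 < A := by linarith
    have : 0 < B := by linarith
    positivity
  refine mul_pos (by positivity) (sub_pos.2 ((div_lt_one h3).2 ?_))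
  nlinarith [mul_nonneg (sub_nonneg.2 hA) (sub_nonneg.2 hB), mul_nonneg (sub_nonneg.2 hA) h1.le,
    mul_nonneg (sub_nonneg.2 hB) h1.le, mul_pos h1 h1, mul_pos h1 (mul_pos h1 h1),
    mul_nonneg h1.le (mul_nonneg (sub_nonneg.2 hA) (sub_nonneg.2 hB)),
    mul_nonneg h1.le (mul_nonneg (sub_nonneg.2 hA) h1.le),
    mul_nonneg h1.le (mul_nonneg (sub_nonneg.2 hB) h1.le)]

theorem pathEntry_lt (ht : 1 < t) (hA : 0 < A) (hB : 0 < B) :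
    pathEntry t A B < t / (t - 1) ^ 2 := by
  have h1 : 0 < t - 1 := by linarith
  refine mul_lt_of_lt_one_right (by positivity) ?_
  have : 0 < 2 * t * (A + B) / ((t + 1) * (A * B + t)) := by positivity
  linarith

end pathEntry

/-- The solution of the path equations in terms of `t` with `q = t + 3 + t⁻¹`. -/
noncomputable def pathValue (t : ℝ) (m i : ℕ) : ℝ := pathEntry t (t ^ (i + 1)) (t ^ (m - i))

/-- The sum of the entries of the path solution. -/
noncomputable def pathSum (t : ℝ) (m : ℕ) : ℝ :=
  t / (t - 1) ^ 2 * (m - 4 * t * (t ^ m - 1) / ((t ^ 2 - 1) * (t ^ m + 1)))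

theorem isPathSolution_pathValue {t q : ℝ} (ht : 1 < t) (hq : q = t + 3 + t⁻¹) (m : ℕ) :
    IsPathSolution q m (pathValue t m) := by
  have h0 : t ≠ 0 := by linarith
  refine ⟨fun i hi => pathEntry_pos ht ?_ ?_, fun i hi => ?_⟩
  · exact le_self_pow₀ ht.le (by omega)
  · exact le_self_pow₀ ht.le (by omega)
  · have hrec := pathEntry_rec ht (show 0 < t ^ (i + 1) by positivity)
      (show 0 < t ^ (m - i) by positivity)
    have hl : pathEntry t (t ^ (i + 1) / t) (t ^ (m - i) * t) =
        if 0 < i then pathValue t m (i - 1) else -pathValue t m i := by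
      split_ifs with h
      · unfold pathValue
        obtain ⟨j, rfl⟩ : ∃ j, i = j + 1 := ⟨i - 1, by omega⟩
        rw [show m - (j + 1 - 1) = m - (j + 1) + 1 by omega, pow_succ t (m - (j + 1)),
          pow_succ t (j + 1), mul_div_cancel_right₀ _ h0, Nat.add_sub_cancel]
      · obtain rfl : i = 0 := by omega
        rw [zero_add, pow_one, div_self h0, pathEntry_end ht (by positivity)]
        simp [pathValue]
    have hr : pathEntry t (t ^ (i + 1) * t) (t ^ (m - i) / t) =
        if i + 1 < m then pathValue t m (i + 1) else -pathValue t m i := by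
      split_ifs with h
      · unfold pathValue
        rw [show m - i = m - (i + 1) + 1 by omega, pow_succ t (m - (i + 1)),
          pow_succ t (i + 1), mul_div_cancel_right₀ _ h0]
      · obtain h : m - i = 1 := by omega
        rw [h, pow_one, div_self h0, pathEntry_swap, pathEntry_end ht (by positivity),
          pathEntry_swap, pathValue, h, pow_one]
    rw [hl, hr] at hrec
    change (t + t⁻¹) * pathValue t m i = _ at hrec
    rw [hq]
    split_ifs at hrec ⊢ <;> linarith

/-- The number 1/(q-5) is the constant solution of the inner equation; the ends pull the solution
strictly below it. -/
theorem pathValue_lt {t q : ℝ} (ht : 1 < t) (hq : q = t + 3 + t⁻¹) (m i : ℕ) :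
    pathValue t m i < 1 / (q - 5) := by
  have h0 : t ≠ 0 := by linarith
  have h1 : t - 1 ≠ 0 := by linarith
  have : 1 / (q - 5) = t / (t - 1) ^ 2 := by
    have : q - 5 = (t - 1) ^ 2 / t := by rw [hq]; field_simp; ring
    rw [this, one_div_div]
  rw [this]
  exact pathEntry_lt ht (by positivity) (by positivity)

theorem sum_pathValue {t : ℝ} (ht : 1 < t) (m : ℕ) :
    ∑ i ∈ range m, pathValue t m i = pathSum t m := by
  have h0 : t ≠ 0 := by linarith
  have h1 : t - 1 ≠ 0 := by linarith
  have h2 : t + 1 ≠ 0 := by linarith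
  have h3 : t ^ m + 1 ≠ 0 := by positivity
  have hsum : ∑ i ∈ range m, (t ^ (i + 1) + t ^ (m - i)) = 2 * t * ((t ^ m - 1) / (t - 1)) := by
    rw [sum_add_distrib]
    have hA : ∑ i ∈ range m, t ^ (i + 1) = t * ((t ^ m - 1) / (t - 1)) := by
      rw [← geom_sum_eq (by linarith), mul_sum]
      exact sum_congr rfl fun i _ => by rw [pow_succ, mul_comm]
    have hB : ∑ i ∈ range m, t ^ (m - i) = ∑ i ∈ range m, t ^ (i + 1) := by
      rw [← sum_range_reflect]
      exact sum_congr rfl fun i hi => by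
        congr 1; have := mem_range.1 hi; omega
    rw [hB, hA]; ring
  have hterm : ∀ i ∈ range m, pathValue t m i = t / (t - 1) ^ 2 *
      (1 - 2 / ((t + 1) * (t ^ m + 1)) * (t ^ (i + 1) + t ^ (m - i))) := by
    intro i hi
    have hi := mem_range.1 hi
    unfold pathValue pathEntry
    have : t ^ (i + 1) * t ^ (m - i) + t = t * (t ^ m + 1) := by
      rw [← pow_add, show i + 1 + (m - i) = m + 1 by omega, pow_succ]; ring
    rw [this]
    field_simp
  rw [sum_congr rfl hterm, ← mul_sum, sum_sub_distrib, ← mul_sum, hsum, pathSum]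
  simp only [sum_const, card_range, nsmul_eq_mul, mul_one]
  have h4 : t ^ 2 - 1 = (t - 1) * (t + 1) := by ring
  rw [h4]
  field_simp
  ring

/-- Up to a linear function and a positive factor, `pathSum t m` is 2/(t^m + 1), which is strictly
convex for m ≥ 0. -/
theorem pathSum_exchange {t : ℝ} (ht : 1 < t) {a b K e : ℕ} (h : a + b = K + e) (ha : e < a)
    (hb : e < b) : pathSum t a + pathSum t b < pathSum t K + pathSum t e := by
  have h1 : 0 < t - 1 := by linarith
  have hg : ∀ m : ℕ, pathSum t m = t / (t - 1) ^ 2 * m -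
      t / (t - 1) ^ 2 * (4 * t / (t ^ 2 - 1)) * (1 - 2 / (t ^ m + 1)) := by
    intro m
    have h3 : t ^ m + 1 ≠ 0 := by positivity
    have h4 : t ^ 2 - 1 ≠ 0 := by nlinarith
    have h5 : t - 1 ≠ 0 := h1.ne'
    unfold pathSum
    field_simp
    ring
  have hc : 0 < t / (t - 1) ^ 2 * (4 * t / (t ^ 2 - 1)) := by
    have : 0 < t ^ 2 - 1 := by nlinarith
    positivity
  have key : 2 / (t ^ a + 1) + 2 / (t ^ b + 1) < 2 / (t ^ K + 1) + 2 / (t ^ e + 1) := by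
    have hAB : t ^ a * t ^ b = t ^ K * t ^ e := by rw [← pow_add, ← pow_add, h]
    have hKA : t ^ a < t ^ K := pow_lt_pow_right₀ ht (by omega)
    have hKB : t ^ b < t ^ K := pow_lt_pow_right₀ ht (by omega)
    have hA : 1 < t ^ a := one_lt_pow₀ ht (by omega)
    have hB : 1 < t ^ b := one_lt_pow₀ ht (by omega)
    have hE : 0 < t ^ e := by positivity
    generalize t ^ a = A at *
    generalize t ^ b = B at *
    generalize t ^ K = C at *
    generalize t ^ e = E at *
    -- Equal products: the pair `C`, `E` is more spread out than `A`, `B`, hence has the larger sum.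
    -- The claim then depends only on the two sums and the common product, which exceeds 1.
    have hs : A + B < C + E := by
      have : 0 < (C - A) * (C - B) := mul_pos (by linarith) (by linarith)
      have h6 : (C - A) * (C - B) = C * (C + E - A - B) := by linear_combination hAB
      rw [h6] at this
      have := (mul_pos_iff_of_pos_left (by linarith)).1 this
      linarith
    have hP : 1 < A * B := by nlinarith
    rw [div_add_div _ _ (by linarith) (by linarith), div_add_div _ _ (by linarith) (by linarith),
      div_lt_div_iff₀ (by nlinarith) (by nlinarith)]
    have e1 : (A + 1) * (B + 1) = A * B + (A + B) + 1 := by ring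
    have e2 : (C + 1) * (E + 1) = A * B + (C + E) + 1 := by rw [hAB]; ring
    rw [e1, e2]
    nlinarith [mul_pos (sub_pos.2 hs) (sub_pos.2 hP)]
  rw [hg a, hg b, hg K, hg e]
  have hcast : (a : ℝ) + b = K + e := by exact_mod_cast h
  have h7 := mul_lt_mul_of_pos_left key hc
  have h8 : t / (t - 1) ^ 2 * (a : ℝ) + t / (t - 1) ^ 2 * b =
      t / (t - 1) ^ 2 * K + t / (t - 1) ^ 2 * e := by
    rw [← mul_add, hcast, mul_add]
  linarith

theorem exists_path_parameter {q : ℝ} (hq : 5 < q) : ∃ t : ℝ, 1 < t ∧ q = t + 3 + t⁻¹ := by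
  have h : 0 ≤ (q - 3) ^ 2 - 4 := by nlinarith
  have hs := Real.sq_sqrt h
  have hs0 := Real.sqrt_nonneg ((q - 3) ^ 2 - 4)
  set s := Real.sqrt ((q - 3) ^ 2 - 4)
  refine ⟨(q - 3 + s) / 2, by linarith, ?_⟩
  have h1 : q - 3 + s ≠ 0 := by linarith
  field_simp
  linear_combination -hs

/-! ### Sums over partitions with bounded parts -/

/-- The value of `S` summed over the partition of `N` into `N / k` parts `k` and a rest. -/
noncomputable def extremalSum (S : ℕ → ℝ) (k N : ℕ) : ℝ := (N / k : ℕ) * S k + S (N % k)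

section extremalSum

variable {S : ℕ → ℝ} {k T : ℕ}

/-- A new part `m` is merged with the rest `r` by one exchange: into r + m and 0 if this stays below
k, otherwise into a full part k and r + m - k. The bound `T` restricts the exchanges that are
needed, since for small orders convexity is available only in a limited range. -/
theorem extremalSum_add_le (hk : 0 < k) (h0 : S 0 = 0)
    (hex : ∀ a b K e, a + b = K + e → e < a → e < b → K ≤ k → a + b ≤ T → S a + S b < S K + S e)
    {N m : ℕ} (hm : m ≤ k) (hT : N + m ≤ T) :
    extremalSum S k N + S m ≤ extremalSum S k (N + m) := by
  have hr := Nat.mod_lt N hk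
  have hN := Nat.div_add_mod N k
  set r := N % k
  set d := N / k
  have hval : ∀ d' r', r' < k → k * d' + r' = N + m →
      extremalSum S k (N + m) = d' * S k + S r' := by
    intro d' r' hr' h
    have h1 : (N + m) / k = d' := by
      rw [← h, Nat.mul_add_div hk, Nat.div_eq_of_lt hr', add_zero]
    have h2 : (N + m) % k = r' := by
      rw [← h, Nat.mul_add_mod, Nat.mod_eq_of_lt hr']
    rw [extremalSum, h1, h2]
  have hval' : extremalSum S k N = d * S k + S r := rfl
  rw [hval']
  rcases Nat.eq_zero_or_pos m with rfl | hm0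
  · rw [hval d r hr (by omega), h0]; simp
  rcases Nat.eq_zero_or_pos r with hr0 | hr0
  · rcases hm.eq_or_lt with rfl | hmk
    · rw [hval (d + 1) 0 hk (by rw [mul_add]; omega), hr0]; push_cast; linarith
    · rw [hval d m hmk (by omega), hr0, h0]; linarith
  rcases Nat.lt_or_ge (r + m) k with h | h
  · rw [hval d (r + m) h (by omega)]
    have := hex r m (r + m) 0 (by omega) hr0 hm0 h.le (by omega)
    linarith
  · rcases hm.eq_or_lt with rfl | hmk
    · rw [hval (d + 1) r hr (by rw [mul_add]; omega)]; push_cast; linarith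
    · rw [hval (d + 1) (r + m - k) (by omega) (by rw [mul_add]; omega)]
      have := hex r m k (r + m - k) (by omega) (by omega) (by omega) le_rfl (by omega)
      push_cast
      linarith

theorem extremalSum_add_sum_le (hk : 0 < k) (h0 : S 0 = 0)
    (hex : ∀ a b K e, a + b = K + e → e < a → e < b → K ≤ k → a + b ≤ T → S a + S b < S K + S e)
    {ι : Type*} (s : Finset ι) (f : ι → ℕ) (hf : ∀ i ∈ s, f i ≤ k)
    (N : ℕ)
    (hT : N + ∑ i ∈ s, f i ≤ T) : extremalSum S k N + ∑ i ∈ s, S (f i) ≤ extremalSum S k (N + ∑ i ∈ s, f i) := by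
  classical
  induction s using Finset.induction_on generalizing N with
  | empty => simp
  | insert a s ha ih =>
    rw [sum_insert ha] at hT
    rw [sum_insert ha, sum_insert ha]
    have h1 := extremalSum_add_le hk h0 hex (N := N) (hf a (by simp)) (by omega)
    have h2 := ih (fun i hi => hf i (by simp [hi])) (N + f a) (by omega)
    rw [add_assoc] at h2
    linarith

theorem extremalSum_zero (h0 : S 0 = 0) : extremalSum S k 0 = 0 := by simp [extremalSum, h0]

theorem sum_le_extremalSum (hk : 0 < k) (h0 : S 0 = 0)
    (hex : ∀ a b K e, a + b = K + e → e < a → e < b → K ≤ k → a + b ≤ T → S a + S b < S K + S e)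
    {ι : Type*} (s : Finset ι) (f : ι → ℕ) (hf : ∀ i ∈ s, f i ≤ k)
    (hT : ∑ i ∈ s, f i ≤ T) : ∑ i ∈ s, S (f i) ≤ extremalSum S k (∑ i ∈ s, f i) := by
  have := extremalSum_add_sum_le hk h0 hex s f hf 0 (by omega)
  rwa [extremalSum_zero h0, zero_add, zero_add] at this

theorem sum_lt_extremalSum (hk : 0 < k) (h0 : S 0 = 0)
    (hex : ∀ a b K e, a + b = K + e → e < a → e < b → K ≤ k → a + b ≤ T → S a + S b < S K + S e)
    {ι : Type*} (s : Finset ι) (f : ι → ℕ) (hf : ∀ i ∈ s, f i ≤ k)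
    {i j : ι} (hi : i ∈ s) (hj : j ∈ s) (hij : i ≠ j) (hi0 : 0 < f i) (hik : f i < k)
    (hj0 : 0 < f j) (hjk : f j < k) (hT : ∑ i ∈ s, f i ≤ T) :
    ∑ i ∈ s, S (f i) < extremalSum S k (∑ i ∈ s, f i) := by
  classical
  have hj' : j ∈ s.erase i := mem_erase.2 ⟨hij.symm, hj⟩
  rw [← add_sum_erase s f hi, ← add_sum_erase _ f hj', ← add_assoc] at hT
  rw [← add_sum_erase s _ hi, ← add_sum_erase _ _ hj', ← add_sum_erase s f hi,
    ← add_sum_erase _ f hj', ← add_assoc, ← add_assoc]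
  have h1 := extremalSum_add_sum_le hk h0 hex ((s.erase i).erase j) f
    (fun x hx => hf x (mem_of_mem_erase (mem_of_mem_erase hx))) (f i + f j) hT
  have h2 : S (f i) + S (f j) < extremalSum S k (f i + f j) := by
    rcases Nat.lt_or_ge (f i + f j) k with h | h
    · rw [extremalSum, Nat.div_eq_of_lt h, Nat.mod_eq_of_lt h]
      have := hex (f i) (f j) (f i + f j) 0 (by omega) hi0 hj0 h.le (by omega)
      rw [h0] at this
      simpa using this
    · have hd : (f i + f j) / k = 1 := Nat.div_eq_of_lt_le (by omega) (by omega)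
      have hm : (f i + f j) % k = f i + f j - k := by
        rw [Nat.mod_eq_sub_mod h, Nat.mod_eq_of_lt (by omega)]
      rw [extremalSum, hd, hm]
      have := hex (f i) (f j) k (f i + f j - k) (by omega) (by omega) (by omega) le_rfl (by omega)
      push_cast
      linarith
  linarith

end extremalSum

end OuterplanarQ

end

section

/-! ### Linear forests -/

namespace OuterplanarQ

open Finset

/-- The disjoint union of paths on `m i` vertices. -/
def sigmaPath {ι : Type*} (m : ι → ℕ) : SimpleGraph (Σ i, Fin (m i)) where
  Adj x y := x.1 = y.1 ∧ (x.2.val + 1 = y.2.val ∨ y.2.val + 1 = x.2.val)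
  symm := ⟨fun _ _ h => ⟨h.1.symm, h.2.symm⟩⟩
  loopless := ⟨fun _ h => by omega⟩

/-- The sequence `p` lists the `n` vertices of a path. -/
def IsPathSeq {W : Type*} (F : SimpleGraph W) (n : ℕ) (p : ℕ → W) : Prop :=
  Set.InjOn p (Set.Iio n) ∧ ∀ t, t + 1 < n → F.Adj (p t) (p (t + 1))

variable {W : Type*} {F : SimpleGraph W}

theorem IsPathSeq.le_card [Finite W] {n : ℕ} {p : ℕ → W} (h : IsPathSeq F n p) :
    n ≤ Nat.card W := by
  classical
  have := Fintype.ofFinite W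
  have h1 : (Finset.image p (range n)).card = n := by
    rw [card_image_of_injOn, card_range]
    intro x hx y hy
    exact h.1 (by simpa using hx) (by simpa using hy)
  rw [← h1, Nat.card_eq_fintype_card]
  exact card_le_univ _

theorem exists_longest_path [Finite W] [Nonempty W] (F : SimpleGraph W) :
    ∃ n p, 0 < n ∧ IsPathSeq F n p ∧ ∀ n' p', IsPathSeq F n' p' → n' ≤ n := by
  classical
  have h1 : ∃ p, IsPathSeq F 1 p := by
    refine ⟨fun _ => Classical.arbitrary W, ?_, fun t ht => by omega⟩
    intro x hx y hy _
    have hx : x < 1 := hx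
    have hy : y < 1 := hy
    omega
  have hcard : 1 ≤ Nat.card W := Nat.card_pos
  obtain ⟨p, hp⟩ := Nat.findGreatest_spec (P := fun n => ∃ p, IsPathSeq F n p) hcard h1
  refine ⟨_, p, Nat.le_findGreatest hcard h1, hp, fun n' p' h => ?_⟩
  exact Nat.le_findGreatest h.le_card ⟨p', h⟩

/-- At an inner vertex of the path the two path neighbours exhaust the degree bound. At an end, a
new neighbour would lengthen the path and an old one would close a cycle. So a longest path is a
whole component. -/
theorem longest_path_adj
    (hdeg : ∀ u a b c, F.Adj u a → F.Adj u b → F.Adj u c → a ≠ b → a ≠ c → b ≠ c → False)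
    (hcyc : ∀ n p, 3 ≤ n → IsPathSeq F n p → ¬ F.Adj (p 0) (p (n - 1)))
    {n : ℕ} {p : ℕ → W} (hp : IsPathSeq F n p) (hmax : ∀ n' p', IsPathSeq F n' p' → n' ≤ n)
    {i : ℕ} (hi : i < n) {w : W} (hw : F.Adj (p i) w) :
    ∃ j < n, w = p j ∧ (j = i + 1 ∨ i = j + 1) := by
  classical
  obtain ⟨hinj, hadj⟩ := hp
  have hmem : ∀ i < n, i ∈ Set.Iio n := fun i hi => hi
  rcases Nat.eq_zero_or_pos i with rfl | hi0
  · by_cases hex : ∃ j < n, w = p j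
    · obtain ⟨j, hj, rfl⟩ := hex
      refine ⟨j, hj, rfl, Or.inl ?_⟩
      by_contra hne
      have hj0 : j ≠ 0 := by rintro rfl; exact F.irrefl hw
      refine hcyc (j + 1) p (by omega) ⟨fun x hx y hy => ?_, fun t ht => hadj t (by omega)⟩ hw
      have hx : x < j + 1 := hx
      have hy : y < j + 1 := hy
      exact hinj (hmem x (by omega)) (hmem y (by omega))
    · exfalso
      have : n + 1 ≤ n := hmax (n + 1) (fun t => if t = 0 then w else p (t - 1)) ⟨?_, ?_⟩
      · omega
      · intro x hx y hy h
        have hx : x < n + 1 := hx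
        have hy : y < n + 1 := hy
        simp only at h
        split_ifs at h with h1 h2 h2
        · omega
        · exact absurd ⟨y - 1, by omega, h⟩ hex
        · exact absurd ⟨x - 1, by omega, h.symm⟩ hex
        · have := hinj (hmem _ (by omega)) (hmem _ (by omega)) h
          omega
      · intro t ht
        by_cases h : t = 0
        · simpa [h] using hw.symm
        · obtain ⟨s, rfl⟩ : ∃ s, t = s + 1 := ⟨t - 1, by omega⟩
          simpa using hadj s (by omega)
  rcases Nat.lt_or_ge (i + 1) n with hin | hin
  · have h1 : F.Adj (p i) (p (i - 1)) := by
      have := hadj (i - 1) (by omega)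
      rw [Nat.sub_add_cancel hi0] at this
      exact this.symm
    have h2 := hadj i hin
    by_cases ha : w = p (i - 1)
    · exact ⟨i - 1, by omega, ha, Or.inr (by omega)⟩
    by_cases hb : w = p (i + 1)
    · exact ⟨i + 1, by omega, hb, Or.inl rfl⟩
    exfalso
    refine hdeg _ _ _ _ hw h1 h2 ha hb fun h => ?_
    have := hinj (hmem _ (by omega)) (hmem _ hin) h
    omega
  · by_cases hex : ∃ j < n, w = p j
    · obtain ⟨j, hj, rfl⟩ := hex
      refine ⟨j, hj, rfl, Or.inr ?_⟩
      by_contra hne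
      have hji : j ≠ i := by rintro rfl; exact F.irrefl hw
      refine hcyc (i - j + 1) (fun t => p (j + t)) (by omega)
        ⟨fun x hx y hy h => ?_, fun t ht => hadj (j + t) (by omega)⟩ ?_
      · have hx : x < i - j + 1 := hx
        have hy : y < i - j + 1 := hy
        have := hinj (hmem (j + x) (by omega)) (hmem (j + y) (by omega)) h
        omega
      · simp only [add_zero, Nat.add_sub_cancel]
        rw [show j + (i - j) = i by omega]
        exact hw.symm
    · exfalso
      have : n + 1 ≤ n := hmax (n + 1) (fun t => if t < n then p t else w) ⟨?_, ?_⟩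
      · omega
      · intro x hx y hy h
        have hx : x < n + 1 := hx
        have hy : y < n + 1 := hy
        simp only at h
        split_ifs at h with h1 h2 h2
        · exact hinj h1 h2 h
        · exact absurd ⟨x, h1, h.symm⟩ hex
        · exact absurd ⟨y, h2, h⟩ hex
        · omega
      · intro t ht
        rcases Nat.lt_or_ge (t + 1) n with h | h
        · simpa [h, show t < n by omega] using hadj t h
        · obtain rfl : t = i := by omega
          simpa [hi, hin.not_gt] using hw

/-- A graph of maximum degree at most two without cycles is a disjoint union of paths. -/
theorem exists_iso_sigmaPath [Finite W] (F : SimpleGraph W)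
    (hdeg : ∀ u a b c, F.Adj u a → F.Adj u b → F.Adj u c → a ≠ b → a ≠ c → b ≠ c → False)
    (hcyc : ∀ n p, 3 ≤ n → IsPathSeq F n p → ¬ F.Adj (p 0) (p (n - 1))) :
    ∃ (ι : Type) (_ : Fintype ι) (m : ι → ℕ), (∀ i, 0 < m i) ∧ Nonempty (F ≃g sigmaPath m) := by
  induction hN : Nat.card W using Nat.strong_induction_on generalizing W with
  | _ N ih =>
  rcases isEmpty_or_nonempty W with hW | hW
  · refine ⟨Empty, inferInstance, fun i => i.elim, fun i => i.elim, ⟨⟨Equiv.equivOfIsEmpty _ _, ?_⟩⟩⟩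
    intro a
    exact hW.elim a
  obtain ⟨n, p, hn, hp, hmax⟩ := exists_longest_path F
  have hnbr := fun i hi w hw => longest_path_adj hdeg hcyc hp hmax (i := i) hi (w := w) hw
  obtain ⟨hinj, hadj⟩ := hp
  -- The longest path is a component; the induction continues on its complement, and `Option ι`
  -- indexes the enlarged family.
  let W' := {w : W | ∀ j < n, w ≠ p j}
  have hlt : Nat.card W' < N := by
    rw [← hN]
    exact Finite.card_subtype_lt (x := p 0) fun h => h 0 hn rfl
  obtain ⟨ι, hι, m, hm, ⟨e⟩⟩ := ih _ hlt (F.induce W')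
    (fun u a b c h1 h2 h3 h4 h5 h6 => hdeg u a b c h1 h2 h3 (fun h => h4 (Subtype.ext h))
      (fun h => h5 (Subtype.ext h)) (fun h => h6 (Subtype.ext h)))
    (fun n p h1 h2 h3 => hcyc n (fun t => p t) h1
      ⟨fun x hx y hy h => h2.1 hx hy (Subtype.ext h), h2.2⟩ h3) rfl
  let f : (Σ o : Option ι, Fin (o.elim n m)) → W := fun x =>
    match x with
    | ⟨none, i⟩ => p i
    | ⟨some j, i⟩ => (e.symm ⟨j, i⟩).1
  have hf : Function.Bijective f := by
    constructor
    · rintro ⟨_ | j, i⟩ ⟨_ | j', i'⟩ h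
      · have : (i : ℕ) = i' := hinj i.2 i'.2 h
        rw [Fin.ext this]
      · exact absurd h.symm ((e.symm ⟨j', i'⟩).2 i i.2)
      · exact absurd h ((e.symm ⟨j, i⟩).2 i' i'.2)
      · have h1 := e.symm.injective (Subtype.ext h)
        exact congrArg (fun x : Σ i, Fin (m i) =>
          (⟨some x.1, x.2⟩ : Σ o : Option ι, Fin (o.elim n m))) h1
    · intro w
      by_cases h : ∃ j < n, w = p j
      · obtain ⟨j, hj, rfl⟩ := h
        exact ⟨⟨none, ⟨j, hj⟩⟩, rfl⟩
      · have hw : w ∈ W' := fun j hj hw => h ⟨j, hj, hw⟩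
        refine ⟨⟨some (e ⟨w, hw⟩).1, (e ⟨w, hw⟩).2⟩, ?_⟩
        change (e.symm (e ⟨w, hw⟩)).1 = w
        simp
  have hpath : ∀ i < n, ∀ j < n, F.Adj (p i) (p j) ↔ (i + 1 = j ∨ j + 1 = i) := by
    intro i hi j hj
    constructor
    · intro h
      obtain ⟨j', hj', h1, h2⟩ := hnbr i hi _ h
      have := hinj hj hj' h1
      omega
    · rintro (rfl | rfl)
      · exact hadj i hj
      · exact (hadj j hi).symm
  have hout : ∀ i < n, ∀ w ∈ W', ¬ F.Adj (p i) w := by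
    intro i hi w hw h
    obtain ⟨j, hj, h1, -⟩ := hnbr i hi _ h
    exact hw j hj h1
  refine ⟨Option ι, inferInstance, fun o => o.elim n m, ?_, ⟨⟨(Equiv.ofBijective f hf).symm, ?_⟩⟩⟩
  · rintro (_ | i)
    exacts [hn, hm i]
  intro a b
  obtain ⟨x, rfl⟩ := hf.2 a
  obtain ⟨y, rfl⟩ := hf.2 b
  have hs : ∀ x, (Equiv.ofBijective f hf).symm (f x) = x := fun x =>
    (Equiv.ofBijective f hf).symm_apply_apply x
  rw [hs, hs]
  obtain ⟨_ | j, i⟩ := x <;> obtain ⟨_ | j', i'⟩ := y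
  · change _ ↔ F.Adj (p i) (p i')
    rw [hpath i i.2 i' i'.2]
    simp [sigmaPath]
  · refine iff_of_false (by simp [sigmaPath]) ?_
    exact hout i i.2 _ (e.symm ⟨j', i'⟩).2
  · refine iff_of_false (by simp [sigmaPath]) ?_
    exact fun h => hout i' i'.2 _ (e.symm ⟨j, i⟩).2 h.symm
  · change _ ↔ (F.induce W').Adj (e.symm ⟨j, i⟩) (e.symm ⟨j', i'⟩)
    rw [e.symm.map_adj_iff]
    simp [sigmaPath]

/-- The disjoint union of `a` paths on `k` vertices and a path on `r` vertices. -/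
abbrev pathForest (a k r : ℕ) : SimpleGraph ((Fin a × Fin k) ⊕ Fin r) :=
  SimpleGraph.sum (copies a (SimpleGraph.pathGraph k)) (SimpleGraph.pathGraph r)

theorem pathGraph_adj_val {n : ℕ} (u v : Fin n) :
    (SimpleGraph.pathGraph n).Adj u v ↔ u.val + 1 = v.val ∨ v.val + 1 = u.val :=
  SimpleGraph.pathGraph_adj

/-- As at most one part differs from k, the total of the non-full parts is less than k; division
with remainder then identifies it with N % k and the number of full parts with N / k. -/
theorem nonempty_iso_pathForest {ι : Type*} [Fintype ι] {m : ι → ℕ} {k N : ℕ} (hk : 0 < k)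
    (hm : ∀ i, m i ≤ k) (hone : ∀ i j, m i < k → m j < k → i = j) (hN : ∑ i, m i = N) :
    Nonempty (sigmaPath m ≃g pathForest (N / k) k (N % k)) := by
  classical
  have hsum : Fintype.card {i // m i = k} * k + ∑ i with ¬ m i = k, m i = N := by
    rw [← hN, ← sum_filter_add_sum_filter_not univ (fun i => m i = k)]
    congr 1
    rw [sum_congr rfl (g := fun _ => k) (fun i hi => (mem_filter.1 hi).2), sum_const,
      Fintype.card_subtype, smul_eq_mul]
  have hrest : ∀ i, m i ≠ k → ∑ i with ¬ m i = k, m i = m i := by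
    intro i hi
    have : univ.filter (fun i => ¬ m i = k) = {i} := by
      ext j
      simp only [mem_filter, mem_univ, true_and, mem_singleton]
      constructor
      · exact fun hj => hone j i (lt_of_le_of_ne (hm j) hj) (lt_of_le_of_ne (hm i) hi)
      · rintro rfl; exact hi
    rw [this, sum_singleton]
  have hlt : ∑ i with ¬ m i = k, m i < k := by
    by_cases h : ∃ i, m i ≠ k
    · obtain ⟨i, hi⟩ := h
      rw [hrest i hi]
      exact lt_of_le_of_ne (hm i) hi
    · push Not at h
      simpa [h] using hk
  have hdiv : N / k = Fintype.card {i // m i = k} := by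
    rw [← hsum, mul_comm, Nat.mul_add_div hk, Nat.div_eq_of_lt hlt, add_zero]
  have hmod : N % k = ∑ i with ¬ m i = k, m i := by
    rw [← hsum, mul_comm, Nat.mul_add_mod, Nat.mod_eq_of_lt hlt]
  have e : {i // m i = k} ≃ Fin (N / k) := Fintype.equivOfCardEq (by simp [hdiv])
  let f : (Σ i, Fin (m i)) → (Fin (N / k) × Fin k) ⊕ Fin (N % k) := fun x =>
    if h : m x.1 = k then Sum.inl (e ⟨x.1, h⟩, ⟨x.2.1, h ▸ x.2.2⟩)
    else Sum.inr ⟨x.2.1, by rw [hmod, hrest _ h]; exact x.2.2⟩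
  have hsub : ∀ x y : (Σ i, Fin (m i)), x.1 = y.1 → x.2.1 = y.2.1 → x = y := by
    rintro ⟨i, x⟩ ⟨j, y⟩ h1 h2
    obtain rfl : i = j := h1
    obtain rfl : x = y := Fin.ext h2
    rfl
  have hinj : Function.Injective f := by
    intro x y h
    simp only [f] at h
    split_ifs at h with h1 h2 h2
    · simp only [Sum.inl.injEq, Prod.mk.injEq, EmbeddingLike.apply_eq_iff_eq, Subtype.mk.injEq,
        Fin.mk.injEq] at h
      exact hsub _ _ h.1 h.2
    · simp only [Sum.inr.injEq, Fin.mk.injEq] at h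
      exact hsub _ _ (hone _ _ (lt_of_le_of_ne (hm _) h1) (lt_of_le_of_ne (hm _) h2)) h
  have hcard : Fintype.card (Σ i, Fin (m i)) =
      Fintype.card ((Fin (N / k) × Fin k) ⊕ Fin (N % k)) := by
    simp [hN, Nat.div_add_mod']
  have hbij : Function.Bijective f := (Fintype.bijective_iff_injective_and_card f).2 ⟨hinj, hcard⟩
  refine ⟨⟨Equiv.ofBijective f hbij, ?_⟩⟩
  intro x y
  change (pathForest (N / k) k (N % k)).Adj (f x) (f y) ↔ _
  simp only [f]
  split_ifs with h1 h2 h2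
  · simp [pathForest, copies, pathGraph_adj_val, sigmaPath]
  · refine iff_of_false (by simp [pathForest]) fun h => h2 (h.1 ▸ h1)
  · refine iff_of_false (by simp [pathForest]) fun h => h1 (h.1 ▸ h2)
  · simp [pathForest, pathGraph_adj_val, sigmaPath,
      hone _ _ (lt_of_le_of_ne (hm _) h1) (lt_of_le_of_ne (hm _) h2)]

/-- A graph with a dominating vertex `v` is the join of a vertex and the rest. -/
theorem nonempty_iso_join {V W' : Type*} {G : SimpleGraph V} {K : SimpleGraph W'} {v : V}
    (hv : ∀ u, u ≠ v → G.Adj v u) (e : G.induce (G.neighborSet v) ≃g K) :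
    Nonempty (G ≃g join (⊤ : SimpleGraph (Fin 1)) K) := by
  classical
  let f : V → Fin 1 ⊕ W' := fun u => if h : u = v then Sum.inl 0 else Sum.inr (e ⟨u, hv u h⟩)
  have hf : Function.Bijective f := by
    constructor
    · intro x y h
      simp only [f] at h
      split_ifs at h with h1 h2 h2
      · rw [h1, h2]
      · simpa [Subtype.ext_iff] using h
    · rintro (i | w)
      · exact ⟨v, by simp [f, Fin.fin_one_eq_zero i]⟩
      · refine ⟨(e.symm w).1, ?_⟩
        have : (e.symm w).1 ≠ v := (G.ne_of_adj (e.symm w).2).symm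
        simp only [f, this, dite_false]
        exact congrArg Sum.inr (e.apply_symm_apply w)
  refine ⟨⟨Equiv.ofBijective f hf, ?_⟩⟩
  intro x y
  change (join (⊤ : SimpleGraph (Fin 1)) K).Adj (f x) (f y) ↔ _
  simp only [f]
  split_ifs with h1 h2 h2
  · simp [join, h1, h2]
  · simpa [join, h1] using hv y h2
  · simpa [join, h2] using (hv x h1).symm
  · simp only [join, SimpleGraph.sup_adj, SimpleGraph.sum_adj, completeBipartiteGraph_adj]
    simpa using e.map_adj_iff (v := ⟨x, hv x h1⟩) (w := ⟨y, hv y h2⟩)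

/-! ### Cycles as sequences -/

theorem not_free_cycleGraph {V : Type*} {G : SimpleGraph V} {l : ℕ} (hl : 3 ≤ l) {c : ℕ → V}
    (hc : IsPathSeq G l c) (h : G.Adj (c (l - 1)) (c 0)) : ¬ (SimpleGraph.cycleGraph l).Free G := by
  obtain ⟨n, rfl⟩ : ∃ n, l = n + 2 := ⟨l - 2, by omega⟩
  obtain ⟨hinj, hadj⟩ := hc
  have key : ∀ a b : Fin (n + 2), b - a = 1 → G.Adj (c a) (c b) := by
    intro a b hab
    obtain rfl : b = a + 1 := by rw [← hab]; abel
    rcases eq_or_ne a (Fin.last _) with rfl | ha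
    · simpa using h
    · have : ((a + 1 : Fin (n + 2)) : ℕ) = a + 1 := by
        rw [Fin.val_add_one, if_neg ha]
      rw [this]
      have hlt : (a : ℕ) ≠ n + 1 := fun h => ha (Fin.ext h)
      exact hadj a (by have := a.2; omega)
  intro hfree
  refine hfree ⟨⟨⟨fun i => c i, ?_⟩, ?_⟩⟩
  · intro a b hab
    rcases SimpleGraph.cycleGraph_adj.1 hab with h | h
    · exact (key b a h).symm
    · exact key a b h
  · intro a b hab
    exact Fin.ext (hinj a.2 b.2 hab)

/-- Indexing the cycle periodically by ℕ allows it to be traversed from any starting point. -/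
theorem exists_cycle_of_not_free {V : Type*} {G : SimpleGraph V} {l : ℕ} (hl : 3 ≤ l)
    (h : ¬ (SimpleGraph.cycleGraph l).Free G) :
    ∃ c : ℕ → V, (∀ s t, c s = c t ↔ s % l = t % l) ∧ ∀ t, G.Adj (c t) (c (t + 1)) := by
  obtain ⟨n, rfl⟩ : ∃ n, l = n + 2 := ⟨l - 2, by omega⟩
  rw [SimpleGraph.Free, not_not] at h
  obtain ⟨f⟩ := h
  refine ⟨fun t => f (Fin.ofNat (n + 2) t), fun s t => ?_, fun t => ?_⟩
  · refine f.injective.eq_iff.trans ?_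
    rw [Fin.ext_iff]
    rfl
  · refine f.toHom.map_adj (SimpleGraph.cycleGraph_adj.2 (Or.inr ?_))
    have : Fin.ofNat (n + 2) (t + 1) = Fin.ofNat (n + 2) t + 1 := by
      apply Fin.ext
      simp [Fin.val_add]
    rw [this]; abel

end OuterplanarQ

end

section

/-! ### The extremal graph -/

namespace OuterplanarQ

open Finset

/-! ### The signless Laplacian of a cone -/

section join

variable {W : Type*} [Fintype W] {K : SimpleGraph W}

theorem qOp_join_inl (z : Fin 1 ⊕ W → ℝ) (i : Fin 1) :
    qOp (join (⊤ : SimpleGraph (Fin 1)) K) z (Sum.inl i) =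
      Fintype.card W * z (Sum.inl i) + ∑ w, z (Sum.inr w) := by
  classical
  rw [qOp_eq_ite, Fintype.sum_sum_type]
  simp [join, Fin.fin_one_eq_zero i, sum_add_distrib]

theorem qOp_join_inr (z : Fin 1 ⊕ W → ℝ) (w : W) :
    qOp (join (⊤ : SimpleGraph (Fin 1)) K) z (Sum.inr w) =
      z (Sum.inl 0) + z (Sum.inr w) + qOp K (fun u => z (Sum.inr u)) w := by
  classical
  rw [qOp_eq_ite, Fintype.sum_sum_type, qOp_eq_ite]
  simp [join, add_comm]

theorem qOp_one_nonneg (w : W) : 0 ≤ qOp K (fun _ => 1) w :=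
  sum_nonneg fun _ _ => by norm_num

/-- The vector with |W| at the hub and 1 elsewhere is the eigenvector of the star with eigenvalue
|W| + 1; the edges of `K` only increase its image. -/
theorem card_add_one_le_qIndex_join [Nonempty W] :
    (Fintype.card W + 1 : ℝ) ≤ qIndex (join (⊤ : SimpleGraph (Fin 1)) K) := by
  by_contra! h
  obtain ⟨w⟩ := ‹Nonempty W›
  let z : Fin 1 ⊕ W → ℝ := Sum.elim (fun _ => (Fintype.card W : ℝ)) fun _ => 1
  have h1 := sum_mul_qOp_le (G := join (⊤ : SimpleGraph (Fin 1)) K) z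
  have hz : ∀ u, 0 ≤ z u := by rintro (i | u) <;> simp [z]
  have h2 : ∀ u, (Fintype.card W + 1 : ℝ) * z u ≤ qOp (join (⊤ : SimpleGraph (Fin 1)) K) z u := by
    rintro (i | u)
    · rw [qOp_join_inl]; simp [z]; linarith
    · rw [qOp_join_inr]
      have := qOp_one_nonneg (K := K) u
      simp only [z, Sum.elim_inl, Sum.elim_inr]; linarith
  have h3 : (Fintype.card W + 1 : ℝ) * ∑ u, z u ^ 2 ≤
      ∑ u, z u * qOp (join (⊤ : SimpleGraph (Fin 1)) K) z u := by
    rw [mul_sum]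
    refine sum_le_sum fun u _ => ?_
    have := mul_le_mul_of_nonneg_left (h2 u) (hz u)
    linarith [this]
  have h4 : 0 < ∑ u, z u ^ 2 :=
    sum_pos' (fun u _ => sq_nonneg _) ⟨Sum.inr w, mem_univ _, by simp [z]⟩
  exact absurd (h3.trans h1) (not_le.2 (mul_lt_mul_of_pos_right h h4))

theorem card_add_one_lt_qIndex_join {u w : W} (huw : K.Adj u w) :
    (Fintype.card W + 1 : ℝ) < qIndex (join (⊤ : SimpleGraph (Fin 1)) K) := by
  classical
  let z : Fin 1 ⊕ W → ℝ := Sum.elim (fun _ => (Fintype.card W : ℝ)) fun _ => 1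
  refine lt_qIndex_of_le_qOp (z := z) (v := Sum.inr u) ?_ ?_ (by simp [z]) ?_
  · rintro (i | u) <;> simp [z]
  · rintro (i | u)
    · rw [qOp_join_inl]; simp [z]; linarith
    · rw [qOp_join_inr]
      have := qOp_one_nonneg (K := K) u
      simp only [z, Sum.elim_inl, Sum.elim_inr]; linarith
  · rw [qOp_join_inr]
    have : 0 < qOp K (fun _ => 1) u :=
      sum_pos (fun _ _ => by norm_num) ⟨w, by simpa using huw⟩
    simp only [z, Sum.elim_inl, Sum.elim_inr]; linarith

end join

theorem sum_path_neighbors {m i : ℕ} (hi : i < m) (g : ℕ → ℝ) :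
    (∑ x : Fin m, if i + 1 = (x : ℕ) ∨ (x : ℕ) + 1 = i then g x else 0) =
      (if 0 < i then g (i - 1) else 0) + if i + 1 < m then g (i + 1) else 0 := by
  rw [Fin.sum_univ_eq_sum_range (fun x => if i + 1 = x ∨ x + 1 = i then g x else 0)]
  have h : ∀ x, (if i + 1 = x ∨ x + 1 = i then g x else 0) =
      (if x = i - 1 then (if 0 < i then g x else 0) else 0) + if x = i + 1 then g x else 0 := by
    intro x
    by_cases h1 : x = i + 1
    · subst h1
      rw [if_pos (Or.inl rfl), if_neg (by omega), if_pos rfl, zero_add]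
    · by_cases h2 : x + 1 = i
      · rw [if_pos (Or.inr h2), if_pos (by omega), if_pos (by omega), if_neg h1, add_zero]
      · rw [if_neg (by omega), if_neg h1]
        split_ifs <;> first | omega | simp
  simp only [h, sum_add_distrib, sum_ite_eq', mem_range]
  rw [if_pos (by omega)]

/-! ### Path solutions on a disjoint union of paths -/

section sigma

variable {ι : Type*} [Fintype ι] {m : ι → ℕ}

theorem qOp_sigmaPath (Y : ι → ℕ → ℝ) (i : ι) (x : Fin (m i)) :
    qOp (sigmaPath m) (fun p => Y p.1 p.2) ⟨i, x⟩ =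
      (if 0 < (x : ℕ) then Y i x + Y i (x - 1) else 0) +
        if (x : ℕ) + 1 < m i then Y i x + Y i (x + 1) else 0 := by
  classical
  rw [qOp_eq_ite, Fintype.sum_sigma, sum_eq_single i]
  · rw [← sum_path_neighbors x.2 (fun t => Y i x + Y i t)]
    refine sum_congr rfl fun y _ => ?_
    simp [sigmaPath]
  · intro j _ hj
    refine sum_eq_zero fun y _ => if_neg fun h => hj h.1.symm
  · simp

theorem sum_sigma_fin (Y : ι → ℕ → ℝ) :
    ∑ p : (Σ i, Fin (m i)), Y p.1 p.2 = ∑ i, ∑ t ∈ range (m i), Y i t := by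
  rw [Fintype.sum_sigma]
  exact sum_congr rfl fun i _ => Fin.sum_univ_eq_sum_range (fun t => Y i t) (m i)

theorem IsPathSolution.qOp_sigmaPath {q : ℝ} {Y : ι → ℕ → ℝ}
    (hY : ∀ i, IsPathSolution q (m i) (Y i)) (p : Σ i, Fin (m i)) :
    1 + Y p.1 p.2 + qOp (sigmaPath m) (fun p => Y p.1 p.2) p = q * Y p.1 p.2 := by
  obtain ⟨i, x⟩ := p
  rw [OuterplanarQ.qOp_sigmaPath, (hY i).eq x x.2]
  ring

/-- With 1 at the hub and the path solutions elsewhere, all equations for q hold except possibly the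
one at the hub. An excess there would force the `Q`-index above q. -/
theorem sum_add_sum_le_of_qIndex_join_le {q : ℝ} {Y : ι → ℕ → ℝ}
    (hY : ∀ i, IsPathSolution q (m i) (Y i))
    (hq : qIndex (join (⊤ : SimpleGraph (Fin 1)) (sigmaPath m)) ≤ q) :
    ((∑ i, m i : ℕ) : ℝ) + ∑ i, ∑ t ∈ range (m i), Y i t ≤ q := by
  by_contra! h
  let z : Fin 1 ⊕ (Σ i, Fin (m i)) → ℝ := Sum.elim (fun _ => 1) fun p => Y p.1 p.2
  refine absurd hq (not_le.2 (lt_qIndex_of_le_qOp (z := z) (v := Sum.inl 0) ?_ ?_ ?_ ?_))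
  · rintro (i | p)
    · simp [z]
    · exact ((hY p.1).pos p.2 p.2.2).le
  · rintro (i | p)
    · rw [qOp_join_inl]
      simp only [z, Sum.elim_inl, Sum.elim_inr, sum_sigma_fin]
      simp
      push_cast at h
      linarith
    · rw [qOp_join_inr]
      simp only [z, Sum.elim_inl, Sum.elim_inr]
      exact (IsPathSolution.qOp_sigmaPath hY p).ge
  · simp [z]
  · rw [qOp_join_inl]
    simp only [z, Sum.elim_inl, Sum.elim_inr, sum_sigma_fin]
    simp
    push_cast at h
    linarith

end sigma

/-- Replacing the second graph of a join by an isomorphic one. -/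
def joinCongr {U W W' : Type*} (G : SimpleGraph U) {K : SimpleGraph W} {K' : SimpleGraph W'}
    (e : K ≃g K') : join G K ≃g join G K' where
  toEquiv := Equiv.sumCongr (Equiv.refl U) e.toEquiv
  map_rel_iff' := by
    rintro (a | a) (b | b) <;> simp [join, e.map_adj_iff]

/-- The sizes of the paths in the extremal linear forest. -/
def extremalPart (k r : ℕ) {a : ℕ} (o : Option (Fin a)) : ℕ := o.elim r fun _ => k

theorem sum_extremalPart (a k r : ℕ) : ∑ o : Option (Fin a), extremalPart k r o = a * k + r := by
  simp [Fintype.sum_option, extremalPart, add_comm]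

theorem nonempty_iso_extremalPart {k N : ℕ} (hk : 0 < k) :
    Nonempty (sigmaPath (extremalPart k (N % k) (a := N / k)) ≃g
      pathForest (N / k) k (N % k)) := by
  refine nonempty_iso_pathForest hk ?_ ?_ (by rw [sum_extremalPart, Nat.div_add_mod'])
  · rintro (_ | i)
    · exact (Nat.mod_lt _ hk).le
    · exact le_rfl
  · rintro (_ | i) (_ | j) hi hj
    · rfl
    · exact absurd hj (lt_irrefl k)
    · exact absurd hi (lt_irrefl k)
    · exact absurd hi (lt_irrefl k)

theorem le_of_qIndex_fanGraph_le {k N : ℕ} (hk : 0 < k) {q : ℝ} {Y : ℕ → ℕ → ℝ}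
    (hY : ∀ m ≤ k, m ≤ N → IsPathSolution q m (Y m))
    (hq : qIndex (fanGraph (N / k) k (N % k)) ≤ q) :
    (N : ℝ) + extremalSum (fun m => ∑ t ∈ range m, Y m t) k N ≤ q := by
  obtain ⟨e⟩ := nonempty_iso_extremalPart (N := N) hk
  have h1 : qIndex (fanGraph (N / k) k (N % k)) = _ :=
    (qIndex_eq_of_iso (joinCongr (⊤ : SimpleGraph (Fin 1)) e)).symm
  rw [h1] at hq
  have h2 := sum_add_sum_le_of_qIndex_join_le (q := q)
    (Y := fun o => Y (extremalPart k (N % k) (a := N / k) o)) (fun o => hY _ ?_ ?_) hq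
  · rw [sum_extremalPart, Nat.div_add_mod', Fintype.sum_option] at h2
    simp only [extremalPart, Option.elim] at h2
    simp only [sum_const, card_univ, Fintype.card_fin, nsmul_eq_mul] at h2
    rw [extremalSum]
    linarith
  · rcases o with _ | i
    · exact (Nat.mod_lt _ hk).le
    · exact le_rfl
  · rcases o with _ | i
    · exact Nat.mod_le _ _
    · have hi := i.2
      by_contra h
      exact Nat.not_lt_zero _ (hi.trans_eq (Nat.div_eq_of_lt (show N < k from not_le.1 h)))

theorem card_fanGraph {k N : ℕ} :
    Fintype.card (Fin 1 ⊕ ((Fin (N / k) × Fin k) ⊕ Fin (N % k))) = N + 1 := by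
  have := Nat.div_add_mod' N k
  simp; omega

theorem card_pathForest {k N : ℕ} :
    Fintype.card ((Fin (N / k) × Fin k) ⊕ Fin (N % k)) = N := by
  simp [Nat.div_add_mod']

theorem le_qIndex_fanGraph {k N : ℕ} (hN : 0 < N) :
    (N + 1 : ℝ) ≤ qIndex (fanGraph (N / k) k (N % k)) := by
  have : Nonempty ((Fin (N / k) × Fin k) ⊕ Fin (N % k)) :=
    Fintype.card_pos_iff.1 (by rw [card_pathForest]; exact hN)
  have h := card_add_one_le_qIndex_join (K := pathForest (N / k) k (N % k))
  rw [card_pathForest] at h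
  exact h

theorem lt_qIndex_fanGraph {k N : ℕ} (hN : 2 ≤ N) (hk : 2 ≤ k) :
    (N + 1 : ℝ) < qIndex (fanGraph (N / k) k (N % k)) := by
  have hedge : ∃ u w, (pathForest (N / k) k (N % k)).Adj u w := by
    rcases Nat.eq_zero_or_pos (N / k) with h | h
    · have hr : 2 ≤ N % k := by
        have := Nat.div_add_mod N k
        rw [h] at this; omega
      exact ⟨Sum.inr ⟨0, by omega⟩, Sum.inr ⟨1, by omega⟩, by simp [pathForest, pathGraph_adj_val]⟩
    · exact ⟨Sum.inl (⟨0, h⟩, ⟨0, by omega⟩), Sum.inl (⟨0, h⟩, ⟨1, by omega⟩),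
        by simp [pathForest, copies, pathGraph_adj_val]⟩
  obtain ⟨u, w, huw⟩ := hedge
  have h := card_add_one_lt_qIndex_join huw
  rw [card_pathForest] at h
  exact h

theorem connected_fanGraph (a k r : ℕ) : (fanGraph a k r).Connected := by
  have h : ∀ w, (fanGraph a k r).Reachable (Sum.inl 0) w := by
    rintro (i | w)
    · rw [Fin.fin_one_eq_zero i]
    · exact SimpleGraph.Adj.reachable (by simp [fanGraph, join])
  exact { preconnected := fun u w => (h u).symm.trans (h w), nonempty := ⟨Sum.inl 0⟩ }

theorem isOuterplanar_fanGraph (a k r : ℕ) : IsOuterplanar (fanGraph a k r) := by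
  have hval : ∀ i i' j j' : ℕ, j < k → j' < k → i * k + j = i' * k + j' → i = i' ∧ j = j' := by
    intro i i' j j' hj hj' h
    have h1 : (i * k + j) / k = i := by
      rw [mul_comm, Nat.mul_add_div (by omega), Nat.div_eq_of_lt hj, add_zero]
    have h2 : (i' * k + j') / k = i' := by
      rw [mul_comm, Nat.mul_add_div (by omega), Nat.div_eq_of_lt hj', add_zero]
    rw [h, h2] at h1
    subst h1
    exact ⟨rfl, by omega⟩
  have hlt : ∀ i j : ℕ, i < a → j < k → i * k + j < a * k := by
    intro i j hi hj
    calc i * k + j < i * k + k := by omega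
      _ = (i + 1) * k := by ring
      _ ≤ a * k := Nat.mul_le_mul_right k hi
  -- The paths are laid end to end on the real axis: copy i occupies the positions from i * k on,
  -- and the rest follows at a * k.
  refine isOuterplanar_of_fan (v₀ := Sum.inl 0) (pos := Sum.elim (fun _ => 0) (Sum.elim
    (fun p => p.1 * k + p.2) fun i => a * k + i)) ?_ ?_
  · rintro (i | (⟨i, j⟩ | i)) (i' | (⟨i', j'⟩ | i')) hu hv h
    · exact absurd (by rw [Fin.fin_one_eq_zero i]) hu
    · exact absurd (by rw [Fin.fin_one_eq_zero i]) hu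
    · exact absurd (by rw [Fin.fin_one_eq_zero i]) hu
    · exact absurd (by rw [Fin.fin_one_eq_zero i']) hv
    · obtain ⟨h1, h2⟩ := hval i i' j j' j.2 j'.2 h
      rw [Fin.ext h1, Fin.ext h2]
    · have h : (i : ℕ) * k + j = a * k + i' := h
      have := hlt i j i.2 j.2
      omega
    · exact absurd (by rw [Fin.fin_one_eq_zero i']) hv
    · have h : a * k + i = (i' : ℕ) * k + j' := h
      have := hlt i' j' i'.2 j'.2
      omega
    · have h : a * k + i = a * k + i' := h
      rw [Fin.ext (show (i : ℕ) = i' by omega)]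
  · rintro (i | (⟨i, j⟩ | i)) (i' | (⟨i', j'⟩ | i')) h hu hv
    · exact absurd (by rw [Fin.fin_one_eq_zero i]) hu
    · exact absurd (by rw [Fin.fin_one_eq_zero i]) hu
    · exact absurd (by rw [Fin.fin_one_eq_zero i]) hu
    · exact absurd (by rw [Fin.fin_one_eq_zero i']) hv
    · simp only [fanGraph, join, copies, SimpleGraph.sup_adj, SimpleGraph.sum_adj_inr,
        SimpleGraph.sum_adj_inl, pathGraph_adj_val, completeBipartiteGraph_adj] at h
      simp at h
      obtain ⟨rfl, h⟩ := h
      simp only [Sum.elim_inr, Sum.elim_inl]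
      omega
    · simp [fanGraph, join] at h
    · exact absurd (by rw [Fin.fin_one_eq_zero i']) hv
    · simp [fanGraph, join] at h
    · simp [fanGraph, join, pathGraph_adj_val] at h
      simp only [Sum.elim_inr]
      omega

/-- Deleting the hub from a cycle leaves at least l - 1 = k + 1 consecutive vertices, which stay in
one path; but every path has at most k vertices. -/
theorem free_fanGraph {k l a r : ℕ} (hl : l = k + 2) (hl3 : 3 ≤ l) (hr : r ≤ k) :
    (SimpleGraph.cycleGraph l).Free (fanGraph a k r) := by
  intro hcon
  obtain ⟨c, hc, hadj⟩ := exists_cycle_of_not_free hl3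
    (fun h : (SimpleGraph.cycleGraph l).Free (fanGraph a k r) => h hcon)
  have hex : ∃ s, ∀ t, t + 1 < l → c (s + t) ≠ Sum.inl 0 := by
    by_cases h : ∃ s, c s = Sum.inl 0
    · obtain ⟨s, hs⟩ := h
      refine ⟨s + 1, fun t ht h => ?_⟩
      rw [← hs, hc] at h
      have h2 : (s + 1 + t) ≡ s [MOD l] := h
      have h3 : s + (1 + t) ≡ s + 0 [MOD l] := by simpa [add_assoc] using h2
      have h4 : (1 + t) % l = 0 % l := Nat.ModEq.add_left_cancel' s h3
      rw [Nat.mod_eq_of_lt (by omega), Nat.zero_mod] at h4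
      omega
    · push Not at h
      exact ⟨0, fun t _ => h _⟩
  obtain ⟨s, hs⟩ := hex
  let blk : Fin 1 ⊕ ((Fin a × Fin k) ⊕ Fin r) → ℕ :=
    Sum.elim (fun _ => 0) (Sum.elim (fun p => p.1) fun _ => a)
  let idx : Fin 1 ⊕ ((Fin a × Fin k) ⊕ Fin r) → ℕ :=
    Sum.elim (fun _ => 0) (Sum.elim (fun p => p.2) fun i => i)
  have hidx : ∀ u, u ≠ Sum.inl 0 → idx u < k := by
    rintro (i | (⟨i, j⟩ | i)) hu
    · exact absurd (by rw [Fin.fin_one_eq_zero i]) hu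
    · exact j.2
    · exact i.2.trans_le hr
  have hinj : ∀ u w, u ≠ Sum.inl 0 → w ≠ Sum.inl 0 → blk u = blk w → idx u = idx w → u = w := by
    rintro (i | (⟨i, j⟩ | i)) (i' | (⟨i', j'⟩ | i')) hu hv h1 h2
    · exact absurd (by rw [Fin.fin_one_eq_zero i]) hu
    · exact absurd (by rw [Fin.fin_one_eq_zero i]) hu
    · exact absurd (by rw [Fin.fin_one_eq_zero i]) hu
    · exact absurd (by rw [Fin.fin_one_eq_zero i']) hv
    · rw [Fin.ext (show (i : ℕ) = i' from h1), Fin.ext (show (j : ℕ) = j' from h2)]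
    · exact absurd (show (i : ℕ) = a from h1) i.2.ne
    · exact absurd (by rw [Fin.fin_one_eq_zero i']) hv
    · exact absurd (show a = (i' : ℕ) from h1) i'.2.ne'
    · rw [Fin.ext (show (i : ℕ) = i' from h2)]
  have hblk : ∀ u w, u ≠ Sum.inl 0 → w ≠ Sum.inl 0 → (fanGraph a k r).Adj u w →
      blk u = blk w := by
    rintro (i | (⟨i, j⟩ | i)) (i' | (⟨i', j'⟩ | i')) hu hv h
    · exact absurd (by rw [Fin.fin_one_eq_zero i]) hu
    · exact absurd (by rw [Fin.fin_one_eq_zero i]) hu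
    · exact absurd (by rw [Fin.fin_one_eq_zero i]) hu
    · exact absurd (by rw [Fin.fin_one_eq_zero i']) hv
    · simp [fanGraph, join, copies] at h
      simp [blk, h.1]
    · simp [fanGraph, join] at h
    · exact absurd (by rw [Fin.fin_one_eq_zero i']) hv
    · simp [fanGraph, join] at h
    · rfl
  have hconst : ∀ t, t + 1 < l → blk (c (s + t)) = blk (c s) := by
    intro t
    induction t with
    | zero => intro _; rfl
    | succ t ih =>
      intro ht
      rw [← ih (by omega)]
      exact (hblk _ _ (hs t (by omega)) (hs (t + 1) ht) (hadj (s + t))).symm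
  have hle : (range (l - 1)).card ≤ (range k).card := by
    refine card_le_card_of_injOn (fun t => idx (c (s + t))) ?_ ?_
    · intro t ht
      have ht : t < l - 1 := by simpa using ht
      simpa using hidx _ (hs t (by omega))
    · intro t ht t' ht' h
      have ht : t < l - 1 := by simpa using ht
      have ht' : t' < l - 1 := by simpa using ht'
      have h1 := hinj _ _ (hs t (by omega)) (hs t' (by omega))
        ((hconst t (by omega)).trans (hconst t' (by omega)).symm) h
      rw [hc] at h1
      have h2 : t % l = t' % l := Nat.ModEq.add_left_cancel' s h1
      rwa [Nat.mod_eq_of_lt (by omega), Nat.mod_eq_of_lt (by omega)] at h2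
  rw [card_range, card_range] at hle
  omega

end OuterplanarQ

end

section

/-! ### The structure of an outerplanar graph around a vertex -/

namespace OuterplanarQ

open Finset

variable {V : Type*} {G : SimpleGraph V}

theorem IsOuterplanar.no_three_common [Finite V] (h : IsOuterplanar G) {u w a b c : V}
    (huw : u ≠ w) (hab : a ≠ b) (hac : a ≠ c) (hbc : b ≠ c) (hua : G.Adj u a) (hub : G.Adj u b)
    (huc : G.Adj u c) (hwa : G.Adj w a) (hwb : G.Adj w b) (hwc : G.Adj w c) : False := by
  refine h.no_theta huw hab hua hub hwa hwb huc hwc.toWalk hwc.ne fun x hx => ?_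
  simp only [SimpleGraph.Walk.support_cons, SimpleGraph.Walk.support_nil,
    List.mem_cons, List.not_mem_nil, or_false] at hx
  rcases hx with rfl | rfl
  · exact ⟨huw.symm, hwa.ne, hwb.ne⟩
  · exact ⟨huc.ne', hac.symm, hbc.symm⟩

theorem exists_walk_of_seq (p : ℕ → V) {s e : ℕ} (hse : s ≤ e)
    (hadj : ∀ t, s ≤ t → t < e → G.Adj (p t) (p (t + 1))) :
    ∃ w : G.Walk (p s) (p e), ∀ x ∈ w.support, ∃ t, s ≤ t ∧ t ≤ e ∧ x = p t := by
  induction e, hse using Nat.le_induction with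
  | base => exact ⟨SimpleGraph.Walk.nil, fun x hx => ⟨s, le_rfl, le_rfl, by simpa using hx⟩⟩
  | succ e hse ih =>
    obtain ⟨w, hw⟩ := ih fun t h1 h2 => hadj t h1 (by omega)
    refine ⟨w.concat (hadj e hse (by omega)), fun x hx => ?_⟩
    rw [SimpleGraph.Walk.support_concat, List.mem_append,
      List.mem_singleton] at hx
    rcases hx with hx | rfl
    · obtain ⟨t, h1, h2, h3⟩ := hw x hx
      exact ⟨t, h1, by omega, h3⟩
    · exact ⟨e + 1, by omega, le_rfl, rfl⟩

/-- The neighbourhood of a vertex of an outerplanar graph induces a linear forest. -/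
theorem IsOuterplanar.exists_iso_neighborSet [Finite V] (h : IsOuterplanar G) (v : V) :
    ∃ (ι : Type) (_ : Fintype ι) (m : ι → ℕ), (∀ i, 0 < m i) ∧
      Nonempty (G.induce (G.neighborSet v) ≃g sigmaPath m) := by
  refine exists_iso_sigmaPath _ ?_ ?_
  · intro u a b c h1 h2 h3 h4 h5 h6
    have hu : G.Adj v u := u.2
    exact h.no_three_common hu.ne (fun h => h4 (Subtype.ext h)) (fun h => h5 (Subtype.ext h))
      (fun h => h6 (Subtype.ext h)) a.2 b.2 c.2 h1 h2 h3
  · rintro n p hn ⟨hinj, hadj⟩ hcl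
    have hadj : ∀ t, t + 1 < n → G.Adj (p t) (p (t + 1)) := hadj
    have hcl : G.Adj (p 0) (p (n - 1)) := hcl
    have hv : ∀ t, G.Adj v (p t) := fun t => (p t).2
    have hne : ∀ s t, s < n → t < n → s ≠ t → (p s : V) ≠ p t := fun s t hs ht hst h =>
      hst (hinj hs ht (Subtype.ext h))
    -- A triangle among the neighbours forms a K₄ with `v`. In a longer cycle, p 0 and p 2 have the
    -- common neighbours `v` and p 1 and are joined by the rest of the cycle, which is an excluded
    -- theta.
    rcases hn.eq_or_lt with rfl | hn
    · exact h.no_K4 (hv 0) (hv 1) (hv 2) (hadj 0 (by omega)) hcl (hadj 1 (by omega))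
    · obtain ⟨w, hw⟩ := exists_walk_of_seq (G := G) (fun t => (p t : V))
        (show 2 ≤ n - 1 by omega) fun t _ h2 => hadj t (by omega)
      refine h.no_theta (hne 0 2 (by omega) (by omega) (by omega)) (hv 1).ne (hv 0).symm
        (hadj 0 (by omega)) (hv 2).symm (hadj 1 (by omega)).symm hcl w
        (hne 2 (n - 1) (by omega) (by omega) (by omega)) fun x hx => ?_
      obtain ⟨t, h1, h2, rfl⟩ := hw x hx
      exact ⟨hne _ _ (by omega) (by omega) (by omega), (hv t).ne',
        hne _ _ (by omega) (by omega) (by omega)⟩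

section neighborhood

variable {ι : Type} {m : ι → ℕ} {v : V}

theorem adj_of_iso
    (e : G.induce (G.neighborSet v) ≃g sigmaPath m) (p : Σ i, Fin (m i)) : G.Adj v (e.symm p) := (e.symm p).2

theorem adj_symm_iff
    (e : G.induce (G.neighborSet v) ≃g sigmaPath m) (p p' : Σ i, Fin (m i)) :
    G.Adj (e.symm p) (e.symm p') ↔ (sigmaPath m).Adj p p' :=
  e.symm.map_adj_iff (v := p) (w := p')

theorem coe_symm_injective
    (e : G.induce (G.neighborSet v) ≃g sigmaPath m) : Function.Injective fun p => (e.symm p : V) :=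
  Subtype.val_injective.comp e.symm.injective

theorem exists_eq_symm
    (e : G.induce (G.neighborSet v) ≃g sigmaPath m) {u : V} (h : G.Adj v u) : ∃ p, u = e.symm p :=
  ⟨e ⟨u, h⟩, by simp⟩

/-- The hub followed by k + 1 consecutive vertices of a longer path closes up to a cycle with k + 2
vertices. -/
theorem part_le_of_free
    (e : G.induce (G.neighborSet v) ≃g sigmaPath m) {k l : ℕ} (hl : l = k + 2) (hl3 : 3 ≤ l)
    (hfree : (SimpleGraph.cycleGraph l).Free G) (i : ι) : m i ≤ k := by
  by_contra hi
  let c : ℕ → V := fun t => if h : 0 < t ∧ t - 1 < m i then e.symm ⟨i, ⟨t - 1, h.2⟩⟩ else v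
  have hc : ∀ t (h : 0 < t ∧ t - 1 < m i), c t = e.symm ⟨i, ⟨t - 1, h.2⟩⟩ := fun t h => dif_pos h
  have hc0 : c 0 = v := dif_neg (by omega)
  refine not_free_cycleGraph hl3 (c := c) ⟨?_, ?_⟩ ?_ hfree
  · intro s hs t ht h
    have hs : s < l := hs
    have ht : t < l := ht
    rcases Nat.eq_zero_or_pos s with rfl | hs0 <;> rcases Nat.eq_zero_or_pos t with rfl | ht0
    · rfl
    · rw [hc0, hc t ⟨ht0, by omega⟩] at h
      exact absurd h (adj_of_iso e _).ne
    · rw [hc0, hc s ⟨hs0, by omega⟩] at h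
      exact absurd h (adj_of_iso e _).ne'
    · rw [hc t ⟨ht0, by omega⟩, hc s ⟨hs0, by omega⟩] at h
      have := coe_symm_injective e h
      simp only [Sigma.mk.injEq, heq_eq_eq, Fin.mk.injEq, true_and] at this
      omega
  · intro t ht
    rcases Nat.eq_zero_or_pos t with rfl | ht0
    · rw [hc0, hc 1 ⟨by omega, by omega⟩]
      exact adj_of_iso e _
    · rw [hc t ⟨ht0, by omega⟩, hc (t + 1) ⟨by omega, by omega⟩, adj_symm_iff]
      refine ⟨rfl, Or.inl ?_⟩
      change t - 1 + 1 = t + 1 - 1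
      omega
  · rw [hc0, hc (l - 1) ⟨by omega, by omega⟩]
    exact (adj_of_iso e _).symm

/-- A vertex outside the closed neighbourhood of `v` is not adjacent to two vertices of the same
path of the neighbourhood, unless these are consecutive. -/
theorem IsOuterplanar.consecutive [Finite V] (h : IsOuterplanar G)
    (e : G.induce (G.neighborSet v) ≃g sigmaPath m) 
    {r : V} (hr : ¬ G.Adj v r)
    (hrv : r ≠ v) {i : ι} {x y : Fin (m i)} (hx : G.Adj r (e.symm ⟨i, x⟩))
    (hy : G.Adj r (e.symm ⟨i, y⟩)) (hxy : (x : ℕ) < y) : (y : ℕ) = x + 1 := by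
  by_contra hne
  let p : ℕ → V := fun t => if h : t < m i then e.symm ⟨i, ⟨t, h⟩⟩ else v
  have hp : ∀ t (h : t < m i), p t = e.symm ⟨i, ⟨t, h⟩⟩ := fun t h => dif_pos h
  have hy2 := y.2
  have hadj : ∀ t, t + 1 < m i → G.Adj (p t) (p (t + 1)) := by
    intro t ht
    rw [hp t (by omega), hp _ ht, adj_symm_iff]
    exact ⟨rfl, Or.inl rfl⟩
  have hpne : ∀ s t, s < m i → t < m i → s ≠ t → p s ≠ p t := by
    intro s t hs ht hst h
    rw [hp s hs, hp t ht] at h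
    have := coe_symm_injective e h
    simp only [Sigma.mk.injEq, heq_eq_eq, Fin.mk.injEq, true_and] at this
    exact hst this
  have hv : ∀ t, t < m i → G.Adj v (p t) := by
    intro t ht
    rw [hp t ht]; exact adj_of_iso e _
  have hx' : G.Adj r (p x) := by rw [hp x x.2]; exact hx
  have hy' : G.Adj r (p y) := by rw [hp y y.2]; exact hy
  obtain ⟨w, hw⟩ := exists_walk_of_seq (G := G) p (show (x : ℕ) + 1 ≤ y by omega) fun t _ h2 =>
    hadj t (by omega)
  -- The two vertices have the common neighbours `r` and `v`; a path segment between them with an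
  -- inner vertex is the third connection of a theta.
  refine h.no_theta (hpne x y x.2 y.2 (by omega)) hrv (hx'.symm)
    (hv x x.2).symm hy'.symm (hv y y.2).symm (hadj x (by omega)) w.reverse
    (hpne y (x + 1) y.2 (by omega) (by omega)) fun z hz => ?_
  rw [SimpleGraph.Walk.support_reverse, List.mem_reverse] at hz
  obtain ⟨t, h1, h2, rfl⟩ := hw z hz
  refine ⟨hpne _ _ (by omega) (by omega) (by omega), fun h => hr ?_, (hv t (by omega)).ne'⟩
  rw [← h]; exact hv t (by omega)

variable [Fintype V]

open Classical in
/-- The neighbours of `v`. -/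
noncomputable def nbr (G : SimpleGraph V) (v : V) : Finset V := univ.filter (G.Adj v)

open Classical in
/-- The vertices outside the closed neighbourhood of `v`. -/
noncomputable def far (G : SimpleGraph V) (v : V) : Finset V :=
  univ.filter fun u => u ≠ v ∧ ¬ G.Adj v u

theorem mem_nbr {u : V} : u ∈ nbr G v ↔ G.Adj v u := by simp [nbr]

theorem mem_far {u : V} : u ∈ far G v ↔ u ≠ v ∧ ¬ G.Adj v u := by simp [far]

end neighborhood

end OuterplanarQ

end

section

/-! ### Eigenvectors and test vectors relative to a vertex of maximal value -/

namespace OuterplanarQ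

open Finset

variable {V : Type*} [Fintype V] {G : SimpleGraph V} {q : ℝ} {v : V} {x y : V → ℝ}

/-- `x` is a positive eigenvector with eigenvalue `q` whose maximal value `1` is attained
at `v`. -/
structure IsHubVector (G : SimpleGraph V) (q : ℝ) (v : V) (x : V → ℝ) : Prop where
  pos : ∀ u, 0 < x u
  hub : x v = 1
  le_one : ∀ u, x u ≤ 1
  eq : ∀ u, qOp G x u = q * x u

theorem sum_eq_hub_add (G : SimpleGraph V) (v : V) (f : V → ℝ) :
    ∑ u, f u = f v + (∑ u ∈ nbr G v, f u + ∑ u ∈ far G v, f u) := by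
  classical
  rw [← add_sum_erase univ f (mem_univ v)]
  congr 1
  rw [← sum_union]
  · refine sum_congr ?_ fun _ _ => rfl
    ext u
    simp only [mem_erase, mem_univ, and_true, mem_union, mem_nbr, mem_far]
    constructor
    · intro h
      by_cases h1 : G.Adj v u
      · exact Or.inl h1
      · exact Or.inr ⟨h, h1⟩
    · rintro (h | h)
      · exact h.ne'
      · exact h.1
  · rw [disjoint_left]
    intro u h1 h2
    exact (mem_far.1 h2).2 (mem_nbr.1 h1)

theorem card_nbr_add_card_far (G : SimpleGraph V) (v : V) :
    1 + (nbr G v).card + (far G v).card = Fintype.card V := by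
  have h := sum_eq_hub_add G v fun _ => 1
  simp only [sum_const, card_univ, nsmul_eq_mul, mul_one] at h
  have h2 : (Fintype.card V : ℝ) = ((1 + (nbr G v).card + (far G v).card : ℕ) : ℝ) := by
    push_cast; linarith
  exact_mod_cast h2.symm

theorem qOp_hub (z : V → ℝ) :
    qOp G z v = (nbr G v).card * z v + ∑ u ∈ nbr G v, z u := by
  rw [← nsmul_eq_mul, ← sum_const, ← sum_add_distrib]
  rfl

open Classical in
theorem qOp_of_mem_nbr (z : V → ℝ) {u : V} (hu : u ∈ nbr G v) :
    qOp G z u = z v + z u + (∑ w ∈ nbr G v, if G.Adj u w then z u + z w else 0) +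
      ∑ r ∈ far G v, if G.Adj u r then z u + z r else 0 := by
  rw [qOp_eq_ite, sum_eq_hub_add G v, if_pos (mem_nbr.1 hu).symm]
  ring

open Classical in
theorem qOp_of_mem_far (z : V → ℝ) {r : V} (hr : r ∈ far G v) :
    qOp G z r = (∑ w ∈ nbr G v, if G.Adj r w then z r + z w else 0) +
      ∑ r' ∈ far G v, if G.Adj r r' then z r + z r' else 0 := by
  rw [qOp_eq_ite, sum_eq_hub_add G v, if_neg fun h => (mem_far.1 hr).2 h.symm, zero_add]

open Classical in
/-- `y` satisfies the eigenvalue equations of the closed neighbourhood of `v` at the neighbours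
of `v` and has the value `ρ` outside. -/
structure IsTestVector (G : SimpleGraph V) (q ρ : ℝ) (v : V) (y : V → ℝ) : Prop where
  hub : y v = 1
  far : ∀ r ∈ far G v, y r = ρ
  nbr : ∀ u ∈ nbr G v,
    1 + y u + (∑ w ∈ nbr G v, if G.Adj u w then y u + y w else 0) = q * y u

-- Symmetry of the signless Laplacian: ⟨y, Qx⟩ = ⟨x, Qy⟩. At the neighbours of `v` the vector `y`
-- satisfies the equations of the closed neighbourhood, so there only the edges to far vertices
-- survive; the condition on ρ is the equation of a one-vertex path.
open Classical in
theorem IsHubVector.sum_identity {ρ : ℝ} (hx : IsHubVector G q v x)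
    (hy : IsTestVector G q ρ v y) (hρ : q * ρ = 1 + ρ) :
    q + (1 + ρ) * ∑ r ∈ far G v, x r = (nbr G v).card + ∑ u ∈ nbr G v, y u +
      (∑ r ∈ far G v, ∑ w ∈ nbr G v, if G.Adj r w then (x w + x r) * (y w + ρ) else 0) +
      ∑ r ∈ far G v, ∑ r' ∈ far G v, if G.Adj r r' then 2 * ρ * x r else 0 := by
  have h := sum_mul_qOp_comm (G := G) x y
  rw [sum_congr rfl fun u _ => by rw [hx.eq u], sum_eq_hub_add G v, sum_eq_hub_add G v,
    hx.hub, hy.hub, qOp_hub, hy.hub] at h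
  have hN : ∑ u ∈ nbr G v, x u * qOp G y u = ∑ u ∈ nbr G v, y u * (q * x u) +
      ∑ r ∈ far G v, ∑ w ∈ nbr G v, if G.Adj r w then x w * (y w + ρ) else 0 := by
    rw [sum_comm, ← sum_add_distrib]
    refine sum_congr rfl fun u hu => ?_
    rw [qOp_of_mem_nbr y hu, hy.hub, hy.nbr u hu, mul_add, mul_sum]
    congr 1
    · ring
    · refine sum_congr rfl fun r hr => ?_
      rw [hy.far r hr]
      simp only [G.adj_comm r u, mul_ite, mul_zero]
  have hR : ∑ r ∈ far G v, x r * qOp G y r =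
      (∑ r ∈ far G v, ∑ w ∈ nbr G v, if G.Adj r w then x r * (y w + ρ) else 0) +
      ∑ r ∈ far G v, ∑ r' ∈ far G v, if G.Adj r r' then 2 * ρ * x r else 0 := by
    rw [← sum_add_distrib]
    refine sum_congr rfl fun r hr => ?_
    rw [qOp_of_mem_far y hr, mul_add, mul_sum, mul_sum]
    congr 1
    · refine sum_congr rfl fun u _ => ?_
      rw [hy.far r hr, mul_ite, mul_zero, add_comm ρ]
    · refine sum_congr rfl fun r' hr' => ?_
      rw [hy.far r hr, hy.far r' hr']
      split_ifs <;> ring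
  have hL : ∑ r ∈ far G v, y r * (q * x r) = (1 + ρ) * ∑ r ∈ far G v, x r := by
    rw [mul_sum]
    refine sum_congr rfl fun r hr => ?_
    rw [hy.far r hr]
    linear_combination x r * hρ
  have hs : (∑ r ∈ far G v, ∑ w ∈ nbr G v, if G.Adj r w then (x w + x r) * (y w + ρ) else 0) =
      (∑ r ∈ far G v, ∑ w ∈ nbr G v, if G.Adj r w then x w * (y w + ρ) else 0) +
      ∑ r ∈ far G v, ∑ w ∈ nbr G v, if G.Adj r w then x r * (y w + ρ) else 0 := by
    simp only [← sum_add_distrib]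
    refine sum_congr rfl fun r _ => sum_congr rfl fun w _ => ?_
    split_ifs <;> ring
  rw [hN, hR, hL] at h
  rw [hs]
  linarith

theorem IsHubVector.eq_card_add (hx : IsHubVector G q v x) :
    q = (nbr G v).card + ∑ u ∈ nbr G v, x u := by
  have h := hx.eq v
  rw [qOp_hub, hx.hub] at h
  linarith

/-- Once q exceeds the order, this makes the hub adjacent to more than half of the vertices. -/
theorem IsHubVector.le_two_mul_card (hx : IsHubVector G q v x) : q ≤ 2 * (nbr G v).card := by
  have h := hx.eq_card_add
  have : ∑ u ∈ nbr G v, x u ≤ ∑ u ∈ nbr G v, 1 := sum_le_sum fun u _ => hx.le_one u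
  simp at this
  linarith

/-- An upper bound for the eigenvalue equation at `u` in terms of a set containing the
neighbours of `u`. -/
theorem IsHubVector.mul_le_sum (hx : IsHubVector G q v x) {u : V} {T : Finset V}
    (hT : ∀ w, G.Adj u w → w ∈ T) : q * x u ≤ ∑ w ∈ T, (x u + x w) := by
  classical
  rw [← hx.eq u, qOp]
  refine sum_le_sum_of_subset_of_nonneg (fun w hw => hT w (by simpa using hw)) fun w _ _ => ?_
  have := hx.pos u
  have := hx.pos w
  linarith

open Classical in
/-- The eigenvalue equations summed over the neighbours of the vertex of maximal value. -/
theorem IsHubVector.mul_sum_le (hx : IsHubVector G q v x) {δ : ℕ}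
    (hδ : ∀ u ∈ nbr G v, ((nbr G v).filter (G.Adj u)).card ≤ δ)
    (hfar : ∀ r ∈ far G v, ((nbr G v).filter (G.Adj r)).card ≤ 2) :
    q * ∑ u ∈ nbr G v, x u ≤
      (nbr G v).card + (1 + 2 * δ) * ∑ u ∈ nbr G v, x u + 4 * (far G v).card := by
  have h1 : ∑ u ∈ nbr G v, ∑ w ∈ nbr G v, (if G.Adj u w then x u + x w else 0) ≤
      2 * δ * ∑ u ∈ nbr G v, x u := by
    have hsplit : ∑ u ∈ nbr G v, ∑ w ∈ nbr G v, (if G.Adj u w then x u + x w else 0) =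
        (∑ u ∈ nbr G v, ∑ w ∈ nbr G v, if G.Adj u w then x u else 0) +
        ∑ u ∈ nbr G v, ∑ w ∈ nbr G v, if G.Adj u w then x w else 0 := by
      simp only [← sum_add_distrib]
      refine sum_congr rfl fun r _ => sum_congr rfl fun w _ => ?_
      split_ifs <;> ring
    have hsymm : (∑ u ∈ nbr G v, ∑ w ∈ nbr G v, if G.Adj u w then x w else 0) =
        ∑ u ∈ nbr G v, ∑ w ∈ nbr G v, if G.Adj u w then x u else 0 := by
      rw [sum_comm]
      simp only [G.adj_comm]
    have hle : ∑ u ∈ nbr G v, ∑ w ∈ nbr G v, (if G.Adj u w then x u else 0) ≤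
        δ * ∑ u ∈ nbr G v, x u := by
      rw [mul_sum]
      refine sum_le_sum fun u hu => ?_
      rw [← sum_filter, sum_const, nsmul_eq_mul]
      exact mul_le_mul_of_nonneg_right (by exact_mod_cast hδ u hu) (hx.pos u).le
    rw [hsplit, hsymm]
    linarith
  have h2 : ∑ u ∈ nbr G v, ∑ r ∈ far G v, (if G.Adj u r then x u + x r else 0) ≤
      4 * (far G v).card := by
    rw [sum_comm, mul_comm, ← nsmul_eq_mul, ← sum_const]
    refine sum_le_sum fun r hr => ?_
    rw [← sum_filter]
    calc ∑ u ∈ nbr G v with G.Adj u r, (x u + x r)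
        ≤ ∑ u ∈ nbr G v with G.Adj u r, 2 := sum_le_sum fun u _ => by
          have := hx.le_one u
          have := hx.le_one r
          linarith
      _ = ((nbr G v).filter (G.Adj r)).card * 2 := by
          rw [sum_const, nsmul_eq_mul]
          simp only [G.adj_comm]
      _ ≤ 4 := by
          have : (((nbr G v).filter (G.Adj r)).card : ℝ) ≤ 2 := by exact_mod_cast hfar r hr
          linarith
  have h3 : q * ∑ u ∈ nbr G v, x u = ∑ u ∈ nbr G v, (1 + x u) +
      ∑ u ∈ nbr G v, ∑ w ∈ nbr G v, (if G.Adj u w then x u + x w else 0) +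
      ∑ u ∈ nbr G v, ∑ r ∈ far G v, (if G.Adj u r then x u + x r else 0) := by
    rw [mul_sum, ← sum_add_distrib, ← sum_add_distrib]
    refine sum_congr rfl fun u hu => ?_
    rw [← hx.eq, qOp_of_mem_nbr x hu, hx.hub]
  rw [h3, sum_add_distrib, sum_const, nsmul_eq_mul, mul_one]
  linarith

section testVector

variable {ι : Type} [Fintype ι] {m : ι → ℕ}

theorem sum_nbr (e : G.induce (G.neighborSet v) ≃g sigmaPath m) (f : V → ℝ) :
    ∑ u ∈ nbr G v, f u = ∑ p, f (e.symm p) := by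
  refine (sum_bij (fun p _ => (e.symm p : V)) (fun p _ => mem_nbr.2 (adj_of_iso e p))
    (fun p _ p' _ h => coe_symm_injective e h) (fun u hu => ?_) fun _ _ => rfl).symm
  obtain ⟨p, rfl⟩ := exists_eq_symm e (mem_nbr.1 hu)
  exact ⟨p, mem_univ _, rfl⟩

theorem card_nbr (e : G.induce (G.neighborSet v) ≃g sigmaPath m) :
    (nbr G v).card = ∑ i, m i := by
  have h := sum_nbr e fun _ => 1
  simp only [sum_const, card_univ, nsmul_eq_mul, mul_one, Fintype.card_sigma,
    Fintype.card_fin] at h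
  exact_mod_cast h

theorem exists_isTestVector (e : G.induce (G.neighborSet v) ≃g sigmaPath m) {Y : ι → ℕ → ℝ}
    (hY : ∀ i, IsPathSolution q (m i) (Y i)) (ρ : ℝ) :
    ∃ y, IsTestVector G q ρ v y ∧ ∀ p, y (e.symm p) = Y p.1 p.2 := by
  classical
  let y : V → ℝ := fun u => if h : G.Adj v u then Y (e ⟨u, h⟩).1 (e ⟨u, h⟩).2 else
    if u = v then 1 else ρ
  have hy : ∀ p, y (e.symm p) = Y p.1 p.2 := by
    intro p
    simp only [y]
    rw [dif_pos (adj_of_iso e p)]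
    exact congrArg (fun p' : Σ i, Fin (m i) => Y p'.1 p'.2) (e.apply_symm_apply p)
  refine ⟨y, ⟨?_, fun r hr => ?_, fun u hu => ?_⟩, hy⟩
  · simp [y]
  · simp only [y]
    rw [dif_neg (mem_far.1 hr).2, if_neg (mem_far.1 hr).1]
  · obtain ⟨p, rfl⟩ := exists_eq_symm e (mem_nbr.1 hu)
    rw [sum_nbr e, hy, ← IsPathSolution.qOp_sigmaPath hY p, qOp_eq_ite]
    simp only [hy, adj_symm_iff]

end testVector

end OuterplanarQ

end

section

/-! ### Short paths -/

namespace OuterplanarQ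

open Finset

section IsPathSolution

variable {q : ℝ} {y : ℕ → ℝ}

theorem IsPathSolution.one (h : IsPathSolution q 1 y) (hq : 1 < q) : y 0 = 1 / (q - 1) := by
  have h0 := h.eq 0 (by omega)
  simp at h0
  rw [eq_div_iff (by linarith)]
  linarith

theorem IsPathSolution.two (h : IsPathSolution q 2 y) (hq : 3 < q) :
    y 0 = 1 / (q - 3) ∧ y 1 = 1 / (q - 3) := by
  have h0 := h.eq 0 (by omega)
  have h1 := h.eq 1 (by omega)
  simp at h0 h1
  have h2 : y 0 = y 1 := by
    have : (q - 1) * (y 0 - y 1) = 0 := by linear_combination h0 - h1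
    rcases mul_eq_zero.1 this with h | h <;> linarith
  rw [← h2, and_self, eq_div_iff (by linarith)]
  rw [← h2] at h0
  linarith

theorem IsPathSolution.three (h : IsPathSolution q 3 y) (hq : 4 < q) :
    y 0 = (q - 2) / ((q - 1) * (q - 4)) ∧ y 1 = q / ((q - 1) * (q - 4)) ∧
      y 2 = (q - 2) / ((q - 1) * (q - 4)) := by
  have h0 := h.eq 0 (by omega)
  have h1 := h.eq 1 (by omega)
  have h2 := h.eq 2 (by omega)
  simp at h0 h1 h2
  have h3 : y 2 = y 0 := by
    have : (q - 2) * (y 0 - y 2) = 0 := by linear_combination h0 - h2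
    rcases mul_eq_zero.1 this with h | h <;> linarith
  have hD : 0 < (q - 1) * (q - 4) := mul_pos (by linarith) (by linarith)
  rw [h3] at h1
  have e1 : y 1 = (q - 2) * y 0 - 1 := by linear_combination -h0
  have e0 : y 0 * ((q - 1) * (q - 4)) = q - 2 := by
    rw [e1] at h1
    linear_combination h1
  rw [h3, eq_div_iff hD.ne', eq_div_iff hD.ne', e1]
  refine ⟨e0, ?_, e0⟩
  linear_combination (q - 2) * e0

theorem four_path_denominator_pos (hq : 5 < q) : 0 < q ^ 2 - 6 * q + 7 := by nlinarith

theorem IsPathSolution.four (h : IsPathSolution q 4 y) (hq : 5 < q) :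
    y 0 = (q - 3) / (q ^ 2 - 6 * q + 7) ∧ y 1 = (q - 1) / (q ^ 2 - 6 * q + 7) ∧
      y 2 = (q - 1) / (q ^ 2 - 6 * q + 7) ∧ y 3 = (q - 3) / (q ^ 2 - 6 * q + 7) := by
  have h0 := h.eq 0 (by omega)
  have h1 := h.eq 1 (by omega)
  have h2 := h.eq 2 (by omega)
  have h3 := h.eq 3 (by omega)
  simp at h0 h1 h2 h3
  have hD := four_path_denominator_pos hq
  have h12 : y 2 = y 1 := by
    have : ((q - 2) ^ 2 - 1) * (y 1 - y 2) = 0 := by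
      linear_combination (q - 2) * (h1 - h2) + h0 - h3
    rcases mul_eq_zero.1 this with h | h
    · nlinarith
    · linarith
  have h03 : y 3 = y 0 := by
    have : (q - 2) * (y 0 - y 3) = 0 := by
      rw [h12] at h3
      linear_combination h0 - h3
    rcases mul_eq_zero.1 this with h | h <;> linarith
  rw [h12] at h1
  have e1 : y 1 = (q - 2) * y 0 - 1 := by linear_combination -h0
  have e0 : y 0 * (q ^ 2 - 6 * q + 7) = q - 3 := by
    rw [e1] at h1
    linear_combination h1
  rw [h12, h03, eq_div_iff hD.ne', eq_div_iff hD.ne', e1]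
  have e2 : ((q - 2) * y 0 - 1) * (q ^ 2 - 6 * q + 7) = q - 1 := by
    linear_combination (q - 2) * e0
  exact ⟨e0, e2, e2, e0⟩

/-- A lower bound for the sum over a path on five vertices. -/
theorem IsPathSolution.five (h : IsPathSolution q 5 y) (hq : 6 < q) (hq' : q < 6.84) :
    2 < ∑ t ∈ range 5, y t := by
  have h0 := h.eq 0 (by omega)
  have h1 := h.eq 1 (by omega)
  have h2 := h.eq 2 (by omega)
  have h3 := h.eq 3 (by omega)
  have h4 := h.eq 4 (by omega)
  have p0 := h.pos 0 (by omega)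
  have p1 := h.pos 1 (by omega)
  have p2 := h.pos 2 (by omega)
  have p3 := h.pos 3 (by omega)
  have p4 := h.pos 4 (by omega)
  simp at h0 h1 h2 h3 h4
  simp only [sum_range_succ, sum_range_zero, zero_add]
  -- Replacing q by its upper bound 6.84 turns the equations into linear inequalities with constant
  -- coefficients, which already force the sum above 2.
  have i0 : 1 + y 1 ≤ 4.84 * y 0 := by nlinarith
  have i1 : 1 + y 0 + y 2 ≤ 3.84 * y 1 := by nlinarith
  have i2 : 1 + y 1 + y 3 ≤ 3.84 * y 2 := by nlinarith
  have i3 : 1 + y 4 + y 2 ≤ 3.84 * y 3 := by nlinarith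
  have i4 : 1 + y 3 ≤ 4.84 * y 4 := by nlinarith
  linarith

theorem isPathSolution_zero : IsPathSolution q 0 y := ⟨by simp, by simp⟩

theorem isPathSolution_one (hq : 1 < q) : IsPathSolution q 1 fun _ => 1 / (q - 1) := by
  refine ⟨fun _ _ => one_div_pos.2 (by linarith), fun i hi => ?_⟩
  obtain rfl : i = 0 := by omega
  have : q - 1 ≠ 0 := by linarith
  simp
  field_simp
  ring

theorem isPathSolution_two (hq : 3 < q) : IsPathSolution q 2 fun _ => 1 / (q - 3) := by
  refine ⟨fun _ _ => one_div_pos.2 (by linarith), fun i hi => ?_⟩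
  have : q - 3 ≠ 0 := by linarith
  interval_cases i <;> simp <;> field_simp <;> ring

theorem isPathSolution_three (hq : 4 < q) : IsPathSolution q 3
    fun i => if i = 1 then q / ((q - 1) * (q - 4)) else (q - 2) / ((q - 1) * (q - 4)) := by
  have h1 : 0 < q - 1 := by linarith
  have h4 : 0 < q - 4 := by linarith
  have h2 : 0 < q - 2 := by linarith
  refine ⟨fun i _ => ?_, fun i hi => ?_⟩
  · have : 0 < q := by linarith
    split_ifs <;> positivity
  · have := h1.ne'
    have := h4.ne'
    interval_cases i <;> simp <;> field_simp <;> ring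

end IsPathSolution

/-- For `q` large enough, there are solutions of the path equations whose sums are strictly
convex in the number of vertices. -/
theorem exists_path_solutions {N : ℕ} {q : ℝ} (hN : 2 ≤ N) (hq : N + 1 < q) :
    ∃ Y : ℕ → ℕ → ℝ, (∀ m ≤ N, IsPathSolution q m (Y m)) ∧
      ∀ a b K e, a + b = K + e → e < a → e < b → a + b ≤ N →
        ∑ t ∈ range a, Y a t + ∑ t ∈ range b, Y b t <
          ∑ t ∈ range K, Y K t + ∑ t ∈ range e, Y e t := by
  -- For N < 4 the value q may be at most 5, where there is no parameter t > 1; the explicit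
  -- solutions on at most three vertices are used instead.
  rcases Nat.lt_or_ge N 4 with h | h
  · let Y : ℕ → ℕ → ℝ := fun m i => if m = 1 then 1 / (q - 1) else if m = 2 then 1 / (q - 3) else
      if i = 1 then q / ((q - 1) * (q - 4)) else (q - 2) / ((q - 1) * (q - 4))
    have hN2 : (2 : ℝ) ≤ N := by exact_mod_cast hN
    refine ⟨Y, fun m hm => ?_, fun a b K e h1 h2 h3 h4 => ?_⟩
    · have : m < 4 := by omega
      interval_cases m
      · exact isPathSolution_zero
      · exact isPathSolution_one (by linarith)
      · exact isPathSolution_two (by linarith)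
      · have hN3 : (3 : ℝ) ≤ N := by exact_mod_cast hm
        exact isPathSolution_three (by linarith)
    · have key2 : 1 / (q - 1) < 1 / (q - 3) :=
        one_div_lt_one_div_of_lt (by linarith) (by linarith)
      have key3 : 3 ≤ N → 1 / (q - 1) + (1 / (q - 3) + 1 / (q - 3)) <
          (q - 2) / ((q - 1) * (q - 4)) + q / ((q - 1) * (q - 4)) +
          (q - 2) / ((q - 1) * (q - 4)) := by
        intro hN3
        have hN3 : (3 : ℝ) ≤ N := by exact_mod_cast hN3
        have a1 : 0 < q - 1 := by linarith
        have a3 : 0 < q - 3 := by linarith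
        have a4 : 0 < q - 4 := by linarith
        have e1 : 1 / (q - 1) + (1 / (q - 3) + 1 / (q - 3)) =
          (3 * q - 5) / ((q - 1) * (q - 3)) := by field_simp; ring
        have e2 : (q - 2) / ((q - 1) * (q - 4)) + q / ((q - 1) * (q - 4)) +
          (q - 2) / ((q - 1) * (q - 4)) = (3 * q - 4) / ((q - 1) * (q - 4)) := by
          rw [← add_div, ← add_div]; congr 1; ring
        rw [e1, e2, div_lt_div_iff₀ (by positivity) (by positivity)]
        have : 0 < (q - 1) * (4 * q - 8) := mul_pos a1 (by linarith)
        nlinarith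
      obtain rfl : e = 0 := by omega
      have hab : (a = 1 ∧ b = 1 ∧ K = 2) ∨ (a = 1 ∧ b = 2 ∧ K = 3) ∨ (a = 2 ∧ b = 1 ∧ K = 3) := by
        omega
      rcases hab with ⟨rfl, rfl, rfl⟩ | ⟨rfl, rfl, rfl⟩ | ⟨rfl, rfl, rfl⟩ <;>
        simp [Y, sum_range_succ] at *
      · linarith
      · have := key3 (by omega)
        linarith
      · have := key3 (by omega)
        linarith
  · have h4 : (4 : ℝ) ≤ N := by exact_mod_cast h
    obtain ⟨t, ht, hqt⟩ := exists_path_parameter (q := q) (by linarith)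
    refine ⟨pathValue t, fun m _ => isPathSolution_pathValue ht hqt m, fun a b K e h1 h2 h3 _ => ?_⟩
    simp only [sum_pathValue ht]
    exact pathSum_exchange ht h1 h2 h3

end OuterplanarQ

end

section

/-! ### Vertices outside the closed neighbourhood of the hub -/

namespace OuterplanarQ

open Finset

variable {V : Type*} [Fintype V] {G : SimpleGraph V}

open Classical in
theorem IsOuterplanar.card_common_le (h : IsOuterplanar G) {v u : V} (huv : u ≠ v) :
    ((nbr G v).filter (G.Adj u)).card ≤ 2 := by
  by_contra! hc
  obtain ⟨a, b, c, ha, hb, hc, hab, hac, hbc⟩ := two_lt_card_iff.1 hc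
  simp only [mem_filter, mem_nbr] at ha hb hc
  exact h.no_three_common huv.symm hab hac hbc ha.1 hb.1 hc.1 ha.2 hb.2 hc.2

/-- The data attached to a graph whose `Q`-index is at least the one of the extremal graph: the
positive eigenvector `x` with maximal value at `v`, the sizes `m` of the paths in the
neighbourhood of `v`, solutions `Y` of the path equations, and the resulting test vector `y`. -/
structure HubConfig (G : SimpleGraph V) (k : ℕ) (q : ℝ) (v : V) (x y : V → ℝ)
    {ι : Type} [Fintype ι] (m : ι → ℕ) (e : G.induce (G.neighborSet v) ≃g sigmaPath m)
    (Y : ℕ → ℕ → ℝ) : Prop where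
  outerplanar : IsOuterplanar G
  free : (SimpleGraph.cycleGraph (k + 2)).Free G
  vec : IsHubVector G q v x
  test : IsTestVector G q (1 / (q - 1)) v y
  test_symm : ∀ p, y (e.symm p) = Y (m p.1) p.2
  part_pos : ∀ i, 0 < m i
  part_le : ∀ i, m i ≤ k
  two_le : 2 ≤ k
  sol : ∀ a, IsPathSolution q a (Y a)
  sol_lt : ∀ a i, Y a i < 1 / (q - 5)
  lower : ∀ (κ : Type) [Fintype κ] (f : κ → ℕ), (∀ i, f i ≤ k) →
    1 + ∑ i, f i = Fintype.card V → ((∑ i, f i : ℕ) : ℝ) + ∑ i, ∑ t ∈ range (f i), Y (f i) t ≤ q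
  card_lt : Fintype.card V < q
  five_le : 5 ≤ Fintype.card V

/-! ### Comparison with the extremal graph, and far vertices when n ≥ 7 -/

namespace HubConfig

variable {k : ℕ} {q : ℝ} {v : V} {x y : V → ℝ} {ι : Type} [Fintype ι] {m : ι → ℕ}
  {e : G.induce (G.neighborSet v) ≃g sigmaPath m} {Y : ℕ → ℕ → ℝ}

theorem five_lt (h : HubConfig G k q v x y m e Y) : 5 < q := by
  have h1 := h.card_lt
  have h2 : (5 : ℝ) ≤ Fintype.card V := by exact_mod_cast h.five_le
  linarith

theorem lt_of_mem_nbr (h : HubConfig G k q v x y m e Y) {u : V} (hu : u ∈ nbr G v) :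
    y u < 1 / (q - 5) := by
  obtain ⟨p, rfl⟩ := exists_eq_symm e (mem_nbr.1 hu)
  rw [h.test_symm]
  exact h.sol_lt _ _

theorem pos_of_mem_nbr (h : HubConfig G k q v x y m e Y) {u : V} (hu : u ∈ nbr G v) :
    0 < y u := by
  obtain ⟨p, rfl⟩ := exists_eq_symm e (mem_nbr.1 hu)
  rw [h.test_symm]
  exact (h.sol _).pos _ p.2.2

theorem sum_one (h : HubConfig G k q v x y m e Y) : ∑ t ∈ range 1, Y 1 t = 1 / (q - 1) := by
  have := h.five_lt
  simp [(h.sol 1).one (by linarith)]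

theorem sum_two (h : HubConfig G k q v x y m e Y) : ∑ t ∈ range 2, Y 2 t = 2 / (q - 3) := by
  have := h.five_lt
  obtain ⟨h0, h1⟩ := (h.sol 2).two (by linarith)
  rw [sum_range_succ, sum_range_succ, sum_range_zero, h0, h1]
  ring

theorem sum_three (h : HubConfig G k q v x y m e Y) :
    ∑ t ∈ range 3, Y 3 t = (3 * q - 4) / ((q - 1) * (q - 4)) := by
  have := h.five_lt
  obtain ⟨h0, h1, h2⟩ := (h.sol 3).three (by linarith)
  rw [sum_range_succ, sum_range_succ, sum_range_succ, sum_range_zero, h0, h1, h2]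
  ring

theorem sum_four (h : HubConfig G k q v x y m e Y) :
    ∑ t ∈ range 4, Y 4 t = (4 * q - 8) / (q ^ 2 - 6 * q + 7) := by
  have := h.five_lt
  obtain ⟨h0, h1, h2, h3⟩ := (h.sol 4).four this
  rw [sum_range_succ, sum_range_succ, sum_range_succ, sum_range_succ, sum_range_zero,
    h0, h1, h2, h3]
  ring

/-- Each far vertex is replaced by a one-vertex path at the hub. The sizes of the parts then sum to
n - 1 and `lower` applies; a new part contributes 1 + 1/(q-1). -/
theorem nbr_add_far (h : HubConfig G k q v x y m e Y) :
    (nbr G v).card + ∑ u ∈ nbr G v, y u + (far G v).card * (1 + 1 / (q - 1)) ≤ q := by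
  have hk := h.two_le
  have hsum : ∑ i : ι ⊕ Fin (far G v).card, Sum.elim m (fun _ => 1) i =
      (nbr G v).card + (far G v).card := by
    rw [Fintype.sum_sum_type]
    simp [card_nbr e]
  have hl := h.lower (ι ⊕ Fin (far G v).card) (Sum.elim m fun _ => 1) ?_ ?_
  · rw [hsum, Fintype.sum_sum_type] at hl
    simp only [Sum.elim_inl, Sum.elim_inr, h.sum_one] at hl
    rw [sum_nbr e, sum_congr rfl fun p _ => h.test_symm p,
      sum_sigma_fin fun i t => Y (m i) t]
    simp only [sum_const, card_univ, Fintype.card_fin, nsmul_eq_mul] at hl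
    push_cast at hl
    linarith
  · rintro (i | i)
    · exact h.part_le i
    · simp; omega
  · rw [hsum, ← add_assoc, card_nbr_add_card_far]

-- The identity for the actual graph minus the bound for the rearranged one, with `x w ≤ 1` at the
-- neighbours of far vertices. All later exclusions of far vertices for n ≥ 7 with at most two of
-- them, and for n = 5 and 6, start here.
open Classical in
theorem far_inequality (h : HubConfig G k q v x y m e Y) :
    (1 + 1 / (q - 1)) * ∑ r ∈ far G v, (1 + x r) ≤
      (∑ r ∈ far G v, (1 + x r) * ∑ w ∈ nbr G v with G.Adj r w, (y w + 1 / (q - 1))) +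
      ∑ r ∈ far G v, ∑ r' ∈ far G v, if G.Adj r r' then 2 * (1 / (q - 1)) * x r else 0 := by
  have hq := h.five_lt
  have hρ : q * (1 / (q - 1)) = 1 + 1 / (q - 1) := by
    have : q - 1 ≠ 0 := by linarith
    field_simp
    ring
  have hρ0 : 0 < 1 / (q - 1) := one_div_pos.2 (by linarith)
  have h1 := h.vec.sum_identity h.test hρ
  have h2 := h.nbr_add_far
  have h3 : (∑ r ∈ far G v, ∑ w ∈ nbr G v,
        if G.Adj r w then (x w + x r) * (y w + 1 / (q - 1)) else 0) ≤
      ∑ r ∈ far G v, (1 + x r) * ∑ w ∈ nbr G v with G.Adj r w, (y w + 1 / (q - 1)) := by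
    refine sum_le_sum fun r _ => ?_
    rw [mul_sum, sum_filter]
    refine sum_le_sum fun w hw => ?_
    split_ifs
    · have := h.pos_of_mem_nbr hw
      have := h.vec.le_one w
      exact mul_le_mul_of_nonneg_right (by linarith) (by linarith)
    · exact le_rfl
  rw [sum_add_distrib, sum_const, nsmul_eq_mul, mul_one, mul_add]
  linarith

-- At most two terms, each less than 1/(q-5) + 1/(q-1). The quadratic condition is exactly 2/(q-5) +
-- 1/(q-1) ≤ 1.
open Classical in
theorem sum_common_lt (h : HubConfig G k q v x y m e Y) (hq : 0 ≤ q ^ 2 - 9 * q + 12) {r : V}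
    (hr : r ≠ v) : ∑ w ∈ nbr G v with G.Adj r w, (y w + 1 / (q - 1)) < 1 + 1 / (q - 1) := by
  have hq5 := h.five_lt
  have hρ : 0 < 1 / (q - 1) := one_div_pos.2 (by linarith)
  have hβ : 0 < 1 / (q - 5) := one_div_pos.2 (by linarith)
  have hle : 2 * (1 / (q - 5)) + 1 / (q - 1) ≤ 1 := by
    have a1 : 0 < q - 1 := by linarith
    have a5 : 0 < q - 5 := by linarith
    have : 2 * (1 / (q - 5)) + 1 / (q - 1) = (3 * q - 7) / ((q - 5) * (q - 1)) := by
      field_simp; ring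
    rw [this, div_le_one (by positivity)]
    linarith
  rcases ((nbr G v).filter (G.Adj r)).eq_empty_or_nonempty with h0 | h0
  · rw [h0, sum_empty]; linarith
  · have h2 : (((nbr G v).filter (G.Adj r)).card : ℝ) ≤ 2 := by
      exact_mod_cast h.outerplanar.card_common_le hr
    calc ∑ w ∈ nbr G v with G.Adj r w, (y w + 1 / (q - 1))
        < ∑ w ∈ nbr G v with G.Adj r w, (1 / (q - 5) + 1 / (q - 1)) :=
          sum_lt_sum_of_nonempty h0 fun w hw => by
            have := h.lt_of_mem_nbr (mem_filter.1 hw).1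
            linarith
      _ = ((nbr G v).filter (G.Adj r)).card * (1 / (q - 5) + 1 / (q - 1)) := by
          rw [sum_const, nsmul_eq_mul]
      _ ≤ 2 * (1 / (q - 5) + 1 / (q - 1)) := mul_le_mul_of_nonneg_right h2 (by linarith)
      _ ≤ 1 + 1 / (q - 1) := by linarith

/-- For n ≥ 8 the bound q > n is enough. For n = 7 it is not, and the partition 2 + 2 + 2 gives 6 +
6/(q-3) ≤ q, which is the claim after clearing the denominator. -/
theorem quadratic_nonneg (h : HubConfig G k q v x y m e Y) (hn : 7 ≤ Fintype.card V) :
    0 ≤ q ^ 2 - 9 * q + 12 := by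
  have hq := h.card_lt
  rcases hn.eq_or_lt with hn | hn
  · have hl := h.lower (Fin 3) (fun _ => 2) (fun _ => h.two_le) (by simp [← hn])
    simp only [h.sum_two, sum_const, card_univ, Fintype.card_fin, nsmul_eq_mul] at hl
    have hq5 := h.five_lt
    have a3 : 0 < q - 3 := by linarith
    have : 6 + 6 / (q - 3) ≤ q := by
      calc 6 + 6 / (q - 3) = _ := by push_cast; ring
        _ ≤ q := hl
    have h2 : 6 / (q - 3) ≤ q - 6 := by linarith
    rw [div_le_iff₀ a3] at h2
    linarith
  · have : (8 : ℝ) ≤ Fintype.card V := by exact_mod_cast hn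
    nlinarith

theorem card_far_ne_one_of_seven_le (h : HubConfig G k q v x y m e Y)
    (hn : 7 ≤ Fintype.card V) : (far G v).card ≠ 1 := by
  classical
  intro h1
  obtain ⟨r, hr⟩ := card_eq_one.1 h1
  have hr' : r ∈ far G v := by simp [hr]
  have h2 := h.far_inequality
  simp only [hr, sum_singleton, SimpleGraph.irrefl, if_false, add_zero] at h2
  have h3 := h.sum_common_lt (h.quadratic_nonneg hn) (mem_far.1 hr').1
  have h4 := mul_lt_mul_of_pos_left h3 (show 0 < 1 + x r by linarith [h.vec.pos r])
  linarith

-- If `a` and `b` are common neighbours of `v` and `r`, a further common neighbour of `v` and `r'`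
-- would give a theta between `r` and `v` through `r'`. So `r'` also sees only `a` and `b`, and
-- these have the three common neighbours `v`, `r`, `r'`.
open Classical in
theorem card_common_le_one_of_adj (hG : IsOuterplanar G) {r r' : V} (hr : r ∈ far G v)
    (hr' : r' ∈ far G v) (hadj : G.Adj r r') :
    ((nbr G v).filter (G.Adj r)).card ≤ 1 ∨ ((nbr G v).filter (G.Adj r')).card ≤ 1 := by
  by_contra! hc
  obtain ⟨a, ha, b, hb, hab⟩ := one_lt_card.1 hc.1
  simp only [mem_filter, mem_nbr] at ha hb
  rw [mem_far] at hr hr'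
  have hall : ∀ c, G.Adj v c → G.Adj r' c → c = a ∨ c = b := by
    intro c hvc hrc
    by_contra! hne
    refine hG.no_theta hr.1 hab ha.2 hb.2 ha.1 hb.1 hadj (.cons hvc (.cons hrc.symm .nil))
      hr'.1.symm fun z hz => ?_
    simp only [SimpleGraph.Walk.support_cons, SimpleGraph.Walk.support_nil,
      List.mem_cons, List.not_mem_nil, or_false] at hz
    rcases hz with rfl | rfl | rfl
    · exact ⟨hr.1.symm, ha.1.ne, hb.1.ne⟩
    · exact ⟨fun hz => hr.2 (hz ▸ hvc), hne.1, hne.2⟩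
    · exact ⟨hadj.ne', fun hz => hr'.2 (hz ▸ ha.1), fun hz => hr'.2 (hz ▸ hb.1)⟩
  obtain ⟨c, hc1, d, hd, hcd⟩ := one_lt_card.1 hc.2
  simp only [mem_filter, mem_nbr] at hc1 hd
  have hboth : G.Adj r' a ∧ G.Adj r' b := by
    rcases hall c hc1.1 hc1.2 with rfl | rfl <;> rcases hall d hd.1 hd.2 with rfl | rfl
    · exact absurd rfl hcd
    · exact ⟨hc1.2, hd.2⟩
    · exact ⟨hd.2, hc1.2⟩
    · exact absurd rfl hcd
  exact hG.no_three_common hab hr.1.symm hr'.1.symm hadj.ne ha.1.symm ha.2.symm hboth.1.symm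
    hb.1.symm hb.2.symm hboth.2.symm

/-- Without the edge between the far vertices each one loses separately. With it, one of them has at
most one neighbour around `v`, and its deficit of at least 2(1 + x)/(q-1) pays for the edge term 2(x
+ x')/(q-1), since x' ≤ 1. -/
theorem card_far_ne_two_of_seven_le (h : HubConfig G k q v x y m e Y)
    (hn : 7 ≤ Fintype.card V) : (far G v).card ≠ 2 := by
  classical
  intro h1
  obtain ⟨r, r', hne, hr⟩ := card_eq_two.1 h1
  have hr1 : r ∈ far G v := by simp [hr]
  have hr2 : r' ∈ far G v := by simp [hr]
  have h2 := h.far_inequality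
  simp only [hr, sum_pair hne, SimpleGraph.irrefl, if_false, add_zero, zero_add] at h2
  have hqq := h.quadratic_nonneg hn
  have h3 := h.sum_common_lt hqq (mem_far.1 hr1).1
  have h3' := h.sum_common_lt hqq (mem_far.1 hr2).1
  have hx := h.vec.pos r
  have hx' := h.vec.pos r'
  have h4 := mul_lt_mul_of_pos_left h3 (show 0 < 1 + x r by linarith)
  have h4' := mul_lt_mul_of_pos_left h3' (show 0 < 1 + x r' by linarith)
  have hq7 : (7 : ℝ) < q := lt_of_le_of_lt (by exact_mod_cast hn) h.card_lt
  have hρ : 0 < 1 / (q - 1) := one_div_pos.2 (by linarith)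
  have hβ : 0 < 1 / (q - 5) := one_div_pos.2 (by linarith)
  have hβρ : 1 / (q - 5) + 2 * (1 / (q - 1)) ≤ 1 := by
    have b1 : 1 / (q - 5) ≤ 1 / 2 := one_div_le_one_div_of_le (by norm_num) (by linarith)
    have b2 : 1 / (q - 1) ≤ 1 / 6 := one_div_le_one_div_of_le (by norm_num) (by linarith)
    linarith
  have hsmall : ∀ s, ((nbr G v).filter (G.Adj s)).card ≤ 1 →
      ∑ w ∈ nbr G v with G.Adj s w, (y w + 1 / (q - 1)) ≤ 1 / (q - 5) + 1 / (q - 1) := by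
    intro s hs
    have hs : (((nbr G v).filter (G.Adj s)).card : ℝ) ≤ 1 := by exact_mod_cast hs
    calc ∑ w ∈ nbr G v with G.Adj s w, (y w + 1 / (q - 1))
        ≤ ∑ w ∈ nbr G v with G.Adj s w, (1 / (q - 5) + 1 / (q - 1)) :=
          sum_le_sum fun w hw => by
            have := h.lt_of_mem_nbr (mem_filter.1 hw).1
            linarith
      _ = ((nbr G v).filter (G.Adj s)).card * (1 / (q - 5) + 1 / (q - 1)) := by
          rw [sum_const, nsmul_eq_mul]
      _ ≤ 1 / (q - 5) + 1 / (q - 1) := mul_le_of_le_one_left (by linarith) hs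
  by_cases hadj : G.Adj r r'
  · rw [if_pos hadj, if_pos hadj.symm] at h2
    have hx1 := h.vec.le_one r
    have hx1' := h.vec.le_one r'
    rcases card_common_le_one_of_adj h.outerplanar hr1 hr2 hadj with hc | hc
    · have h5 := mul_le_mul_of_nonneg_left (hsmall r hc) (show 0 ≤ 1 + x r by linarith)
      have h6 := mul_le_mul_of_nonneg_left hβρ (show 0 ≤ 1 + x r by linarith)
      have h7 := mul_le_mul_of_nonneg_left hx1' hρ.le
      linarith
    · have h5 := mul_le_mul_of_nonneg_left (hsmall r' hc) (show 0 ≤ 1 + x r' by linarith)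
      have h6 := mul_le_mul_of_nonneg_left hβρ (show 0 ≤ 1 + x r' by linarith)
      have h7 := mul_le_mul_of_nonneg_left hx1 hρ.le
      linarith
  · rw [if_neg hadj, if_neg fun h => hadj h.symm] at h2
    linarith

/-- With d neighbours and s far vertices, the summed equations give (q - d)(q - 5) ≤ d + 4s. As q >
1 + d + s, this is impossible for s ≥ 3 and n ≥ 10; below that, d > n/2 leaves only n = 9, d = 5, s
= 3, where the partition 2 + 2 + 2 + 2 makes q too large. -/
theorem card_far_le_two (h : HubConfig G k q v x y m e Y) (hn : 7 ≤ Fintype.card V) :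
    (far G v).card ≤ 2 := by
  classical
  by_contra! hs
  have hq := h.card_lt
  have hcard := card_nbr_add_card_far G v
  have h1 := h.vec.mul_sum_le (δ := 2)
    (fun u hu => h.outerplanar.card_common_le (mem_nbr.1 hu).ne')
    (fun r hr => h.outerplanar.card_common_le (mem_far.1 hr).1)
  have h2 := h.vec.eq_card_add
  have h3 := h.vec.le_two_mul_card
  have h4 : (q - (nbr G v).card) * (q - 5) ≤ (nbr G v).card + 4 * (far G v).card := by
    have : ∑ u ∈ nbr G v, x u = q - (nbr G v).card := by linarith
    rw [this] at h1
    push_cast at h1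
    linarith
  have hlarge : Fintype.card V < 2 * (nbr G v).card := by
    have : (Fintype.card V : ℝ) < (2 * (nbr G v).card : ℕ) := by push_cast; linarith
    exact_mod_cast this
  have hcardR : (Fintype.card V : ℝ) = 1 + (nbr G v).card + (far G v).card := by
    rw [← hcard]; push_cast; ring
  have hsR : (3 : ℝ) ≤ (far G v).card := by exact_mod_cast hs
  rcases Nat.lt_or_ge (Fintype.card V) 10 with hn10 | hn10
  · have hd : (nbr G v).card = 5 ∧ (far G v).card = 3 := by omega
    have hl := h.lower (Fin 4) (fun _ => 2) (fun _ => h.two_le) (by simp; omega)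
    simp only [h.sum_two, sum_const, card_univ, Fintype.card_fin, nsmul_eq_mul] at hl
    rw [hd.1, hd.2] at h4
    have hq5 := h.five_lt
    have a3 : 0 < q - 3 := by linarith
    have : 8 + 8 / (q - 3) ≤ q := by
      calc 8 + 8 / (q - 3) = _ := by push_cast; ring
        _ ≤ q := hl
    have h2 : 8 / (q - 3) ≤ q - 8 := by linarith
    rw [div_le_iff₀ a3] at h2
    push_cast at h4
    nlinarith
  · have h10 : (10 : ℝ) ≤ Fintype.card V := by exact_mod_cast hn10
    have a1 : 1 + ((far G v).card : ℝ) < q - (nbr G v).card := by linarith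
    have a2 : (Fintype.card V : ℝ) - 5 < q - 5 := by linarith
    have a3 := mul_lt_mul'' a1 a2 (by linarith) (by linarith)
    nlinarith

end HubConfig

end OuterplanarQ

end

section

/-! ### The neighbours of a single vertex outside the closed neighbourhood -/

namespace OuterplanarQ

open Finset

variable {V : Type*} {G : SimpleGraph V}

section partVertex

variable {v : V} {ι : Type} {m : ι → ℕ}

/-- The vertex number `t` of the path `i` in the neighbourhood of `v`. -/
noncomputable def partVertex (e : G.induce (G.neighborSet v) ≃g sigmaPath m) (i : ι) (t : ℕ) : V :=
  if h : t < m i then e.symm ⟨i, ⟨t, h⟩⟩ else v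

variable (e : G.induce (G.neighborSet v) ≃g sigmaPath m)

theorem partVertex_eq {i : ι} {t : ℕ} (h : t < m i) :
    partVertex e i t = e.symm ⟨i, ⟨t, h⟩⟩ := dif_pos h

theorem adj_partVertex {i : ι} {t : ℕ} (h : t < m i) : G.Adj v (partVertex e i t) := by
  rw [partVertex_eq e h]
  exact adj_of_iso e _

theorem partVertex_inj {i j : ι} {s t : ℕ} (hs : s < m i) (ht : t < m j)
    (h : partVertex e i s = partVertex e j t) : i = j ∧ s = t := by
  rw [partVertex_eq e hs, partVertex_eq e ht] at h
  have h2 := coe_symm_injective e h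
  obtain ⟨rfl, h3⟩ := Sigma.mk.inj_iff.1 h2
  exact ⟨rfl, congrArg Fin.val (eq_of_heq h3)⟩

theorem exists_eq_partVertex {u : V} (h : G.Adj v u) :
    ∃ i t, t < m i ∧ u = partVertex e i t := by
  obtain ⟨⟨i, t⟩, rfl⟩ := exists_eq_symm e h
  exact ⟨i, t, t.2, (partVertex_eq e t.2).symm⟩

theorem partVertex_adj_iff {i j : ι} {s t : ℕ} (hs : s < m i) (ht : t < m j) :
    G.Adj (partVertex e i s) (partVertex e j t) ↔ i = j ∧ (s + 1 = t ∨ t + 1 = s) := by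
  rw [partVertex_eq e hs, partVertex_eq e ht, adj_symm_iff]
  rfl

theorem sum_nbr_partVertex [Fintype V] [Fintype ι]
    (e : G.induce (G.neighborSet v) ≃g sigmaPath m) (f : V → ℝ) :
    ∑ u ∈ nbr G v, f u = ∑ i, ∑ t ∈ range (m i), f (partVertex e i t) := by
  rw [sum_nbr e, ← sum_sigma_fin fun i t => f (partVertex e i t)]
  exact sum_congr rfl fun p _ => by rw [partVertex_eq e p.2.2]

theorem add_part_le [Fintype ι] (m : ι → ℕ) {i j : ι} (hij : i ≠ j) :
    m i + m j ≤ ∑ i, m i := by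
  classical
  rw [← sum_pair hij]
  exact sum_le_sum_of_subset (subset_univ _)

theorem part_le_sum [Fintype ι] (m : ι → ℕ) (i : ι) : m i ≤ ∑ i, m i :=
  single_le_sum (f := m) (fun _ _ => Nat.zero_le _) (mem_univ i)

end partVertex

variable [Fintype V]

theorem IsHubVector.mul_le_list_sum {q : ℝ} {v : V} {x : V → ℝ} (hx : IsHubVector G q v x) {u : V}
    (L : List V) (hL : ∀ w, G.Adj u w → w ∈ L) :
    q * x u ≤ (L.map fun w => x u + x w).sum := by
  classical
  refine (hx.mul_le_sum (T := L.toFinset) fun w hw => List.mem_toFinset.2 (hL w hw)).trans ?_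
  clear hL
  induction L with
  | nil => simp
  | cons a L ih =>
    have h1 := hx.pos u
    have h2 := hx.pos a
    rw [List.toFinset_cons, List.map_cons, List.sum_cons]
    by_cases ha : a ∈ L.toFinset
    · rw [insert_eq_of_mem ha]; linarith
    · rw [sum_insert ha]; linarith

theorem adj_partVertex_cases {v r : V} {ι : Type} {m : ι → ℕ}
    {e : G.induce (G.neighborSet v) ≃g sigmaPath m} (hr : far G v = {r}) {i : ι} {s : ℕ} (hs : s < m i) {w : V}
    (hw : G.Adj (partVertex e i s) w) : w = v ∨ w = r ∨
      ∃ t, t < m i ∧ (s + 1 = t ∨ t + 1 = s) ∧ w = partVertex e i t := by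
  by_cases h1 : w = v
  · exact Or.inl h1
  by_cases h2 : G.Adj v w
  · obtain ⟨j, t, ht, rfl⟩ := exists_eq_partVertex e h2
    obtain ⟨rfl, h3⟩ := (partVertex_adj_iff e hs ht).1 hw
    exact Or.inr (Or.inr ⟨t, ht, h3, rfl⟩)
  · have : w ∈ far G v := mem_far.2 ⟨h1, h2⟩
    rw [hr, mem_singleton] at this
    exact Or.inr (Or.inl this)

theorem ne_partVertex_of_far {v r : V} {ι : Type} {m : ι → ℕ}
    {e : G.induce (G.neighborSet v) ≃g sigmaPath m} (hr : far G v = {r}) {i : ι} {s : ℕ} (hs : s < m i) :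
    r ≠ partVertex e i s := by
  have hr' : r ∈ far G v := by simp [hr]
  exact fun h => (mem_far.1 hr').2 (h ▸ adj_partVertex e hs)

/-- The cycle is v, P₀, P₁, r, P₂, P₃. -/
theorem exists_six_cycle {v r : V} {ι : Type} {m : ι → ℕ}
    {e : G.induce (G.neighborSet v) ≃g sigmaPath m} {i : ι} (hr : far G v = {r}) (hi : m i = 4)
    (h1 : G.Adj r (partVertex e i 1)) (h2 : G.Adj r (partVertex e i 2)) :
    ¬ (SimpleGraph.cycleGraph 6).Free G := by
  have hr' : r ≠ v := (mem_far.1 (show r ∈ far G v by simp [hr])).1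
  let P := partVertex e i
  have hP : ∀ s t, s < 4 → t < 4 → P s = P t → s = t := fun s t hs ht h =>
    (partVertex_inj e (by omega) (by omega) h).2
  have hv : ∀ s, s < 4 → v ≠ P s := fun s hs => (adj_partVertex e (by omega)).ne
  have hrP : ∀ s, s < 4 → r ≠ P s := fun s hs => ne_partVertex_of_far hr (by omega)
  have hadj : ∀ s, s + 1 < 4 → G.Adj (P s) (P (s + 1)) := fun s hs =>
    (partVertex_adj_iff e (by omega) (by omega)).2 ⟨rfl, Or.inl rfl⟩
  let c : ℕ → V := fun t => if t = 0 then v else if t < 3 then P (t - 1) else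
    if t = 3 then r else P (t - 2)
  have c0 : c 0 = v := rfl
  have c1 : c 1 = P 0 := rfl
  have c2 : c 2 = P 1 := rfl
  have c3 : c 3 = r := rfl
  have c4 : c 4 = P 2 := rfl
  have c5 : c 5 = P 3 := rfl
  refine not_free_cycleGraph (c := c) (by norm_num) ⟨?_, ?_⟩ ?_
  · have key : ∀ s t, s < t → t < 6 → c s ≠ c t := by
      intro s t hst ht h
      have hc : ∀ a b, a < 4 → b < 4 → a ≠ b → P a ≠ P b := fun a b ha hb hab h =>
        hab (hP a b ha hb h)
      interval_cases t <;> interval_cases s <;>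
        simp only [c0, c1, c2, c3, c4, c5] at h <;>
        first
          | exact hr' h.symm
          | exact hv _ (by omega) h
          | exact hrP _ (by omega) h
          | exact hrP _ (by omega) h.symm
          | exact hc _ _ (by omega) (by omega) (by omega) h
    intro s hs t ht h
    rcases lt_trichotomy s t with hst | hst | hst
    · exact absurd h (key s t hst ht)
    · exact hst
    · exact absurd h.symm (key t s hst hs)
  · intro t ht
    have : t < 5 := by omega
    interval_cases t
    · rw [c0, c1]; exact adj_partVertex e (by omega)
    · rw [c1, c2]; exact hadj 0 (by omega)
    · rw [c2, c3]; exact h1.symm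
    · rw [c3, c4]; exact h2
    · rw [c4, c5]; exact hadj 2 (by omega)
  · change G.Adj (c 5) (c 0)
    rw [c5, c0]
    exact (adj_partVertex e (by omega)).symm

namespace HubConfig

variable {k : ℕ} {q : ℝ} {v : V} {x y : V → ℝ} {ι : Type} [Fintype ι] {m : ι → ℕ}
  {e : G.induce (G.neighborSet v) ≃g sigmaPath m} {Y : ℕ → ℕ → ℝ} {r : V}

theorem adj_of_adj_far (hr : far G v = {r}) {w : V} (hw : G.Adj r w) : G.Adj v w := by
  have h1 : r ∈ far G v := by rw [hr]; simp
  by_contra h2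
  have : w ∈ far G v := mem_far.2 ⟨fun h => (mem_far.1 h1).2 (h ▸ hw.symm), h2⟩
  rw [hr, mem_singleton] at this
  exact hw.ne' this

/-- The neighbours of the only vertex outside the closed neighbourhood. -/
theorem exists_common (h : HubConfig G k q v x y m e Y) (hr : far G v = {r}) :
    ∃ i s j t, s < m i ∧ t < m j ∧ G.Adj r (partVertex e i s) ∧ G.Adj r (partVertex e j t) ∧
      (∀ w, G.Adj r w → w = partVertex e i s ∨ w = partVertex e j t) ∧
      ((i = j ∧ s = t ∧ 1 ≤ Y (m i) s) ∨
        ((i = j → s ≠ t) ∧ 1 - 1 / (q - 1) ≤ Y (m i) s + Y (m j) t)) := by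
  classical
  have hr' : r ∈ far G v := by simp [hr]
  have hq := h.five_lt
  have hρ : 0 < 1 / (q - 1) := one_div_pos.2 (by linarith)
  have h2 := h.far_inequality
  simp only [hr, sum_singleton, SimpleGraph.irrefl, if_false, add_zero] at h2
  -- With a single far vertex, the factor 1 + x r cancels from both sides.
  have h3 : 1 + 1 / (q - 1) ≤ ∑ w ∈ nbr G v with G.Adj r w, (y w + 1 / (q - 1)) := by
    rw [mul_comm] at h2
    exact le_of_mul_le_mul_left h2 (by linarith [h.vec.pos r])
  have hcard := h.outerplanar.card_common_le (mem_far.1 hr').1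
  have hy : ∀ i s, s < m i → y (partVertex e i s) = Y (m i) s := by
    intro i s hs
    rw [partVertex_eq e hs, h.test_symm]
  have hmem : ∀ w, G.Adj r w → w ∈ (nbr G v).filter (G.Adj r) := fun w hw =>
    mem_filter.2 ⟨mem_nbr.2 (adj_of_adj_far hr hw), hw⟩
  have hcases : ((nbr G v).filter (G.Adj r)).card = 0 ∨ ((nbr G v).filter (G.Adj r)).card = 1 ∨
    ((nbr G v).filter (G.Adj r)).card = 2 := by omega
  rcases hcases with hc | hc | hc
  · rw [card_eq_zero.1 hc, sum_empty] at h3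
    linarith
  · obtain ⟨w, hw⟩ := card_eq_one.1 hc
    have hw1 : w ∈ (nbr G v).filter (G.Adj r) := by rw [hw]; simp
    obtain ⟨hw1, hw2⟩ := mem_filter.1 hw1
    obtain ⟨i, s, hs, rfl⟩ := exists_eq_partVertex e (mem_nbr.1 hw1)
    refine ⟨i, s, i, s, hs, hs, hw2, hw2, fun w' hw' => ?_, Or.inl ⟨rfl, rfl, ?_⟩⟩
    · have := hmem w' hw'
      rw [hw, mem_singleton] at this
      exact Or.inl this
    · rw [hw, sum_singleton, hy i s hs] at h3
      linarith
  · obtain ⟨w, w', hne, hw⟩ := card_eq_two.1 hc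
    have hw1 : w ∈ (nbr G v).filter (G.Adj r) := by rw [hw]; simp
    have hw3 : w' ∈ (nbr G v).filter (G.Adj r) := by rw [hw]; simp
    obtain ⟨hw1, hw2⟩ := mem_filter.1 hw1
    obtain ⟨hw3, hw4⟩ := mem_filter.1 hw3
    obtain ⟨i, s, hs, rfl⟩ := exists_eq_partVertex e (mem_nbr.1 hw1)
    obtain ⟨j, t, ht, rfl⟩ := exists_eq_partVertex e (mem_nbr.1 hw3)
    refine ⟨i, s, j, t, hs, ht, hw2, hw4, fun w' hw' => ?_, Or.inr ⟨?_, ?_⟩⟩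
    · have := hmem w' hw'
      rwa [hw, mem_insert, mem_singleton] at this
    · rintro rfl rfl
      exact hne rfl
    · rw [hw, sum_pair hne, hy i s hs, hy j t ht] at h3
      linarith

theorem sum_nbr_of_single (h : HubConfig G k q v x y m e Y) {i : ι} (hi : m i = ∑ i, m i) :
    q = m i + ∑ t ∈ range (m i), x (partVertex e i t) := by
  have h1 := h.vec.eq_card_add
  rw [card_nbr e, ← hi, sum_nbr_partVertex e, Fintype.sum_eq_single i] at h1
  · exact h1
  · intro j hj
    have := add_part_le m hj
    rw [show m j = 0 by omega, range_zero, sum_empty]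

/-! ### Explicit values on paths with at most four vertices -/

section values

theorem value_one (h : HubConfig G k q v x y m e Y) : Y 1 0 = 1 / (q - 1) :=
  (h.sol 1).one (by linarith [h.five_lt])

theorem value_two (h : HubConfig G k q v x y m e Y) {s : ℕ} (hs : s < 2) :
    Y 2 s = 1 / (q - 3) := by
  obtain ⟨h0, h1⟩ := (h.sol 2).two (by linarith [h.five_lt])
  interval_cases s
  · exact h0
  · exact h1

theorem value_three_le (h : HubConfig G k q v x y m e Y) {s : ℕ} (hs : s < 3) :
    Y 3 s ≤ q / ((q - 1) * (q - 4)) := by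
  have hq := h.five_lt
  obtain ⟨h0, h1, h2⟩ := (h.sol 3).three (by linarith)
  have hD : 0 < (q - 1) * (q - 4) := mul_pos (by linarith) (by linarith)
  interval_cases s
  · rw [h0]; gcongr; linarith
  · rw [h1]
  · rw [h2]; gcongr; linarith

theorem value_three_add_le (h : HubConfig G k q v x y m e Y) {s t : ℕ} (hst : s < t)
    (ht : t < 3) : Y 3 s + Y 3 t ≤ 2 / (q - 4) := by
  have hq := h.five_lt
  obtain ⟨h0, h1, h2⟩ := (h.sol 3).three (by linarith)
  have a1 : 0 < q - 1 := by linarith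
  have a4 : 0 < q - 4 := by linarith
  have hD : 0 < (q - 1) * (q - 4) := mul_pos a1 a4
  have e1 : 2 / (q - 4) = (q - 2) / ((q - 1) * (q - 4)) + q / ((q - 1) * (q - 4)) := by
    field_simp; ring
  have e2 : (q - 2) / ((q - 1) * (q - 4)) ≤ q / ((q - 1) * (q - 4)) := by gcongr; linarith
  interval_cases t <;> interval_cases s
  · rw [h0, h1]; linarith
  · rw [h0, h2]; linarith
  · rw [h1, h2]; linarith

theorem value_four_add_le (h : HubConfig G k q v x y m e Y) {s t : ℕ} (hst : s < t)
    (ht : t < 4) (hne : s ≠ 1 ∨ t ≠ 2) : Y 4 s + Y 4 t ≤ (2 * q - 4) / (q ^ 2 - 6 * q + 7) := by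
  have hq := h.five_lt
  obtain ⟨h0, h1, h2, h3⟩ := (h.sol 4).four hq
  have hD := four_path_denominator_pos hq
  have e1 : (2 * q - 4) / (q ^ 2 - 6 * q + 7) =
      (q - 3) / (q ^ 2 - 6 * q + 7) + (q - 1) / (q ^ 2 - 6 * q + 7) := by ring
  have e2 : (q - 3) / (q ^ 2 - 6 * q + 7) ≤ (q - 1) / (q ^ 2 - 6 * q + 7) := by gcongr; linarith
  interval_cases t <;> interval_cases s <;> first | omega | skip
  · rw [h0, h1]; linarith
  · rw [h0, h2]; linarith
  · rw [h0, h3]; linarith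
  · rw [h1, h3]; linarith
  · rw [h2, h3]; linarith

end values

/-! ### Six vertices: locating the neighbours of the far vertex -/

section six

theorem six_lt (h : HubConfig G k q v x y m e Y) (hn : Fintype.card V = 6) : 6 < q := by
  have := h.card_lt
  rw [hn] at this
  exact_mod_cast this

/-- The partition 3 + 2 of the five vertices other than the hub. The path sums decrease in q, so a
smaller q would violate `lower`; the next two bounds use 4 + 1 and 5 in the same way. -/
theorem bound_three_six (h : HubConfig G k q v x y m e Y) (hn : Fintype.card V = 6)
    (hk : 3 ≤ k) : 6.5 ≤ q := by
  by_contra! hlt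
  have hq := h.six_lt hn
  have hl := h.lower (Fin 2) ![3, 2] (fun i => by fin_cases i <;> simp <;> omega) (by simp [hn])
  simp [Fin.sum_univ_two, h.sum_two, h.sum_three] at hl
  have a1 : 1.1 ≤ (3 * q - 4) / ((q - 1) * (q - 4)) := by
    rw [le_div_iff₀ (mul_pos (by linarith) (by linarith))]
    nlinarith
  have a2 : 0.5 ≤ 2 / (q - 3) := by
    rw [le_div_iff₀ (by linarith)]
    linarith
  linarith

theorem bound_four_six (h : HubConfig G k q v x y m e Y) (hn : Fintype.card V = 6)
    (hk : 4 ≤ k) : 6.7 ≤ q := by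
  by_contra! hlt
  have hq := h.six_lt hn
  have hl := h.lower (Fin 2) ![4, 1] (fun i => by fin_cases i <;> simp <;> omega) (by simp [hn])
  simp only [Fin.sum_univ_two, Matrix.cons_val_zero, Matrix.cons_val_one, h.sum_one,
    h.sum_four] at hl
  have a1 : 1.6 ≤ (4 * q - 8) / (q ^ 2 - 6 * q + 7) := by
    rw [le_div_iff₀ (four_path_denominator_pos (by linarith))]
    nlinarith
  have a2 : 0.17 ≤ 1 / (q - 1) := by
    rw [le_div_iff₀ (by linarith)]
    linarith
  push_cast at hl
  linarith

theorem bound_five_six (h : HubConfig G k q v x y m e Y) (hn : Fintype.card V = 6)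
    (hk : 5 ≤ k) : 6.84 ≤ q := by
  by_contra! hlt
  have hq := h.six_lt hn
  have hl := h.lower (Fin 1) (fun _ => 5) (fun i => hk) (by simp [hn])
  simp only [Fin.sum_univ_one] at hl
  have := (h.sol 5).five hq hlt
  push_cast at hl
  linarith

/-- On six vertices, the vertex outside is adjacent to the two middle vertices of a path on four
vertices. -/
theorem common_six (h : HubConfig G k q v x y m e Y) (hn : Fintype.card V = 6) {i j : ι}
    {s t : ℕ} (hm : ∑ i, m i = 4) (hs : s < m i) (ht : t < m j)
    (hij : (i = j ∧ s = t ∧ 1 ≤ Y (m i) s) ∨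
        ((i = j → s ≠ t) ∧ 1 - 1 / (q - 1) ≤ Y (m i) s + Y (m j) t)) :
    i = j ∧ m i = 4 ∧ ((s = 1 ∧ t = 2) ∨ (s = 2 ∧ t = 1)) := by
  have hq := h.six_lt hn
  have b1 : 1 / (q - 1) ≤ 1 / 5 := one_div_le_one_div_of_le (by norm_num) (by linarith)
  have b3 : 1 / (q - 3) < 1 / 3 := one_div_lt_one_div_of_lt (by norm_num) (by linarith)
  have b5 : 1 / (q - 5) < 1 / 1 := one_div_lt_one_div_of_lt (by norm_num) (by linarith)
  rcases hij with ⟨rfl, rfl, h1⟩ | ⟨hne, h1⟩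
  · have := h.sol_lt (m i) s
    linarith
  by_cases hij : i = j
  · subst hij
    have key : ∀ s t, s < t → t < m i → 1 - 1 / (q - 1) ≤ Y (m i) s + Y (m i) t →
        m i = 4 ∧ s = 1 ∧ t = 2 := by
      intro s t hst ht h1
      have hi4 : m i ≤ 4 := hm ▸ part_le_sum m i
      have hik := h.part_le i
      have hcase : m i = 2 ∨ m i = 3 ∨ m i = 4 := by omega
      rcases hcase with hM | hM | hM <;> rw [hM] at h1 ht hik
      · rw [h.value_two ht, h.value_two (hst.trans ht)] at h1
        linarith
      · have hq2 := h.bound_three_six hn hik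
        have h2 := h.value_three_add_le hst ht
        have h3 : 2 / (q - 4) ≤ 0.8 := by
          rw [div_le_iff₀ (by linarith)]
          linarith
        have h4 : 1 / (q - 1) < 0.2 := by
          rw [div_lt_iff₀ (by linarith)]
          linarith
        linarith
      · refine ⟨hM, ?_⟩
        by_contra hne
        have hq2 := h.bound_four_six hn hik
        have h2 := h.value_four_add_le hst ht (by omega)
        have h3 : (2 * q - 4) / (q ^ 2 - 6 * q + 7) ≤ 0.81 := by
          rw [div_le_iff₀ (four_path_denominator_pos (by linarith))]
          nlinarith
        have h4 : 1 / (q - 1) < 0.18 := by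
          rw [div_lt_iff₀ (by linarith)]
          linarith
        linarith
    rcases (hne rfl).lt_or_gt with hst | hst
    · obtain ⟨h2, h3⟩ := key s t hst ht h1
      exact ⟨rfl, h2, Or.inl h3⟩
    · obtain ⟨h2, h3⟩ := key t s hst hs (by linarith)
      exact ⟨rfl, h2, Or.inr h3.symm⟩
  · exfalso
    have h2 := add_part_le m hij
    rw [hm] at h2
    have hbound : ∀ M s, s < M → M ≤ 3 → M ≤ k → Y M s ≤ 0.2 ∨ (M = 2 ∧ Y M s < 1 / 3) ∨
        (M = 3 ∧ Y M s ≤ 0.5) := by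
      intro M s hsM hM3 hMk
      have : M = 1 ∨ M = 2 ∨ M = 3 := by omega
      rcases this with rfl | rfl | rfl
      · obtain rfl : s = 0 := by omega
        left
        rw [h.value_one]
        linarith
      · right; left
        rw [h.value_two hsM]
        exact ⟨rfl, b3⟩
      · right; right
        refine ⟨rfl, (h.value_three_le hsM).trans ?_⟩
        have hq2 := h.bound_three_six hn hMk
        rw [div_le_iff₀ (mul_pos (by linarith) (by linarith))]
        nlinarith
    rcases hbound _ s hs (by omega) (h.part_le i) with h3 | ⟨h3, h3'⟩ | ⟨h3, h3'⟩ <;>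
    rcases hbound _ t ht (by omega) (h.part_le j) with h4 | ⟨h4, h4'⟩ | ⟨h4, h4'⟩ <;>
    first | omega | linarith

end six

end HubConfig

end OuterplanarQ

end

section

/-! ### Excluding vertices outside the closed neighbourhood on five and six vertices -/

namespace OuterplanarQ

open Finset

variable {V : Type*} {G : SimpleGraph V} [Fintype V]

namespace HubConfig

variable {k : ℕ} {q : ℝ} {v : V} {x y : V → ℝ} {ι : Type} [Fintype ι] {m : ι → ℕ}
  {e : G.induce (G.neighborSet v) ≃g sigmaPath m} {Y : ℕ → ℕ → ℝ} {r : V}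

/-- The two end vertices are not adjacent to `r`, so their equations give (q-2)(x₀+x₃) ≤ 2 + x₁ +
x₂. Substituting q = 4 + x₀ + x₁ + x₂ + x₃ and x₁ + x₂ ≤ 2 leaves the quadratic, that is, q ≤ 4 +
2√2. -/
theorem mul_middle_le (h : HubConfig G k q v x y m e Y) (hn : Fintype.card V = 6)
    (hr : far G v = {r}) {i : ι} (hi : m i = 4) (hm : ∑ i, m i = 4)
    (hmem : ∀ w, G.Adj r w → w = partVertex e i 1 ∨ w = partVertex e i 2) :
    q ^ 2 - 8 * q + 8 ≤ 0 := by
  have hq := h.six_lt hn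
  have hx := h.vec
  have hsum := h.sum_nbr_of_single (i := i) (by rw [hi, hm])
  rw [hi] at hsum
  simp only [sum_range_succ, sum_range_zero, zero_add] at hsum
  have h0 := hx.mul_le_list_sum (u := partVertex e i 0) [v, partVertex e i 1] fun w hw => by
    rcases adj_partVertex_cases hr (by omega) hw with rfl | rfl | ⟨t, ht, h1, rfl⟩
    · simp
    · rcases hmem _ hw.symm with h1 | h1 <;>
        have := (partVertex_inj e (by omega) (by omega) h1).2 <;> omega
    · obtain rfl : t = 1 := by omega
      simp
  have h3 := hx.mul_le_list_sum (u := partVertex e i 3) [v, partVertex e i 2] fun w hw => by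
    rcases adj_partVertex_cases hr (by omega) hw with rfl | rfl | ⟨t, ht, h1, rfl⟩
    · simp
    · rcases hmem _ hw.symm with h1 | h1 <;>
        have := (partVertex_inj e (by omega) (by omega) h1).2 <;> omega
    · obtain rfl : t = 2 := by omega
      simp
  simp only [List.map_cons, List.map_nil, List.sum_cons, List.sum_nil, hx.hub] at h0 h3
  have l1 := hx.le_one (partVertex e i 1)
  have l2 := hx.le_one (partVertex e i 2)
  push_cast at hsum
  generalize x (partVertex e i 0) = x0 at *
  generalize x (partVertex e i 1) = x1 at *
  generalize x (partVertex e i 2) = x2 at *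
  generalize x (partVertex e i 3) = x3 at *
  have e1 : (q - 2) * (x0 + x3) ≤ 2 + (x1 + x2) := by linarith
  have e2 : x0 + x3 = q - 4 - (x1 + x2) := by linarith
  rw [e2] at e1
  have e3 : (q - 1) * (x1 + x2) ≤ (q - 1) * 2 :=
    mul_le_mul_of_nonneg_left (by linarith) (by linarith)
  linarith

/-- The far vertex must sit over the middle edge of a path on four vertices. If k = 4 this creates
the forbidden C₆; if k ≥ 5, a path on five vertices is allowed and forces q ≥ 6.84 > 4 + 2√2. -/
theorem card_far_ne_one_of_six (h : HubConfig G k q v x y m e Y) (hn : Fintype.card V = 6) :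
    (far G v).card ≠ 1 := by
  intro h1
  obtain ⟨r, hr⟩ := card_eq_one.1 h1
  have hm : ∑ i, m i = 4 := by
    have := card_nbr_add_card_far G v
    rw [← card_nbr e]; omega
  obtain ⟨i, s, j, t, hs, ht, ha, hb, hmem, hij⟩ := h.exists_common hr
  obtain ⟨rfl, hi, hst⟩ := h.common_six hn hm hs ht hij
  have hadj : G.Adj r (partVertex e i 1) ∧ G.Adj r (partVertex e i 2) ∧
      ∀ w, G.Adj r w → w = partVertex e i 1 ∨ w = partVertex e i 2 := by
    rcases hst with ⟨rfl, rfl⟩ | ⟨rfl, rfl⟩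
    · exact ⟨ha, hb, hmem⟩
    · exact ⟨hb, ha, fun w hw => (hmem w hw).symm⟩
  have h3 := h.mul_middle_le hn hr hi hm hadj.2.2
  have hk : 4 ≤ k := hi ▸ h.part_le i
  rcases hk.eq_or_lt with hk | hk
  · have hf := h.free
    rw [← hk] at hf
    exact exists_six_cycle hr hi hadj.1 hadj.2.1 hf
  · have := h.bound_five_six hn hk
    nlinarith

/-! ### Five vertices -/

section five

theorem bound_three_five (h : HubConfig G k q v x y m e Y) (hn : Fintype.card V = 5)
    (hk : 3 ≤ k) : 5.7 ≤ q := by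
  by_contra! hlt
  have hq := h.five_lt
  have hl := h.lower (Fin 2) ![3, 1] (fun i => by fin_cases i <;> simp <;> omega) (by simp [hn])
  simp only [Fin.sum_univ_two, Matrix.cons_val_zero, Matrix.cons_val_one, h.sum_one,
    h.sum_three] at hl
  have a1 : 1.6 ≤ (3 * q - 4) / ((q - 1) * (q - 4)) := by
    rw [le_div_iff₀ (mul_pos (by linarith) (by linarith))]
    nlinarith
  have a2 : 0.2 ≤ 1 / (q - 1) := by
    rw [le_div_iff₀ (by linarith)]
    linarith
  push_cast at hl
  linarith

theorem quadratic_nonneg_five (h : HubConfig G k q v x y m e Y) (hn : Fintype.card V = 5) :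
    0 ≤ q ^ 2 - 7 * q + 8 := by
  have hq := h.five_lt
  have hl := h.lower (Fin 2) (fun _ => 2) (fun i => h.two_le) (by simp [hn])
  simp only [sum_const, card_univ, Fintype.card_fin, nsmul_eq_mul, h.sum_two] at hl
  have : 4 + 4 / (q - 3) ≤ q := by
    calc 4 + 4 / (q - 3) = _ := by push_cast; ring
      _ ≤ q := hl
  have h2 : 4 / (q - 3) ≤ q - 4 := by linarith
  rw [div_le_iff₀ (by linarith)] at h2
  linarith

/-- The neighbour of `v` off the two-vertex path is a leaf with value at most 1/(q-1), so q - 5 ≤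
1/(q-1). This contradicts the bound from the partition 2 + 2. -/
theorem not_common_five_two (h : HubConfig G k q v x y m e Y) (hn : Fintype.card V = 5)
    (hr : far G v = {r}) {i : ι} (hi : m i = 2) (hm : ∑ i, m i = 3)
    (hmem : ∀ w, G.Adj r w → w = partVertex e i 0 ∨ w = partVertex e i 1) : False := by
  classical
  have hq := h.five_lt
  have hx := h.vec
  have hsum := hx.eq_card_add
  rw [card_nbr e, hm, sum_nbr_partVertex e, ← add_sum_erase _ _ (mem_univ i), hi] at hsum
  simp only [sum_range_succ, sum_range_zero, zero_add] at hsum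
  have hrest : ∑ j ∈ univ.erase i, ∑ t ∈ range (m j), x (partVertex e j t) ≤ 1 / (q - 1) := by
    calc ∑ j ∈ univ.erase i, ∑ t ∈ range (m j), x (partVertex e j t)
        ≤ ∑ j ∈ univ.erase i, (m j : ℝ) * (1 / (q - 1)) := by
          refine sum_le_sum fun j hj => ?_
          rw [← nsmul_eq_mul]
          refine (sum_le_card_nsmul (range (m j)) _ (1 / (q - 1)) fun t ht => ?_).trans_eq
            (by rw [card_range])
          have ht := mem_range.1 ht
          have hji : j ≠ i := (mem_erase.1 hj).1
          have hj2 := add_part_le m hji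
          have h0 := hx.mul_le_list_sum (u := partVertex e j t) [v] fun w hw => by
            rcases adj_partVertex_cases hr ht hw with rfl | rfl | ⟨t', ht', h1, rfl⟩
            · simp
            · rcases hmem _ hw.symm with h1 | h1 <;>
                exact absurd (partVertex_inj e ht (by omega) h1).1 hji
            · omega
          simp [hx.hub] at h0
          rw [le_div_iff₀ (by linarith)]
          linarith
      _ = 1 / (q - 1) := by
          rw [← sum_mul, ← Nat.cast_sum]
          have := add_sum_erase univ m (mem_univ i)
          rw [show ∑ j ∈ univ.erase i, m j = 1 by omega]
          simp
  have l1 := hx.le_one (partVertex e i 0)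
  have l2 := hx.le_one (partVertex e i 1)
  push_cast at hsum
  have h2 : q - 5 ≤ 1 / (q - 1) := by linarith
  rw [le_div_iff₀ (by linarith)] at h2
  have := h.quadratic_nonneg_five hn
  nlinarith

/-- The equations at both path ends and at `r` bound the end values so tightly that the hub equation
cannot reach 5.7, the bound from the partition 3 + 1. -/
theorem not_common_five_three (h : HubConfig G k q v x y m e Y) (hn : Fintype.card V = 5)
    (hr : far G v = {r}) {i : ι} (hi : m i = 3) (hm : ∑ i, m i = 3) {a c : ℕ}
    (hac : (a = 0 ∧ c = 2) ∨ (a = 2 ∧ c = 0))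
    (hmem : ∀ w, G.Adj r w → w = partVertex e i a ∨ w = partVertex e i 1) : False := by
  have hx := h.vec
  have hq := h.bound_three_five hn (hi ▸ h.part_le i)
  have hsum := h.sum_nbr_of_single (i := i) (by rw [hi, hm])
  rw [hi] at hsum
  simp only [sum_range_succ, sum_range_zero, zero_add] at hsum
  have hsum' : q = 3 + (x (partVertex e i a) + x (partVertex e i 1) + x (partVertex e i c)) := by
    push_cast at hsum
    rcases hac with ⟨rfl, rfl⟩ | ⟨rfl, rfl⟩ <;> linarith
  have ha3 : a < m i := by omega
  have hc3 : c < m i := by omega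
  have hc := hx.mul_le_list_sum (u := partVertex e i c) [v, partVertex e i 1] fun w hw => by
    rcases adj_partVertex_cases hr hc3 hw with rfl | rfl | ⟨t, ht, h1, rfl⟩
    · simp
    · rcases hmem _ hw.symm with h1 | h1 <;>
        have := (partVertex_inj e hc3 (by omega) h1).2 <;> omega
    · obtain rfl : t = 1 := by omega
      simp
  have ha := hx.mul_le_list_sum (u := partVertex e i a) [v, partVertex e i 1, r] fun w hw => by
    rcases adj_partVertex_cases hr ha3 hw with rfl | rfl | ⟨t, ht, h1, rfl⟩
    · simp
    · simp
    · obtain rfl : t = 1 := by omega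
      simp
  have hrr := hx.mul_le_list_sum (u := r) [partVertex e i a, partVertex e i 1] fun w hw => by
    simpa using hmem w hw
  simp only [List.map_cons, List.map_nil, List.sum_cons, List.sum_nil, hx.hub] at ha hc hrr
  have l1 := hx.le_one (partVertex e i 1)
  have pa := hx.pos (partVertex e i a)
  have pc := hx.pos (partVertex e i c)
  have pr := hx.pos r
  generalize x (partVertex e i a) = xa at *
  generalize x (partVertex e i 1) = xb at *
  generalize x (partVertex e i c) = xc at *
  generalize x r = xr at *
  have m1 := mul_le_mul_of_nonneg_right hq pa.le
  have m2 := mul_le_mul_of_nonneg_right hq pc.le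
  have m3 := mul_le_mul_of_nonneg_right hq pr.le
  linarith

theorem card_far_ne_one_of_five (h : HubConfig G k q v x y m e Y) (hn : Fintype.card V = 5) :
    (far G v).card ≠ 1 := by
  intro h1
  obtain ⟨r, hr⟩ := card_eq_one.1 h1
  have hr' : r ∈ far G v := by simp [hr]
  have hm : ∑ i, m i = 3 := by
    have := card_nbr_add_card_far G v
    rw [← card_nbr e]; omega
  have hq := h.five_lt
  have b1 : 1 / (q - 1) < 1 / 4 := one_div_lt_one_div_of_lt (by norm_num) (by linarith)
  have b3 : 1 / (q - 3) < 1 / 2 := one_div_lt_one_div_of_lt (by norm_num) (by linarith)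
  obtain ⟨i, s, j, t, hs, ht, ha, hb, hmem, ⟨rfl, rfl, h2⟩ | ⟨hne, h2⟩⟩ := h.exists_common hr
  · have hi3 : m i ≤ 3 := hm ▸ part_le_sum m i
    have hik := h.part_le i
    have hcase : m i = 1 ∨ m i = 2 ∨ m i = 3 := by omega
    rcases hcase with hM | hM | hM <;> rw [hM] at h2 hs hik
    · obtain rfl : s = 0 := by omega
      rw [h.value_one] at h2
      linarith
    · rw [h.value_two hs] at h2
      linarith
    · have h3 := h.value_three_le hs
      have h4 := h.bound_three_five hn hik
      have h5 : q / ((q - 1) * (q - 4)) < 1 := by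
        rw [div_lt_one (mul_pos (by linarith) (by linarith))]
        nlinarith
      linarith
  · by_cases hij : i = j
    · subst hij
      have hst := hne rfl
      have key : ∀ s t, s < t → t < m i → G.Adj r (partVertex e i s) →
          G.Adj r (partVertex e i t) →
          (∀ w, G.Adj r w → w = partVertex e i s ∨ w = partVertex e i t) → False := by
        intro s t hst ht ha hb hmem
        have hi3 : m i ≤ 3 := hm ▸ part_le_sum m i
        have hcons : t = s + 1 := by
          rw [partVertex_eq e (hst.trans ht)] at ha
          rw [partVertex_eq e ht] at hb
          exact h.outerplanar.consecutive e (mem_far.1 hr').2 (mem_far.1 hr').1 ha hb hst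
        have hcase : (m i = 2 ∧ s = 0 ∧ t = 1) ∨ (m i = 3 ∧ s = 0 ∧ t = 1) ∨
          (m i = 3 ∧ s = 1 ∧ t = 2) := by omega
        rcases hcase with ⟨hM, rfl, rfl⟩ | ⟨hM, rfl, rfl⟩ | ⟨hM, rfl, rfl⟩
        · exact h.not_common_five_two hn hr hM hm hmem
        · exact h.not_common_five_three hn hr hM hm (Or.inl ⟨rfl, rfl⟩) hmem
        · exact h.not_common_five_three hn hr hM hm (Or.inr ⟨rfl, rfl⟩) fun w hw =>
            (hmem w hw).symm
      rcases hst.lt_or_gt with hst | hst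
      · exact key s t hst ht ha hb hmem
      · exact key t s hst hs hb ha fun w hw => (hmem w hw).symm
    · have h3 := add_part_le m hij
      rw [hm] at h3
      have hbound : ∀ M s, s < M → M ≤ 2 → Y M s < 1 / 4 ∨ (M = 2 ∧ Y M s < 1 / 2) := by
        intro M s hsM hM
        have : M = 1 ∨ M = 2 := by omega
        rcases this with rfl | rfl
        · obtain rfl : s = 0 := by omega
          exact Or.inl (h.value_one ▸ b1)
        · exact Or.inr ⟨rfl, (h.value_two hsM) ▸ b3⟩
      rcases hbound _ s hs (by omega) with h4 | ⟨h4, h4'⟩ <;>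
      rcases hbound _ t ht (by omega) with h5 | ⟨h5, h5'⟩ <;>
      first | omega | linarith

end five

/-- Every vertex is in the closed neighbourhood of the hub. -/
theorem far_eq_empty (h : HubConfig G k q v x y m e Y) : far G v = ∅ := by
  have hcard := card_nbr_add_card_far G v
  have hd : Fintype.card V < 2 * (nbr G v).card := by
    have h1 := h.card_lt
    have h2 := h.vec.le_two_mul_card
    have : (Fintype.card V : ℝ) < (2 * (nbr G v).card : ℕ) := by push_cast; linarith
    exact_mod_cast this
  have h5 := h.five_le
  rw [← card_eq_zero]
  rcases Nat.lt_or_ge (Fintype.card V) 7 with hn | hn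
  · have hn : Fintype.card V = 5 ∨ Fintype.card V = 6 := by omega
    rcases hn with hn | hn
    · have := h.card_far_ne_one_of_five hn
      omega
    · have := h.card_far_ne_one_of_six hn
      omega
  · have h1 := h.card_far_ne_one_of_seven_le hn
    have h2 := h.card_far_ne_two_of_seven_le hn
    have h3 := h.card_far_le_two hn
    omega

end HubConfig

end OuterplanarQ

end

section

/-! ### The extremal problem -/

namespace OuterplanarQ

open Finset

variable {V : Type*} [Fintype V] {G : SimpleGraph V} {k N : ℕ} {q : ℝ} {v : V} {x : V → ℝ}
  {ι : Type} {m : ι → ℕ}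

theorem nonempty_iso_fanGraph [Fintype ι] (hk : 0 < k) (hcard : Fintype.card V = N + 1)
    (e : G.induce (G.neighborSet v) ≃g sigmaPath m) (hle : ∀ i, m i ≤ k)
    (hone : ∀ i j, m i < k → m j < k → i = j) (hfar : far G v = ∅) :
    Nonempty (G ≃g fanGraph (N / k) k (N % k)) := by
  have hN : ∑ i, m i = N := by
    have := card_nbr_add_card_far G v
    rw [hfar, card_empty, card_nbr e] at this
    omega
  obtain ⟨e'⟩ := nonempty_iso_pathForest hk hle hone hN
  refine nonempty_iso_join (v := v) (fun u hu => ?_) (e.trans e')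
  by_contra h
  have : u ∈ far G v := mem_far.2 ⟨hu, h⟩
  simp [hfar] at this

/-- Here the pairing identity reads q = N + ∑ S(m i). Two non-full parts would make this strictly
less than N plus the extremal sum, which is at most q. -/
theorem part_unique_of_far_eq_empty [Fintype ι] (hk : 0 < k)
    (hcard : Fintype.card V = N + 1) (hN : 2 ≤ N)
    (hx : IsHubVector G q v x) (hq : N + 1 < q) (hqH : qIndex (fanGraph (N / k) k (N % k)) ≤ q)
    (e : G.induce (G.neighborSet v) ≃g sigmaPath m) (hpos : ∀ i, 0 < m i) (hle : ∀ i, m i ≤ k)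
    (hfar : far G v = ∅) (i j : ι) (hi : m i < k) (hj : m j < k) : i = j := by
  by_contra hij
  have hsum : ∑ i, m i = N := by
    have := card_nbr_add_card_far G v
    rw [hfar, card_empty, card_nbr e] at this
    omega
  have hN0 : (2 : ℝ) ≤ N := by exact_mod_cast hN
  obtain ⟨Y, hY, hex⟩ := exists_path_solutions hN hq
  have hYm : ∀ i, IsPathSolution q (m i) (Y (m i)) := fun i => hY _ (hsum ▸ part_le_sum m i)
  obtain ⟨y, hy, hys⟩ := exists_isTestVector e (Y := fun i => Y (m i)) hYm (1 / (q - 1))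
  have hρ : q * (1 / (q - 1)) = 1 + 1 / (q - 1) := by
    have : q - 1 ≠ 0 := by linarith
    field_simp
    ring
  have h1 := hx.sum_identity hy hρ
  simp only [hfar, sum_empty, mul_zero, add_zero] at h1
  rw [card_nbr e, hsum, sum_nbr e, sum_congr rfl fun p _ => hys p,
    sum_sigma_fin fun i t => Y (m i) t] at h1
  have h2 := le_of_qIndex_fanGraph_le hk (fun a _ ha => hY a ha) hqH
  have h3 := sum_lt_extremalSum (S := fun a => ∑ t ∈ range a, Y a t) hk (by simp)
    (fun a b K e h1 h2 h3 _ h4 => hex a b K e h1 h2 h3 h4) univ m (fun i _ => hle i)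
    (mem_univ i) (mem_univ j) hij (hpos i) hi (hpos j) hj hsum.le
  rw [hsum] at h3
  linarith

theorem far_eq_empty_of_four_le [Fintype ι] (hk : 2 ≤ k) (hcard : Fintype.card V = N + 1) (hN : 4 ≤ N)
    (hG : IsOuterplanar G) (hfree : (SimpleGraph.cycleGraph (k + 2)).Free G)
    (hx : IsHubVector G q v x) (hq : N + 1 < q) (hqH : qIndex (fanGraph (N / k) k (N % k)) ≤ q)
    (e : G.induce (G.neighborSet v) ≃g sigmaPath m) (hpos : ∀ i, 0 < m i)
    (hle : ∀ i, m i ≤ k) : far G v = ∅ := by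
  have h4 : (4 : ℝ) ≤ N := by exact_mod_cast hN
  obtain ⟨t, ht, hqt⟩ := exists_path_parameter (q := q) (by linarith)
  have hsol := isPathSolution_pathValue ht hqt
  obtain ⟨y, hy, hys⟩ := exists_isTestVector e (Y := fun i => pathValue t (m i))
    (fun i => hsol (m i)) (1 / (q - 1))
  have hlow := le_of_qIndex_fanGraph_le (by omega) (fun a _ _ => hsol a) hqH
  refine HubConfig.far_eq_empty (k := k) (e := e) (Y := pathValue t)
    { outerplanar := hG
      free := hfree
      vec := hx
      test := hy
      test_symm := hys
      part_pos := hpos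
      part_le := hle
      two_le := hk
      sol := hsol
      sol_lt := pathValue_lt ht hqt
      lower := fun κ _ f hf hs => ?_
      card_lt := by rw [hcard]; push_cast; exact hq
      five_le := by omega }
  have h1 := sum_le_extremalSum (S := fun a => ∑ i ∈ range a, pathValue t a i) (k := k)
    (T := ∑ i, f i) (by omega) (by simp)
    (fun a b K e h1 h2 h3 _ _ => by
      simp only [sum_pathValue ht]
      exact pathSum_exchange ht h1 h2 h3) univ f (fun i _ => hf i) le_rfl
  have h2 : ∑ i, f i = N := by omega
  rw [h2] at h1 ⊢
  linarith

/-- The neighbours of `v` are pairwise non-adjacent. With d neighbours and s far vertices the summed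
equations yield (1 + s)(d + s) ≤ d + 4s; for s > 0 this means N + 1 ≤ 4, and N + 1 ≤ 2d leaves d =
2, s = 1. -/
theorem far_eq_empty_of_triangle_free (hcard : Fintype.card V = N + 1) (hN : 0 < N)
    (hG : IsOuterplanar G) (hx : IsHubVector G q v x) (hq : N + 1 ≤ q)
    (e : G.induce (G.neighborSet v) ≃g sigmaPath m) (hle : ∀ i, m i ≤ 1) :
    far G v = ∅ ∨ (N = 3 ∧ q ≤ 4) := by
  classical
  have hc := card_nbr_add_card_far G v
  rw [hcard] at hc
  have h1 := hx.mul_sum_le (δ := 0) (fun u hu => ?_)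
    (fun r hr => hG.card_common_le (mem_far.1 hr).1)
  · have h2 := hx.eq_card_add
    have h3 := hx.le_two_mul_card
    have hd : N + 1 ≤ 2 * (nbr G v).card := by
      have : ((N + 1 : ℕ) : ℝ) ≤ (2 * (nbr G v).card : ℕ) := by push_cast; linarith
      exact_mod_cast this
    rcases (far G v).eq_empty_or_nonempty with hs | hs
    · exact Or.inl hs
    right
    have hs : 1 ≤ (far G v).card := card_pos.2 hs
    have hcR : (N : ℝ) = (nbr G v).card + (far G v).card := by
      have : N = (nbr G v).card + (far G v).card := by omega
      rw [this]; push_cast; ring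
    have hsR : (1 : ℝ) ≤ (far G v).card := by exact_mod_cast hs
    have hX : ∑ u ∈ nbr G v, x u = q - (nbr G v).card := by linarith
    rw [hX] at h1
    push_cast at h1
    have hd0 : (0 : ℝ) ≤ (nbr G v).card := Nat.cast_nonneg _
    have h4 : (1 + (far G v).card : ℝ) * ((nbr G v).card + (far G v).card) ≤
        (q - (nbr G v).card) * (q - 1) :=
      mul_le_mul (by linarith) (by linarith) (by linarith) (by linarith)
    have h5 : ((far G v).card : ℝ) * (1 + (nbr G v).card + (far G v).card) ≤
        (far G v).card * 4 := by linarith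
    have h6 := le_of_mul_le_mul_left h5 (by linarith)
    have h7 : 1 + (nbr G v).card + (far G v).card ≤ 4 := by exact_mod_cast h6
    have h8 : (nbr G v).card = 2 := by omega
    rw [h8] at h3
    push_cast at h3
    exact ⟨by omega, by linarith⟩
  · rw [Nat.le_zero, card_eq_zero, filter_eq_empty_iff]
    intro w hw hadj
    obtain ⟨i, s, hs, rfl⟩ := exists_eq_partVertex e (mem_nbr.1 hu)
    obtain ⟨j, t, ht, rfl⟩ := exists_eq_partVertex e (mem_nbr.1 hw)
    obtain ⟨rfl, h⟩ := (partVertex_adj_iff e hs ht).1 hadj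
    have := hle i
    omega

/-- A graph of the class whose `Q`-index is at least the one of the extremal graph is isomorphic
to it, except for triangle-free graphs on four vertices. -/
theorem nonempty_iso_of_qIndex_le (hk : 0 < k) (hcard : Fintype.card V = N + 1)
    (hconn : G.Connected) (hG : IsOuterplanar G)
    (hfree : (SimpleGraph.cycleGraph (k + 2)).Free G)
    (hq : qIndex (fanGraph (N / k) k (N % k)) ≤ qIndex G) :
    Nonempty (G ≃g fanGraph (N / k) k (N % k)) ∨ (N = 3 ∧ k = 1 ∧ qIndex G ≤ 4) := by
  obtain ⟨x, v, hx0, hxv, hx1, hxq⟩ := exists_positive_eigenvector hconn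
  have hx : IsHubVector G (qIndex G) v x := ⟨hx0, hxv, hx1, hxq⟩
  obtain ⟨ι, _, m, hpos, ⟨e⟩⟩ := hG.exists_iso_neighborSet v
  have hle : ∀ i, m i ≤ k := part_le_of_free e rfl (by omega) hfree
  have hc := card_nbr_add_card_far G v
  have hd := hx.le_two_mul_card
  rcases Nat.eq_zero_or_pos N with rfl | hN
  · left
    have hfar : far G v = ∅ := card_eq_zero.1 (by omega)
    refine nonempty_iso_fanGraph hk hcard e hle (fun i j _ _ => ?_) hfar
    have := part_le_sum m i
    have := hpos i
    rw [← card_nbr e] at *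
    omega
  have hqN := (le_qIndex_fanGraph (k := k) hN).trans hq
  rcases (show 1 ≤ k from hk).eq_or_lt with rfl | hk2
  · rcases far_eq_empty_of_triangle_free hcard hN hG hx hqN e hle with hfar | ⟨h3, h4⟩
    · left
      refine nonempty_iso_fanGraph hk hcard e hle (fun i j hi _ => ?_) hfar
      have := hpos i
      omega
    · exact Or.inr ⟨h3, rfl, h4⟩
  left
  rcases (show 1 ≤ N from hN).eq_or_lt with rfl | hN2
  · have hd1 : 0 < (nbr G v).card := by
      by_contra! h0
      rw [Nat.le_zero.1 h0] at hd
      norm_num at hqN hd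
      linarith
    have hfar : far G v = ∅ := card_eq_zero.1 (by omega)
    refine nonempty_iso_fanGraph hk hcard e hle (fun i j _ _ => ?_) hfar
    by_contra hij
    have := add_part_le m hij
    have := hpos i
    have := hpos j
    rw [← card_nbr e] at *
    omega
  have hqN := (lt_qIndex_fanGraph hN2 hk2).trans_le hq
  have hfar : far G v = ∅ := by
    rcases Nat.lt_or_ge N 4 with hN4 | hN4
    -- With N < 4, having more than (N + 1)/2 neighbours means having all N of them.
    · have : N + 1 < 2 * (nbr G v).card := by
        have : ((N + 1 : ℕ) : ℝ) < (2 * (nbr G v).card : ℕ) := by push_cast; linarith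
        exact_mod_cast this
      exact card_eq_zero.1 (by omega)
    · exact far_eq_empty_of_four_le hk2 hcard hN4 hG hfree hx hqN hq e hpos hle
  exact nonempty_iso_fanGraph hk hcard e hle
    (part_unique_of_far_eq_empty hk hcard hN2 hx hqN hq e hpos hle hfar) hfar

end OuterplanarQ

end

theorem theorem1 (n ℓ a r : ℕ) (hn : 1 ≤ n) (hℓ : 3 ≤ ℓ)
    (ha : a = (n - 1) / (ℓ - 2)) (hr : r = n - 1 - a * (ℓ - 2)) :
    -- the graph `K₁ ∨ (a P_{ℓ-2} ∪ P_r)` belongs to the class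
    (Fintype.card (Fin 1 ⊕ ((Fin a × Fin (ℓ - 2)) ⊕ Fin r)) = n ∧
      (OuterplanarQ.fanGraph a (ℓ - 2) r).Connected ∧
      OuterplanarQ.IsOuterplanar (OuterplanarQ.fanGraph a (ℓ - 2) r) ∧
      (SimpleGraph.cycleGraph ℓ).Free (OuterplanarQ.fanGraph a (ℓ - 2) r)) ∧
    -- it has the largest `Q`-index in the class, and is the only such graph
    ∀ (V : Type*) [Fintype V] (G : SimpleGraph V),
      Fintype.card V = n → G.Connected → OuterplanarQ.IsOuterplanar G →
      (SimpleGraph.cycleGraph ℓ).Free G →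
        OuterplanarQ.qIndex G ≤ OuterplanarQ.qIndex (OuterplanarQ.fanGraph a (ℓ - 2) r) ∧
        (¬ (n = 4 ∧ ℓ = 3) →
          (OuterplanarQ.qIndex G = OuterplanarQ.qIndex (OuterplanarQ.fanGraph a (ℓ - 2) r) ↔
            Nonempty (G ≃g OuterplanarQ.fanGraph a (ℓ - 2) r))) := by
  obtain ⟨N, rfl⟩ : ∃ N, n = N + 1 := ⟨n - 1, by omega⟩
  obtain ⟨k, rfl⟩ : ∃ k, ℓ = k + 2 := ⟨ℓ - 2, by omega⟩
  rw [Nat.add_sub_cancel, Nat.add_sub_cancel] at ha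
  rw [Nat.add_sub_cancel, Nat.add_sub_cancel, ha] at hr
  have hk : 0 < k := by omega
  obtain rfl : r = N % k := by
    have := Nat.div_add_mod' N k
    omega
  subst ha
  rw [Nat.add_sub_cancel]
  refine ⟨⟨OuterplanarQ.card_fanGraph, OuterplanarQ.connected_fanGraph _ _ _,
    OuterplanarQ.isOuterplanar_fanGraph _ _ _,
    OuterplanarQ.free_fanGraph rfl hℓ (Nat.mod_lt _ hk).le⟩, ?_⟩
  intro V _ G hcard hconn hG hfree
  have : Nonempty V := hconn.nonempty
  refine ⟨?_, fun hne => ⟨fun h => ?_, fun ⟨e⟩ => OuterplanarQ.qIndex_eq_of_iso e⟩⟩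
  · by_contra! hlt
    rcases OuterplanarQ.nonempty_iso_of_qIndex_le hk hcard hconn hG hfree hlt.le with
      ⟨⟨e⟩⟩ | ⟨rfl, rfl, h4⟩
    · exact hlt.ne' (OuterplanarQ.qIndex_eq_of_iso e)
    -- The exceptional case is harmless for the inequality: q(G) ≤ 4, and 4 is a lower bound for the
    -- star on four vertices.
    · have := OuterplanarQ.le_qIndex_fanGraph (k := 1) (show 0 < 3 by norm_num)
      norm_num at this hlt
      linarith
  · rcases OuterplanarQ.nonempty_iso_of_qIndex_le hk hcard hconn hG hfree h.ge with
      h | ⟨rfl, rfl, _⟩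
    · exact h
    · exact absurd ⟨rfl, rfl⟩ hne
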